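/- Let $\beta>2$. Let $R_n$, $n\ge 1$, be bounded linear operators on a complex Banach space $E$ with $\sum_{k=n+1}^\infty\|R_k\|=O(n^{-\beta})$. Set $R(z)=\sum_{n\ge1}R_nz^n$ for $|z|\le1$, and assume that $1$ is a simple isolated eigenvalue of $R(1)$ (that is, an eigenvalue which is an isolated point of the spectrum and whose spectral projection has rank one), while $I-R(z)$ is invertible for all $|z|\le 1$, $z\ne1$. Let $P$ be the spectral projection of $R(1)$ associated with the eigenvalue $1$, and assume that $PR'(1)P=\mu P$ with $\mu>0$, where $R'(1)$ is the derivative of $R$ at $1$ within the closed unit disk. For $t\in[-\alpha,\alpha]$, where $\alpha>0$, let $R_n(t)$, $n\ge1$, be bounded linear operators on $E$ such that, for some constant $C_0$, for all $t\in[-\alpha,\alpha]$ and all $n\ge0$, $$\sum_{k=n+1}^\infty\|R_k(t)-R_k\|\le \frac{C_0|t|}{(n+1)^{\beta-1}}.$$ Set $R(z,t)=\sum_{n\ge1}R_n(t)z^n$. For $(z,t)$ close to $(1,0)$ with $|z|\le1$, let $\lambda(z,t)$ be the eigenvalue of $R(z,t)$ close to $1$ (so $\lambda(z,t)\to1$ as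 $(z,t)\to(1,0)$). Assume that $\lambda(1,t)=1-M(t)$ with $M(t)\sim ct^2$ as $t\to0$, for some $c\in\mathbb{C}$ with $\operatorname{Re}(c)>0$. Then, for all small enough $t$, $I-R(z,t)$ is invertible for every $|z|<1$, and its inverse has an expansion $\sum_{n\ge0}T_n(t)z^n$ there. Moreover there exist $\alpha'\in(0,\alpha]$, $d>0$ and $C>0$ such that, for all $t\in[-\alpha',\alpha']$ and all $n\ge1$, $$\left\|T_n(t)-\frac1\mu\Bigl(1-\frac1\mu M(t)\Bigr)^nP\right\|\le\frac{C}{n^{\beta-1}}+C|t|\sum_{k=0}^n\frac{1}{(k+1)^{\beta-1}}\,(1-dt^2)^{n-k}.$$ -/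

import Mathlib

open Filter Topology Asymptotics

noncomputable section

/-- The sum `∑_{n ≥ 1} zⁿ Rₙ` of a sequence of operators indexed by the positive integers
(the value `R 0` is never used). -/
def opSeries {E : Type*} [NormedAddCommGroup E] [NormedSpace ℂ E]
    (R : ℕ → E →L[ℂ] E) (z : ℂ) : E →L[ℂ] E :=
  ∑' n : ℕ, z ^ (n + 1) • R (n + 1)

/-- The tail `∑_{k ≥ n+1} ‖R_k‖`. -/
def normTail {E : Type*} [NormedAddCommGroup E] [NormedSpace ℂ E]
    (R : ℕ → E →L[ℂ] E) (n : ℕ) : ℝ :=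
  ∑' k : ℕ, ‖R (n + 1 + k)‖

/-- The derivative at `1` of `R(z) = ∑_{n ≥ 1} zⁿ Rₙ`, as a function on the closed unit disk. -/
def opSeriesDerivOne {E : Type*} [NormedAddCommGroup E] [NormedSpace ℂ E]
    (R : ℕ → E →L[ℂ] E) : E →L[ℂ] E :=
  derivWithin (opSeries R) (Metric.closedBall 0 1) 1

/-- `a` is an isolated point of the spectrum of `A`, and `P` is the associated spectral (Riesz)
projection `(2πi)⁻¹ ∮ (ζ - A)⁻¹ dζ`, the integral being over a circle around `a` that
separates `a` from the rest of the spectrum. -/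
def IsSpectralProjection {E : Type*} [NormedAddCommGroup E] [NormedSpace ℂ E]
    (A : E →L[ℂ] E) (a : ℂ) (P : E →L[ℂ] E) : Prop :=
  ∃ r : ℝ, 0 < r ∧ spectrum ℂ A ∩ Metric.closedBall a r = {a} ∧
    P = (2 * (Real.pi : ℂ) * Complex.I)⁻¹ • ∮ ζ in C(a, r), resolvent A ζ

/-- `a` is a simple isolated eigenvalue of `A`, with spectral projection `P`: it is an eigenvalue,
it is isolated in the spectrum, and its algebraic multiplicity, the rank of `P`, is one. -/
def IsSimpleIsolatedEigenvalue {E : Type*} [NormedAddCommGroup E] [NormedSpace ℂ E]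
    (A : E →L[ℂ] E) (a : ℂ) (P : E →L[ℂ] E) : Prop :=
  Module.End.HasEigenvalue (A : Module.End ℂ E) a ∧ IsSpectralProjection A a P ∧
    Module.finrank ℂ (LinearMap.range (P : E →ₗ[ℂ] E)) = 1

/-- `lam z t` is the eigenvalue close to `1` of `R(z,t)`, for `(z,t)` close to `(1,0)` with
`|z| ≤ 1`. -/
def IsEigenvalueCloseToOne {E : Type*} [NormedAddCommGroup E] [NormedSpace ℂ E]
    (Rt : ℝ → ℕ → E →L[ℂ] E) (lam : ℂ → ℝ → ℂ) : Prop :=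
  (∀ᶠ p : ℂ × ℝ in 𝓝[Metric.closedBall 0 1 ×ˢ Set.univ] (1, 0),
    Module.End.HasEigenvalue (opSeries (Rt p.2) p.1 : Module.End ℂ E) (lam p.1 p.2)) ∧
  Tendsto (fun p : ℂ × ℝ => lam p.1 p.2)
    (𝓝[Metric.closedBall 0 1 ×ˢ Set.univ] (1, 0)) (𝓝 1)

/-- The convolution `∑_{k=0}^n a_k b_{n-k}`. -/
def seqConv (a b : ℕ → ℝ) (n : ℕ) : ℝ :=
  ∑ k ∈ Finset.range (n + 1), a k * b (n - k)

end

/-! ### Coefficientwise majorants of power series. -/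

section Majorants

open PowerSeries

/-! Everything is done with formal power series with operator coefficients, measured by
coefficientwise majorants. Let `S` be the series of the tails of `R`, so that `R(z) = R(1) - (1 - z)
S(z)`, and let `Q = 1 - P`. The factorization `1 - R = G (Q + (1 - z) P)` with `G = (1 - R) Q + S P`
isolates the singularity at `1`: the series `G` is invertible on the whole closed disk, at `z = 1`
because the eigenvalue is simple and `μ ≠ 0`. Wiener's lemma (`exists_majorizes_inverse`) then gives
`H = G⁻¹` coefficients `O(n^(-β))`, and `P H(1) = μ⁻¹ P`.

For small `t`, let `P_t` be the projection onto the eigenvector of `R(1,t)` for `1 - M(t)` that has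
the same kernel as `P`. It need not be the spectral projection, but it is `O(|t|)`-close to `P` by
elementary means (`SimpleEigenvalueData.exists_perturbed_projection`). Regularizing with `P_t` gives
`G_t`, whose inverse `H_t` differs from `H` by `O(|t| n^(-γ))` with `γ = β - 1`, and `1 - R(z,t) =
G_t (Q_t + (1 - z) P_t + M H_t P_t)`. The last factor is block triangular, so inverting it reduces
to inverting the scalar series `1 - z + M h_t`, where `P_t H_t P_t = h_t P_t`
(`one_sub_mul_inverse_eq_one`).

Since `h_0(1) = 1/μ`, the scalar series is close to `1 - (1 - M/μ) z`, whose inverse is the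
geometric series of the statement. The discrepancy is `M` times `(1 - z) c + (h_t - h_0)`, and the
factor `1 - z` cancels the geometric series up to a term of size `M`. The error is absorbed by a
fixed point argument (`majorizes_of_eq_add_mul`) in the weight `v`, the convolution of `(n+1)^(-γ)`
with `(1 - d t²)^n`. This works because `Re c > 0` gives `|1 - M/μ| ≤ 1 - 2 d t²`, and the
convolution of the rates `1 - 2 d t²` and `1 - d t²` is at most `(1 - d t²)^n / (d t²)`, a loss paid
for by the factor `M = O(t²)`. Multiplying back by the operator factors
(`unifBound_inverse_sub_geometric`) leaves a remainder `O(n^(-γ)) + O(|t| v)`. -/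

/-- Coefficientwise comparison of real power series. -/
def CoeffLE (a b : ℝ⟦X⟧) : Prop := ∀ n, coeff n a ≤ coeff n b

/-- `a` majorizes `F`: the norms of the coefficients of `F` are at most those of `a`. -/
def Majorizes {A : Type*} [NormedRing A] (F : A⟦X⟧) (a : ℝ⟦X⟧) : Prop :=
  ∀ n, ‖coeff n F‖ ≤ coeff n a

lemma CoeffLE.refl (a : ℝ⟦X⟧) : CoeffLE a a := fun _ => le_rfl

lemma CoeffLE.trans {a b c : ℝ⟦X⟧} (h : CoeffLE a b) (h' : CoeffLE b c) : CoeffLE a c :=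
  fun n => (h n).trans (h' n)

lemma CoeffLE.smul {a b : ℝ⟦X⟧} {r : ℝ} (hr : 0 ≤ r) (h : CoeffLE a b) :
    CoeffLE (r • a) (r • b) := fun n => by
  simpa using mul_le_mul_of_nonneg_left (h n) hr

lemma CoeffLE.smul_right {a : ℝ⟦X⟧} {r s : ℝ} (hrs : r ≤ s) (h : CoeffLE 0 a) :
    CoeffLE (r • a) (s • a) := fun n => by
  simpa using mul_le_mul_of_nonneg_right hrs (by simpa using h n)

lemma CoeffLE.mul {a b c d : ℝ⟦X⟧} (h : CoeffLE a b) (h' : CoeffLE c d) (ha : CoeffLE 0 a)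
    (hc : CoeffLE 0 c) : CoeffLE (a * c) (b * d) := fun n => by
  simp only [coeff_mul]
  refine Finset.sum_le_sum fun p _ => mul_le_mul (h _) (h' _) (by simpa using hc p.2) ?_
  exact (by simpa using ha p.1 : (0 : ℝ) ≤ _).trans (h _)

lemma CoeffLE.mul_nonneg {a b : ℝ⟦X⟧} (ha : CoeffLE 0 a) (hb : CoeffLE 0 b) :
    CoeffLE 0 (a * b) := fun n => by
  simp only [coeff_mul, map_zero]
  exact Finset.sum_nonneg fun p _ =>
    _root_.mul_nonneg (by simpa using ha p.1) (by simpa using hb p.2)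

variable {A : Type*} [NormedRing A]

lemma Majorizes.trans {F : A⟦X⟧} {a b : ℝ⟦X⟧} (h : Majorizes F a) (h' : CoeffLE a b) :
    Majorizes F b := fun n => (h n).trans (h' n)

lemma Majorizes.add {F G : A⟦X⟧} {a b : ℝ⟦X⟧} (h : Majorizes F a) (h' : Majorizes G b) :
    Majorizes (F + G) (a + b) := fun n => by
  simpa using (norm_add_le _ _).trans (add_le_add (h n) (h' n))

lemma Majorizes.neg {F : A⟦X⟧} {a : ℝ⟦X⟧} (h : Majorizes F a) : Majorizes (-F) a :=
  fun n => by simpa using h n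

lemma Majorizes.mul {F G : A⟦X⟧} {a b : ℝ⟦X⟧} (h : Majorizes F a) (h' : Majorizes G b) :
    Majorizes (F * G) (a * b) := fun n => by
  simp only [coeff_mul]
  refine (norm_sum_le _ _).trans (Finset.sum_le_sum fun p _ => (norm_mul_le _ _).trans ?_)
  exact mul_le_mul (h _) (h' _) (norm_nonneg _) ((norm_nonneg _).trans (h _))

lemma Majorizes.C_mul {F : A⟦X⟧} {a : ℝ⟦X⟧} {B : A} {r : ℝ} (hB : ‖B‖ ≤ r)
    (h : Majorizes F a) : Majorizes (C B * F) (r • a) := fun n => by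
  simp only [coeff_C_mul, coeff_smul, smul_eq_mul]
  exact (norm_mul_le _ _).trans
    (mul_le_mul hB (h n) (norm_nonneg _) ((norm_nonneg _).trans hB))

lemma Majorizes.mul_C {F : A⟦X⟧} {a : ℝ⟦X⟧} {B : A} {r : ℝ} (hB : ‖B‖ ≤ r)
    (h : Majorizes F a) : Majorizes (F * C B) (r • a) := fun n => by
  simp only [coeff_mul_C, coeff_smul, smul_eq_mul]
  refine (norm_mul_le _ _).trans ?_
  rw [mul_comm]
  exact mul_le_mul hB (h n) (norm_nonneg _) ((norm_nonneg _).trans hB)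

/-- If `Y = Z + F Y` where `F` acts on the multiples of `v` with norm at most `1/2`,
then a bound of `Z` by a multiple of `v` gives one of `Y`. -/
lemma majorizes_of_eq_add_mul {Y Z F : A⟦X⟧} {f v : ℝ⟦X⟧} {K : ℝ} (hK : 0 ≤ K)
    (hY : Y = Z + F * Y) (hF : Majorizes F f) (hZ : Majorizes Z (K • v))
    (hfv : CoeffLE (f * v) ((1 / 2 : ℝ) • v)) (hv : ∀ n, 0 < coeff n v) :
    Majorizes Y ((2 * K) • v) := by
  intro n
  induction n using Nat.strong_induction_on with
  | _ n ih =>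
  have hf : ∀ k, 0 ≤ coeff k f := fun k => (norm_nonneg _).trans (hF k)
  have h1 : ‖coeff n Y‖ ≤ K * coeff n v +
      ∑ p ∈ Finset.HasAntidiagonal.antidiagonal n, coeff p.1 f * ‖coeff p.2 Y‖ := by
    conv_lhs => rw [hY]
    rw [map_add, coeff_mul]
    refine (norm_add_le _ _).trans (add_le_add (by simpa using hZ n) ?_)
    exact (norm_sum_le _ _).trans (Finset.sum_le_sum fun p _ => (norm_mul_le _ _).trans
      (mul_le_mul_of_nonneg_right (hF _) (norm_nonneg _)))
  -- The constant term of `F` may be nonzero, so `coeff n Y` occurs on both sides. Including its own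
  -- ratio in `m` treats it like the earlier coefficients, and the factor `1/2` then forces the
  -- ratio below `2 K`.
  set m : ℝ := max (2 * K) (‖coeff n Y‖ / coeff n v) with hm
  have hm0 : 0 ≤ m := le_max_of_le_left (by positivity)
  have h2 : ∀ p ∈ Finset.HasAntidiagonal.antidiagonal n, coeff p.1 f * ‖coeff p.2 Y‖ ≤
      m * (coeff p.1 f * coeff p.2 v) := by
    intro p hp
    have : ‖coeff p.2 Y‖ ≤ m * coeff p.2 v := by
      rcases (show p.2 ≤ n by have := Finset.HasAntidiagonal.mem_antidiagonal.1 hp; omega).lt_or_eq with h | h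
      · refine (ih _ h).trans ?_
        simp only [coeff_smul, smul_eq_mul]
        exact mul_le_mul_of_nonneg_right (le_max_left _ _) (hv _).le
      · rw [h, ← div_le_iff₀ (hv n)]
        exact le_max_right _ _
    calc _ ≤ coeff p.1 f * (m * coeff p.2 v) := mul_le_mul_of_nonneg_left this (hf _)
      _ = _ := by ring
  have h3 : ∑ p ∈ Finset.HasAntidiagonal.antidiagonal n, coeff p.1 f * ‖coeff p.2 Y‖ ≤
      m * (1 / 2 * coeff n v) := by
    refine (Finset.sum_le_sum h2).trans ?_
    rw [← Finset.mul_sum, ← coeff_mul]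
    exact mul_le_mul_of_nonneg_left (by simpa using hfv n) hm0
  have h4 : ‖coeff n Y‖ ≤ (K + m / 2) * coeff n v := by linarith
  simp only [coeff_smul, smul_eq_mul]
  rw [← div_le_iff₀ (hv n)] at h4 ⊢
  rcases max_choice (2 * K) (‖coeff n Y‖ / coeff n v) with h | h
  · rw [← h]; exact le_max_right _ _
  · rw [hm, h] at h4; linarith

end Majorants

/-! ### Polynomial and geometric weights. -/

section Weights

open PowerSeries

/-- The sequence `(n + 1) ^ (-s)`. -/
noncomputable def polyWeight (s : ℝ) : ℝ⟦X⟧ := PowerSeries.mk fun n : ℕ => 1 / ((n : ℝ) + 1) ^ s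

/-- The sequence `r ^ n`. -/
noncomputable def geomWeight (r : ℝ) : ℝ⟦X⟧ := PowerSeries.mk fun n : ℕ => r ^ n

lemma coeff_polyWeight (s : ℝ) (n : ℕ) : coeff n (polyWeight s) = 1 / ((n : ℝ) + 1) ^ s := by
  simp [polyWeight]

lemma coeff_geomWeight (r : ℝ) (n : ℕ) : coeff n (geomWeight r) = r ^ n := by
  simp [geomWeight]

lemma coeff_polyWeight_pos (s : ℝ) (n : ℕ) : 0 < coeff n (polyWeight s) := by
  rw [coeff_polyWeight]; positivity

lemma polyWeight_nonneg (s : ℝ) : CoeffLE 0 (polyWeight s) :=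
  fun n => by simpa using (coeff_polyWeight_pos s n).le

lemma geomWeight_nonneg {r : ℝ} (hr : 0 ≤ r) : CoeffLE 0 (geomWeight r) :=
  fun n => by rw [coeff_geomWeight, map_zero]; positivity

lemma polyWeight_anti {s t : ℝ} (h : s ≤ t) : CoeffLE (polyWeight t) (polyWeight s) := by
  intro n
  rw [coeff_polyWeight, coeff_polyWeight]
  have : (1 : ℝ) ≤ (n : ℝ) + 1 := by linarith [n.cast_nonneg (α := ℝ)]
  exact one_div_le_one_div_of_le (by positivity) (Real.rpow_le_rpow_of_exponent_le this h)

lemma summable_polyWeight {s : ℝ} (hs : 1 < s) : Summable fun n => coeff n (polyWeight s) := by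
  have := (summable_nat_add_iff 1).2 (Real.summable_one_div_nat_rpow.2 hs)
  simpa [coeff_polyWeight] using this

/-- In a pair with `a + b = n`, the larger index is at least `n / 2`, so its weight is at most `2 ^
s` times the weight of `n`; the other weight is summable. Series dominated by this weight thus form
an algebra. -/
lemma polyWeight_mul_self_le {s : ℝ} (hs : 1 < s) :
    ∃ K : ℝ, 0 < K ∧ CoeffLE (polyWeight s * polyWeight s) (K • polyWeight s) := by
  have hsum := summable_polyWeight hs
  set W : ℝ := ∑' n, coeff n (polyWeight s)
  have hW : 0 < W := hsum.tsum_pos (fun n => (coeff_polyWeight_pos s n).le) 0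
    (coeff_polyWeight_pos s 0)
  refine ⟨2 ^ s * (2 * W), by positivity, fun n => ?_⟩
  simp only [coeff_mul, coeff_smul, smul_eq_mul]
  have key : ∀ p ∈ Finset.HasAntidiagonal.antidiagonal n, coeff p.1 (polyWeight s) * coeff p.2 (polyWeight s) ≤
      2 ^ s * coeff n (polyWeight s) *
        (coeff p.1 (polyWeight s) + coeff p.2 (polyWeight s)) := by
    have half : ∀ a : ℕ, n ≤ 2 * a →
        coeff a (polyWeight s) ≤ 2 ^ s * coeff n (polyWeight s) := by
      intro a ha
      have ha' : (n : ℝ) ≤ 2 * a := by exact_mod_cast ha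
      rw [coeff_polyWeight, coeff_polyWeight, mul_one_div,
        div_le_div_iff₀ (by positivity) (by positivity), one_mul,
        ← Real.mul_rpow (by norm_num) (by positivity)]
      exact Real.rpow_le_rpow (by positivity) (by linarith) (by linarith)
    rintro ⟨a, b⟩ hab
    have hab' : a + b = n := by simpa using hab
    have pa := coeff_polyWeight_pos s a
    have pb := coeff_polyWeight_pos s b
    have pn := coeff_polyWeight_pos s n
    have p2 : (0 : ℝ) < 2 ^ s := by positivity
    have pp := mul_pos p2 pn
    rcases le_total a b with h | h
    · have := half b (by omega)
      dsimp only
      nlinarith [mul_le_mul_of_nonneg_left this pa.le, mul_pos pp pb]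
    · have := half a (by omega)
      dsimp only
      nlinarith [mul_le_mul_of_nonneg_right this pb.le, mul_pos pp pa]
  refine (Finset.sum_le_sum key).trans ?_
  rw [← Finset.mul_sum, Finset.sum_add_distrib]
  have e1 : ∑ p ∈ Finset.HasAntidiagonal.antidiagonal n, coeff p.1 (polyWeight s) ≤ W := by
    rw [Finset.Nat.sum_antidiagonal_eq_sum_range_succ_mk]
    exact hsum.sum_le_tsum _ fun k _ => (coeff_polyWeight_pos s k).le
  have e2 : ∑ p ∈ Finset.HasAntidiagonal.antidiagonal n, coeff p.2 (polyWeight s) ≤ W := by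
    rw [← Finset.Nat.sum_antidiagonal_swap]; exact e1
  have pn := coeff_polyWeight_pos s n
  have : 0 ≤ (2 : ℝ) ^ s * coeff n (polyWeight s) := by positivity
  nlinarith [mul_le_mul_of_nonneg_left (add_le_add e1 e2) this]

/-- Bernoulli's inequality for `(1 + 1/x) ^ s`. The difference on the right makes sums over tails
telescope. -/
lemma coeff_polyWeight_succ_le {s : ℝ} (hs : 1 ≤ s) (n : ℕ) :
    coeff (n + 1) (polyWeight (s + 1)) ≤ coeff n (polyWeight s) - coeff (n + 1) (polyWeight s) := by
  simp only [coeff_polyWeight]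
  push_cast
  set x : ℝ := (n : ℝ) + 1
  have hx : 0 < x := by positivity
  have h1 := one_add_mul_self_le_rpow_one_add (s := 1 / x) (by
    have : 0 < 1 / x := by positivity
    linarith) hs
  have e : (1 + 1 / x) ^ s = (x + 1) ^ s / x ^ s := by
    rw [← Real.div_rpow (by positivity) hx.le]; congr 1; field_simp
  rw [e] at h1
  have e2 : 1 / x ^ s - 1 / (x + 1) ^ s = ((x + 1) ^ s / x ^ s - 1) * (1 / (x + 1) ^ s) := by
    have := (Real.rpow_pos_of_pos hx s).ne'
    have := (Real.rpow_pos_of_pos (by positivity : 0 < x + 1) s).ne'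
    field_simp
  rw [e2, Real.rpow_add (by positivity), Real.rpow_one, mul_comm ((x + 1) ^ s),
    ← one_div_mul_one_div]
  refine mul_le_mul_of_nonneg_right ?_ (by positivity)
  calc 1 / (x + 1) ≤ 1 / x := one_div_le_one_div_of_le hx (by linarith)
    _ ≤ s * (1 / x) := le_mul_of_one_le_left (by positivity) hs
    _ ≤ _ := by linarith

/-- The tails of a sequence that is `O(n ^ (-(s + 1)))` are `O(n ^ (-s))`. -/
lemma tsum_norm_tail_le {V : Type*} [NormedAddCommGroup V] {s : ℝ} (hs : 1 ≤ s)
    {C : ℝ} {a : ℕ → V} (ha : ∀ n, ‖a n‖ ≤ C * coeff n (polyWeight (s + 1))) (n : ℕ) :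
    ∑' k, ‖a (n + 1 + k)‖ ≤ C * coeff n (polyWeight s) := by
  have hC : 0 ≤ C := by
    have := (norm_nonneg _).trans (ha 0)
    exact nonneg_of_mul_nonneg_left this (coeff_polyWeight_pos _ 0)
  refine Real.tsum_le_of_sum_range_le (fun _ => norm_nonneg _) fun m => ?_
  calc ∑ k ∈ Finset.range m, ‖a (n + 1 + k)‖
      ≤ ∑ k ∈ Finset.range m, C * (coeff (n + k) (polyWeight s)
          - coeff (n + (k + 1)) (polyWeight s)) := by
        refine Finset.sum_le_sum fun k _ => (ha _).trans (mul_le_mul_of_nonneg_left ?_ hC)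
        have := coeff_polyWeight_succ_le hs (n + k)
        rwa [add_right_comm] 
    _ = C * (coeff n (polyWeight s) - coeff (n + m) (polyWeight s)) := by
        rw [← Finset.mul_sum, Finset.sum_range_sub' fun k => coeff (n + k) (polyWeight s)]
        simp
    _ ≤ _ := mul_le_mul_of_nonneg_left (by linarith [coeff_polyWeight_pos s (n + m)]) hC

end Weights

/-! ### Evaluation of power series in the disk, Cauchy estimates, formal inverses. -/

section Evaluation

open PowerSeries

variable {A : Type*} [NormedRing A]

lemma summable_norm_coeff_mul {F G : A⟦X⟧} {ρ : ℝ} (hρ : 0 ≤ ρ)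
    (hF : Summable fun n => ‖coeff n F‖ * ρ ^ n) (hG : Summable fun n => ‖coeff n G‖ * ρ ^ n) :
    Summable fun n => ‖coeff n (F * G)‖ * ρ ^ n := by
  have h := summable_norm_sum_mul_antidiagonal_of_summable_norm
    (f := fun n => ‖coeff n F‖ * ρ ^ n) (g := fun n => ‖coeff n G‖ * ρ ^ n)
    (by simpa [abs_of_nonneg hρ] using hF) (by simpa [abs_of_nonneg hρ] using hG)
  refine h.of_nonneg_of_le (fun _ => by positivity) fun n => ?_
  refine le_trans ?_ (le_abs_self _)
  rw [coeff_mul]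
  refine (mul_le_mul_of_nonneg_right (norm_sum_le _ _) (by positivity)).trans ?_
  rw [Finset.sum_mul]
  refine Finset.sum_le_sum fun p hp => ?_
  rw [← Finset.HasAntidiagonal.mem_antidiagonal.1 hp, pow_add]
  calc _ ≤ ‖coeff p.1 F‖ * ‖coeff p.2 G‖ * (ρ ^ p.1 * ρ ^ p.2) :=
        mul_le_mul_of_nonneg_right (norm_mul_le _ _) (by positivity)
    _ = _ := by ring

variable [NormedAlgebra ℂ A]

/-- The sum `∑ zⁿ Fₙ` of a power series with coefficients in a complex normed algebra. -/
noncomputable def evalAt (F : A⟦X⟧) (z : ℂ) : A := ∑' n : ℕ, z ^ n • coeff n F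

lemma evalAt_one (z : ℂ) : evalAt (1 : A⟦X⟧) z = 1 := by
  unfold evalAt
  rw [tsum_eq_single 0 fun n hn => by simp [coeff_one, hn]]
  simp

lemma summable_norm_pow_smul {F : A⟦X⟧} {ρ : ℝ} (hF : Summable fun n => ‖coeff n F‖ * ρ ^ n)
    {z : ℂ} (hz : ‖z‖ ≤ ρ) : Summable fun n => ‖z ^ n • coeff n F‖ := by
  refine hF.of_nonneg_of_le (fun _ => norm_nonneg _) fun n => ?_
  rw [norm_smul, norm_pow, mul_comm]
  exact mul_le_mul_of_nonneg_left (pow_le_pow_left₀ (norm_nonneg _) hz n) (norm_nonneg _)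

lemma norm_evalAt_le {F : A⟦X⟧} (hF : Summable fun n => ‖coeff n F‖) {z : ℂ} (hz : ‖z‖ ≤ 1) :
    ‖evalAt F z‖ ≤ ∑' n, ‖coeff n F‖ := by
  refine tsum_of_norm_bounded hF.hasSum fun n => ?_
  rw [norm_smul, norm_pow]
  exact mul_le_of_le_one_left (norm_nonneg _) (pow_le_one₀ (norm_nonneg _) hz)

lemma evalAt_mul [CompleteSpace A] {F G : A⟦X⟧} {z : ℂ}
    (hF : Summable fun n => ‖z ^ n • coeff n F‖) (hG : Summable fun n => ‖z ^ n • coeff n G‖) :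
    evalAt (F * G) z = evalAt F z * evalAt G z := by
  unfold evalAt
  rw [tsum_mul_tsum_eq_tsum_sum_antidiagonal_of_summable_norm hF hG]
  refine tsum_congr fun n => ?_
  rw [coeff_mul, Finset.smul_sum]
  refine Finset.sum_congr rfl fun p hp => ?_
  rw [← Finset.HasAntidiagonal.mem_antidiagonal.1 hp, pow_add, smul_mul_smul_comm]

/-- The formal multilinear series attached to a power series with coefficients in `A`. -/
noncomputable def toFMS (F : A⟦X⟧) : FormalMultilinearSeries ℂ ℂ A :=
  fun n => ContinuousMultilinearMap.mkPiRing ℂ (Fin n) (coeff n F)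

lemma toFMS_coeff (F : A⟦X⟧) (n : ℕ) : (toFMS F).coeff n = coeff n F := by
  simp [toFMS, FormalMultilinearSeries.coeff]

lemma norm_toFMS (F : A⟦X⟧) (n : ℕ) : ‖toFMS F n‖ = ‖coeff n F‖ := by
  simp only [toFMS, ContinuousMultilinearMap.norm_mkPiRing]

lemma toFMS_sum (F : A⟦X⟧) : (toFMS F).sum = evalAt F := by
  ext z
  simp [FormalMultilinearSeries.sum, toFMS, evalAt]

lemma hasFPowerSeriesOnBall_evalAt [CompleteSpace A] {F : A⟦X⟧}
    (hF : ∀ ρ : ℝ, 0 < ρ → ρ < 1 → Summable fun n => ‖coeff n F‖ * ρ ^ n) :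
    HasFPowerSeriesOnBall (evalAt F) (toFMS F) 0 1 := by
  have hr : 1 ≤ (toFMS F).radius := by
    refine ENNReal.le_of_forall_nnreal_lt fun r hr => ?_
    rcases eq_or_ne r 0 with rfl | h0
    · simp
    refine (toFMS F).le_radius_of_summable_norm ?_
    simp only [norm_toFMS]
    exact hF r (by positivity) (by exact_mod_cast hr)
  have h := (toFMS F).hasFPowerSeriesOnBall (zero_lt_one.trans_le hr)
  rw [toFMS_sum] at h
  exact h.mono one_pos hr

/-- **Cauchy's estimate** for a power series with coefficients in `A`. -/
lemma norm_coeff_mul_pow_le [CompleteSpace A] {F : A⟦X⟧}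
    (hF : ∀ ρ : ℝ, 0 < ρ → ρ < 1 → Summable fun n => ‖coeff n F‖ * ρ ^ n)
    {ρ B : ℝ} (h0 : 0 < ρ) (h1 : ρ < 1) (hB : ∀ z : ℂ, ‖z‖ = ρ → ‖evalAt F z‖ ≤ B) (n : ℕ) :
    ‖coeff n F‖ * ρ ^ n ≤ B := by
  have hf := hasFPowerSeriesOnBall_evalAt hF
  have hd : DiffContOnCl ℂ (evalAt F) (Metric.ball 0 ρ) := by
    have := hf.differentiableOn
    refine (DifferentiableOn.mono this fun z hz => ?_).diffContOnCl
    have := Metric.closure_ball_subset_closedBall hz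
    rw [mem_closedBall_zero_iff] at this
    rw [Metric.mem_eball, edist_zero_right, ← ofReal_norm, ← ENNReal.ofReal_one]
    exact (ENNReal.ofReal_lt_ofReal_iff one_pos).2 (this.trans_lt h1)
  have key := Complex.norm_iteratedDeriv_le_of_forall_mem_sphere_norm_le n h0 hd
    fun z hz => hB z (by simpa using hz)
  have e := hf.factorial_smul 1 n
  rw [← iteratedDeriv_eq_iteratedFDeriv] at e
  rw [← e] at key
  have e2 : (toFMS F n fun _ => (1 : ℂ)) = coeff n F := by simp [toFMS]
  rw [e2, ← Nat.cast_smul_eq_nsmul ℂ, norm_smul, Complex.norm_natCast, mul_div_assoc] at key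
  have := le_of_mul_le_mul_left key (by positivity)
  rwa [le_div_iff₀ (by positivity)] at this

lemma eq_of_evalAt_eventuallyEq [CompleteSpace A] {F G : A⟦X⟧} {f : ℂ → A}
    (hF : ∀ᶠ z in 𝓝 (0 : ℂ), HasSum (fun n => z ^ n • coeff n F) (f z))
    (hG : ∀ᶠ z in 𝓝 (0 : ℂ), HasSum (fun n => z ^ n • coeff n G) (f z)) : F = G := by
  have h1 : HasFPowerSeriesAt f (toFMS F) 0 := by
    rw [hasFPowerSeriesAt_iff]; simpa [toFMS_coeff] using hF
  have h2 : HasFPowerSeriesAt f (toFMS G) 0 := by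
    rw [hasFPowerSeriesAt_iff]; simpa [toFMS_coeff] using hG
  ext n
  rw [← toFMS_coeff, h1.eq_formalMultilinearSeries h2, toFMS_coeff]

/-- If `G` converges on the unit disk and is invertible there, its formal inverse
converges on the unit disk. -/
lemma summable_inverse [CompleteSpace A] {G H : A⟦X⟧}
    (hG : ∀ ρ : ℝ, 0 < ρ → ρ < 1 → Summable fun n => ‖coeff n G‖ * ρ ^ n)
    (hinv : ∀ z : ℂ, ‖z‖ < 1 → IsUnit (evalAt G z)) (hHG : H * G = 1) {ρ : ℝ}
    (h0 : 0 < ρ) (h1 : ρ < 1) : Summable fun n => ‖coeff n H‖ * ρ ^ n := by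
  obtain ⟨σ, hσ, hσ1⟩ := exists_between h1
  have hσ0 : 0 < σ := h0.trans hσ
  -- The pointwise inverse is holomorphic; its Taylor series converges inside radius `σ > ρ` and
  -- will be identified with `H`.
  set f : ℂ → A := fun z => Ring.inverse (evalAt G z)
  have hGd := (hasFPowerSeriesOnBall_evalAt hG).differentiableOn
  have hfd : DifferentiableOn ℂ f (Metric.closedBall 0 σ) := by
    intro z hz
    rw [mem_closedBall_zero_iff] at hz
    have hz1 : z ∈ Metric.eball (0 : ℂ) 1 := by
      rw [Metric.mem_eball, edist_zero_right, ← ofReal_norm, ← ENNReal.ofReal_one]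
      exact (ENNReal.ofReal_lt_ofReal_iff one_pos).2 (hz.trans_lt hσ1)
    have hGz := (hGd z hz1).differentiableAt (Metric.isOpen_eball.mem_nhds hz1)
    obtain ⟨u, hu⟩ := hinv z (hz.trans_lt hσ1)
    have : DifferentiableAt ℂ Ring.inverse (evalAt G z) := by
      rw [← hu]; exact differentiableAt_inverse u.isUnit
    exact (this.comp z hGz).differentiableWithinAt
  lift σ to NNReal using hσ0.le
  have hp := hfd.hasFPowerSeriesOnBall (by exact_mod_cast hσ0)
  set p := cauchyPowerSeries f 0 σ
  set F : A⟦X⟧ := PowerSeries.mk fun n => p.coeff n with hFdef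
  have hFn : ∀ n, coeff n F = p.coeff n := fun n => by simp [F]
  have hnorm : ∀ n, ‖coeff n F‖ = ‖p n‖ := fun n => by
    rw [hFn, ← FormalMultilinearSeries.norm_apply_eq_norm_coef]
  have hsum : ∀ r : ℝ, 0 < r → r < σ → Summable fun n => ‖coeff n F‖ * r ^ n := by
    intro r hr hr1
    lift r to NNReal using hr.le
    simp only [hnorm]
    refine p.summable_norm_mul_pow (lt_of_lt_of_le ?_ hp.r_le)
    exact_mod_cast hr1
  have hFG : F * G = 1 := by
    refine eq_of_evalAt_eventuallyEq (f := fun _ => (1 : A)) ?_ ?_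
    · have : ∀ᶠ z : ℂ in 𝓝 0, ‖z‖ < ρ := by
        have := Metric.ball_mem_nhds (0 : ℂ) h0
        filter_upwards [this] with z hz using by simpa using hz
      filter_upwards [this] with z hz
      have s1 := summable_norm_pow_smul (hsum ρ h0 hσ) hz.le
      have s2 := summable_norm_pow_smul (hG ρ h0 h1) hz.le
      have s3 := summable_norm_pow_smul
        (summable_norm_coeff_mul h0.le (hsum ρ h0 hσ) (hG ρ h0 h1)) hz.le
      have e : evalAt F z = f z := by
        have hz' : z ∈ Metric.eball (0 : ℂ) σ := by
          rw [Metric.mem_eball, edist_zero_right, ← ofReal_norm, ← ENNReal.ofReal_coe_nnreal]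
          exact (ENNReal.ofReal_lt_ofReal_iff hσ0).2 (hz.trans hσ)
        have := (hp.hasSum hz').tsum_eq
        rw [zero_add] at this
        rw [← this, evalAt]
        refine tsum_congr fun n => ?_
        rw [hFn, FormalMultilinearSeries.apply_eq_pow_smul_coeff]
      have e2 : evalAt (F * G) z = 1 := by
        rw [evalAt_mul s1 s2, e]
        exact Ring.inverse_mul_cancel _ (hinv z (hz.trans h1))
      rw [← e2]
      exact s3.of_norm.hasSum
    · refine Eventually.of_forall fun z => ?_
      have : HasSum (fun n => z ^ n • coeff n (1 : A⟦X⟧)) (z ^ 0 • coeff 0 (1 : A⟦X⟧)) :=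
        hasSum_single 0 fun n hn => by simp [coeff_one, hn]
      simpa using this
  have hc : constantCoeff H * constantCoeff G = 1 := by rw [← map_mul, hHG, map_one]
  -- Both are left inverses of `G`, and `G` has a formal right inverse because its constant term
  -- `G(0)` is a unit.
  have : H = F := by
    have hu : IsUnit (constantCoeff G) := by
      have := hinv 0 (by simp)
      rwa [evalAt, tsum_eq_single 0 fun n hn => by simp [hn], pow_zero, one_smul,
        coeff_zero_eq_constantCoeff_apply] at this
    obtain ⟨u, hu⟩ := hu
    have hr := mul_invOfUnit G u hu.symm
    exact (left_inv_eq_right_inv hHG hr).trans (left_inv_eq_right_inv hFG hr).symm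
  rw [this]
  exact hsum ρ h0 hσ

end Evaluation

/-! ### Wiener's lemma for polynomially decaying coefficients. -/

section InverseClosed

open PowerSeries

variable {A : Type*} [NormedRing A]

lemma Majorizes.summable {F : A⟦X⟧} {C s : ℝ} (hs : 1 < s)
    (h : Majorizes F (C • polyWeight s)) : Summable fun n => ‖coeff n F‖ :=
  ((summable_polyWeight hs).mul_left C).of_nonneg_of_le (fun _ => norm_nonneg _)
    fun n => by simpa using h n

lemma summable_mul_pow_of_summable {F : A⟦X⟧} (h : Summable fun n => ‖coeff n F‖) {ρ : ℝ}
    (h0 : 0 ≤ ρ) (h1 : ρ ≤ 1) : Summable fun n => ‖coeff n F‖ * ρ ^ n :=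
  h.of_nonneg_of_le (fun _ => by positivity) fun _ =>
    mul_le_of_le_one_right (norm_nonneg _) (pow_le_one₀ h0 h1)

lemma Majorizes.const_nonneg {F : A⟦X⟧} {C s : ℝ} (h : Majorizes F (C • polyWeight s)) :
    0 ≤ C := by
  simpa [coeff_polyWeight] using (norm_nonneg _).trans (h 0)

variable [NormedAlgebra ℂ A]

/-- The Euler operator `z d/dz` on power series. -/
noncomputable def eulerOp (F : A⟦X⟧) : A⟦X⟧ := PowerSeries.mk fun n => (n : ℂ) • coeff n F

lemma coeff_eulerOp (F : A⟦X⟧) (n : ℕ) : coeff n (eulerOp F) = (n : ℂ) • coeff n F := by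
  simp [eulerOp]

lemma eulerOp_mul (F G : A⟦X⟧) : eulerOp (F * G) = eulerOp F * G + F * eulerOp G := by
  ext n
  simp only [coeff_eulerOp, coeff_mul, map_add, Finset.smul_sum, ← Finset.sum_add_distrib]
  refine Finset.sum_congr rfl fun p hp => ?_
  rw [← Finset.HasAntidiagonal.mem_antidiagonal.1 hp, smul_mul_assoc, mul_smul_comm, ← add_smul]
  push_cast
  rfl

/-- Apply the derivation to `H * G = 1`. Decay of the product on the right, divided by `n`, gains
one power for `H`; this drives Wiener's lemma. -/
lemma eulerOp_inverse {G H : A⟦X⟧} (hHG : H * G = 1) (hGH : G * H = 1) :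
    eulerOp H = -(H * eulerOp G * H) := by
  have h1 : eulerOp (H * G) = 0 := by
    rw [hHG]
    ext n
    rcases eq_or_ne n 0 with rfl | hn <;> simp [coeff_eulerOp, coeff_one, *]
  rw [eulerOp_mul] at h1
  calc eulerOp H = eulerOp H * (G * H) := by rw [hGH, mul_one]
    _ = (eulerOp H * G) * H := by rw [mul_assoc]
    _ = _ := by rw [eq_neg_of_add_eq_zero_left h1, neg_mul]

lemma Majorizes.eulerOp {F : A⟦X⟧} {C s : ℝ} (h : Majorizes F (C • polyWeight s)) :
    Majorizes (eulerOp F) (C • polyWeight (s - 1)) := fun n => by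
  have := h n
  simp only [coeff_smul, smul_eq_mul, coeff_polyWeight, coeff_eulerOp] at this ⊢
  rw [norm_smul, Complex.norm_natCast, Real.rpow_sub_one (by positivity)]
  have e : C * (1 / (((n : ℝ) + 1) ^ s / ((n : ℝ) + 1))) =
      ((n : ℝ) + 1) * (C * (1 / ((n : ℝ) + 1) ^ s)) := by
    field_simp
  rw [e]
  exact mul_le_mul (by linarith) this (norm_nonneg _) (by positivity)

lemma Majorizes.of_eulerOp {F : A⟦X⟧} {C s : ℝ}
    (h : Majorizes (_root_.eulerOp F) (C • polyWeight (s - 1))) :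
    ∃ C' : ℝ, Majorizes F (C' • polyWeight s) := by
  have hC : 0 ≤ C := h.const_nonneg
  -- The Euler operator forgets the constant term, which is added back; the factor `2` comes from `n
  -- + 1 ≤ 2 n`.
  refine ⟨2 * C + ‖coeff 0 F‖, fun n => ?_⟩
  have hp := coeff_polyWeight_pos s n
  have h0 := norm_nonneg (coeff 0 F)
  rcases Nat.eq_zero_or_pos n with rfl | hn
  · simp only [coeff_smul, smul_eq_mul, coeff_polyWeight]
    simp [hC]
  have := h n
  simp only [coeff_smul, smul_eq_mul, coeff_eulerOp] at this ⊢
  have hn1 : (1 : ℝ) ≤ n := by exact_mod_cast hn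
  have e : coeff n (polyWeight (s - 1)) = ((n : ℝ) + 1) * coeff n (polyWeight s) := by
    rw [coeff_polyWeight, coeff_polyWeight, Real.rpow_sub_one (by positivity)]
    field_simp
  rw [norm_smul, Complex.norm_natCast, e] at this
  have h2 : (n : ℝ) * ‖coeff n F‖ ≤ n * (2 * C * coeff n (polyWeight s)) := by
    have := mul_nonneg (mul_nonneg hC hp.le) (sub_nonneg.2 hn1)
    linarith
  have h3 := le_of_mul_le_mul_left h2 (by linarith)
  nlinarith [mul_nonneg h0 hp.le]

lemma summable_pow_smul_of_summable {F : A⟦X⟧} (h : Summable fun n => ‖coeff n F‖) {z : ℂ}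
    (hz : ‖z‖ ≤ 1) : Summable fun n => ‖z ^ n • coeff n F‖ :=
  summable_norm_pow_smul (ρ := 1) (by simpa using h) hz

/-- Interpolation between the bounds `2` and `n ‖1 - w‖`. -/
lemma norm_one_sub_pow_le {w : ℂ} (hw : ‖w‖ = 1) {s : ℝ} (hs0 : 0 < s) (hs1 : s ≤ 1) (n : ℕ) :
    ‖1 - w ^ n‖ ≤ 2 * (n : ℝ) ^ s * ‖1 - w‖ ^ s := by
  have h2 : ‖1 - w ^ n‖ ≤ 2 := by
    refine (norm_sub_le _ _).trans ?_
    rw [norm_pow, hw, one_pow, norm_one]; norm_num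
  have hn : ‖1 - w ^ n‖ ≤ n * ‖1 - w‖ := by
    rw [← geom_sum_mul_neg, norm_mul]
    refine mul_le_mul_of_nonneg_right ((norm_sum_le _ _).trans ?_) (norm_nonneg _)
    simp [hw]
  rcases (norm_nonneg (1 - w ^ n)).eq_or_lt with h | h
  · rw [← h]; positivity
  calc ‖1 - w ^ n‖ = ‖1 - w ^ n‖ ^ (1 - s) * ‖1 - w ^ n‖ ^ s := by
        rw [← Real.rpow_add h]; simp
    _ ≤ 2 ^ (1 - s) * (n * ‖1 - w‖) ^ s := by gcongr
    _ ≤ 2 * (n * ‖1 - w‖) ^ s := by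
        refine mul_le_mul_of_nonneg_right ?_ (by positivity)
        calc (2 : ℝ) ^ (1 - s) ≤ 2 ^ (1 : ℝ) :=
              Real.rpow_le_rpow_of_exponent_le (by norm_num) (by linarith)
          _ = 2 := Real.rpow_one 2
    _ = _ := by rw [Real.mul_rpow (by positivity) (norm_nonneg _), mul_assoc]

/-- Hölder regularity along circles of a power series with decaying coefficients. -/
lemma norm_evalAt_sub_rotate_le [CompleteSpace A] {F : A⟦X⟧} {C σ s : ℝ} (hs0 : 0 < s)
    (hs1 : s ≤ 1) (hσ : 1 + s < σ) (hF : Majorizes F (C • polyWeight σ)) :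
    ∃ L : ℝ, 0 ≤ L ∧ ∀ z w : ℂ, ‖z‖ ≤ 1 → ‖w‖ = 1 →
      ‖evalAt F z - evalAt F (w * z)‖ ≤ L * ‖1 - w‖ ^ s := by
  have hsum : Summable fun n : ℕ => ‖coeff n F‖ * (2 * (n : ℝ) ^ s) := by
    refine ((summable_polyWeight (s := σ - s) (by linarith)).mul_left (2 * C)).of_nonneg_of_le
      (fun _ => by positivity) fun n => ?_
    have h := hF n
    have hC : 0 ≤ C * coeff n (polyWeight σ) := (norm_nonneg _).trans (by simpa using h)
    simp only [coeff_smul, smul_eq_mul] at h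
    calc ‖coeff n F‖ * (2 * (n : ℝ) ^ s)
        ≤ C * coeff n (polyWeight σ) * (2 * ((n : ℝ) + 1) ^ s) := by
          gcongr; linarith
      _ = _ := by
          rw [coeff_polyWeight, coeff_polyWeight, Real.rpow_sub (by positivity)]
          field_simp
  have hsF : Summable fun n => ‖coeff n F‖ := hF.summable (by linarith)
  refine ⟨∑' n : ℕ, ‖coeff n F‖ * (2 * (n : ℝ) ^ s), tsum_nonneg fun _ => by positivity,
    fun z w hz hw => ?_⟩
  have hwz : ‖w * z‖ ≤ 1 := by rw [norm_mul, hw, one_mul]; exact hz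
  unfold evalAt
  rw [← Summable.tsum_sub (summable_pow_smul_of_summable hsF hz).of_norm
    (summable_pow_smul_of_summable hsF hwz).of_norm]
  rw [← tsum_mul_right]
  refine tsum_of_norm_bounded (hsum.mul_right _).hasSum fun n => ?_
  rw [mul_pow, ← sub_smul, norm_smul, ← one_sub_mul, norm_mul, norm_pow, mul_comm, mul_assoc]
  refine mul_le_mul_of_nonneg_left ?_ (norm_nonneg _)
  exact (mul_le_of_le_one_right (norm_nonneg _) (pow_le_one₀ (norm_nonneg _) hz)).trans
    (norm_one_sub_pow_le hw hs0 hs1 n)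

lemma continuousOn_evalAt [CompleteSpace A] {F : A⟦X⟧} (h : Summable fun n => ‖coeff n F‖) :
    ContinuousOn (evalAt F) (Metric.closedBall 0 1) := by
  refine continuousOn_tsum (fun n => by fun_prop) h fun n z hz => ?_
  rw [mem_closedBall_zero_iff] at hz
  rw [norm_smul, norm_pow]
  exact mul_le_of_le_one_left (norm_nonneg _) (pow_le_one₀ (norm_nonneg _) hz)

lemma exists_bound_inverse_evalAt [CompleteSpace A] {G : A⟦X⟧}
    (h : Summable fun n => ‖coeff n G‖)
    (hinv : ∀ z : ℂ, ‖z‖ ≤ 1 → IsUnit (evalAt G z)) :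
    ∃ B : ℝ, 0 ≤ B ∧ ∀ z : ℂ, ‖z‖ ≤ 1 → ‖Ring.inverse (evalAt G z)‖ ≤ B := by
  have hc : ContinuousOn (fun z => Ring.inverse (evalAt G z)) (Metric.closedBall 0 1) := by
    intro z hz
    obtain ⟨u, hu⟩ := hinv z (by simpa using hz)
    have : ContinuousAt Ring.inverse (evalAt G z) := by
      rw [← hu]; exact NormedRing.inverse_continuousAt u
    exact this.comp_continuousWithinAt (continuousOn_evalAt h z hz)
  obtain ⟨B, hB⟩ := (isCompact_closedBall (0 : ℂ) 1).exists_bound_of_continuousOn hc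
  exact ⟨B, (norm_nonneg _).trans (hB 0 (by simp)), fun z hz => hB z (by simpa using hz)⟩

/-- A first, non-optimal decay rate for `H`, to start the bootstrap. By compactness `G⁻¹` is bounded
on the disk, so `G⁻¹ (z G') G⁻¹` is Hölder of exponent `s` along circles, and its coefficients are
`O(n^(-s))`. Up to sign these are the `n H_n`. -/
lemma exists_majorizes_inverse_of_holder [CompleteSpace A] {G H : A⟦X⟧} {C β s : ℝ}
    (hs0 : 0 < s) (hs1 : s ≤ 1) (hβ : 2 + s < β) (hG : Majorizes G (C • polyWeight β))
    (hinv : ∀ z : ℂ, ‖z‖ ≤ 1 → IsUnit (evalAt G z)) (hHG : H * G = 1) (hGH : G * H = 1) :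
    ∃ C' : ℝ, Majorizes H (C' • polyWeight (s + 1)) := by
  have hGs : Summable fun n => ‖coeff n G‖ := hG.summable (by linarith)
  have hG' := hG.eulerOp
  have hGs' : Summable fun n => ‖coeff n (eulerOp G)‖ := hG'.summable (by linarith)
  obtain ⟨B, hB0, hB⟩ := exists_bound_inverse_evalAt hGs hinv
  obtain ⟨L, hL0, hL⟩ := norm_evalAt_sub_rotate_le hs0 hs1 (by linarith) hG
  obtain ⟨L', hL0', hL'⟩ := norm_evalAt_sub_rotate_le hs0 hs1 (by linarith) hG'
  set D : ℝ := ∑' n, ‖coeff n (eulerOp G)‖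
  have hD : ∀ z : ℂ, ‖z‖ ≤ 1 → ‖evalAt (eulerOp G) z‖ ≤ D := fun z hz => norm_evalAt_le hGs' hz
  have hD0 : 0 ≤ D := (norm_nonneg _).trans (hD 0 (by simp))
  have hHs : ∀ ρ : ℝ, 0 < ρ → ρ < 1 → Summable fun n => ‖coeff n H‖ * ρ ^ n := fun ρ h0 h1 =>
    summable_inverse (fun r h0 h1 => summable_mul_pow_of_summable hGs h0.le h1.le)
      (fun z hz => hinv z hz.le) hHG h0 h1
  have hHz : ∀ z : ℂ, 0 < ‖z‖ → ‖z‖ < 1 → evalAt H z = Ring.inverse (evalAt G z) := by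
    intro z h0 hz
    have : evalAt H z * evalAt G z = 1 := by
      rw [← evalAt_mul (summable_norm_pow_smul (hHs _ h0 hz) le_rfl)
        (summable_pow_smul_of_summable hGs hz.le), hHG, evalAt_one]
    exact left_inv_eq_right_inv this (Ring.mul_inverse_cancel _ (hinv z hz.le))
  set Φ : A⟦X⟧ := H * eulerOp G * H with hΦ
  have hΦs : ∀ ρ : ℝ, 0 < ρ → ρ < 1 → Summable fun n => ‖coeff n Φ‖ * ρ ^ n := fun ρ h0 h1 =>
    summable_norm_coeff_mul h0.le (summable_norm_coeff_mul h0.le (hHs ρ h0 h1)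
      (summable_mul_pow_of_summable hGs' h0.le h1.le)) (hHs ρ h0 h1)
  have hΦz : ∀ z : ℂ, 0 < ‖z‖ → ‖z‖ < 1 → evalAt Φ z =
      Ring.inverse (evalAt G z) * evalAt (eulerOp G) z * Ring.inverse (evalAt G z) := by
    intro z h0 hz
    have sH := summable_norm_pow_smul (hHs _ h0 hz) le_rfl
    have sG := summable_pow_smul_of_summable hGs' hz.le
    have sHG := summable_norm_pow_smul (summable_norm_coeff_mul h0.le (hHs _ h0 hz)
      (summable_mul_pow_of_summable hGs' h0.le hz.le)) le_rfl
    rw [hΦ, evalAt_mul sHG sH, evalAt_mul sH sG, hHz z h0 hz]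
  set L₀ : ℝ := 2 * (B * B * L * D * B) + B * L' * B with hL₀
  have hL₀0 : 0 ≤ L₀ := by positivity
  have hdiff : ∀ z w : ℂ, 0 < ‖z‖ → ‖z‖ < 1 → ‖w‖ = 1 →
      ‖evalAt Φ z - evalAt Φ (w * z)‖ ≤ L₀ * ‖1 - w‖ ^ s := by
    intro z w h0 hz hw
    have hwz : ‖w * z‖ = ‖z‖ := by rw [norm_mul, hw, one_mul]
    rw [hΦz z h0 hz, hΦz (w * z) (hwz ▸ h0) (hwz ▸ hz)]
    have u1 := hinv z hz.le
    have u2 := hinv (w * z) (hwz ▸ hz.le)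
    have b1 := hB z hz.le
    have b2 := hB (w * z) (hwz ▸ hz.le)
    have d1 := hD z hz.le
    have d2 := hD (w * z) (hwz ▸ hz.le)
    have l1 := hL z w hz.le hw
    have l2 := hL' z w hz.le hw
    set g := evalAt G z
    set g' := evalAt G (w * z)
    set e := evalAt (eulerOp G) z
    set e' := evalAt (eulerOp G) (w * z)
    set h := Ring.inverse g
    set h' := Ring.inverse g'
    set ε := ‖1 - w‖ ^ s
    have hε : 0 ≤ ε := by positivity
    have hh : ‖h - h'‖ ≤ B * (L * ε) * B := by
      have : h - h' = -(h * (g - g') * h') := by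
        have e1 : h * g = 1 := Ring.inverse_mul_cancel _ u1
        have e2 : g' * h' = 1 := Ring.mul_inverse_cancel _ u2
        rw [mul_sub, sub_mul, e1, mul_assoc, e2]; simp
      rw [this, norm_neg]
      exact norm_mul₃_le.trans (by gcongr)
    have : h * e * h - h' * e' * h' =
        (h - h') * e * h + h' * (e - e') * h + h' * e' * (h - h') := by noncomm_ring
    rw [this]
    calc _ ≤ ‖(h - h') * e * h‖ + ‖h' * (e - e') * h‖ + ‖h' * e' * (h - h')‖ := norm_add₃_le
      _ ≤ (B * (L * ε) * B) * D * B + B * (L' * ε) * B + B * D * (B * (L * ε) * B) := by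
          gcongr <;> exact norm_mul₃_le.trans (by gcongr)
      _ = L₀ * ε := by rw [hL₀]; ring
  have hcoeff : ∀ n : ℕ, 0 < n → 2 * ‖coeff n Φ‖ ≤ L₀ * (Real.pi / n) ^ s := by
    intro n hn
    have hn' : (n : ℂ) ≠ 0 := by exact_mod_cast hn.ne'
    set w : ℂ := Complex.exp ((Real.pi / n : ℝ) * Complex.I) with hw
    have hw1 : ‖w‖ = 1 := Complex.norm_exp_ofReal_mul_I _
    have hwn : w ^ n = -1 := by
      rw [hw, ← Complex.exp_nat_mul, ← Complex.exp_pi_mul_I]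
      congr 1
      push_cast
      field_simp
    have hw2 : ‖1 - w‖ ≤ Real.pi / n := by
      rw [norm_sub_rev, hw, mul_comm]
      refine (Real.norm_exp_I_mul_ofReal_sub_one_le).trans ?_
      rw [Real.norm_of_nonneg (by positivity)]
    -- This is the series of `Φ(z) - Φ(w z)`. As `w ^ n = -1`, its `n`-th coefficient is `2 Φ_n`,
    -- which Cauchy's estimate bounds by the Hölder modulus at `‖1 - w‖ ≤ π / n`.
    set Ψ : A⟦X⟧ := PowerSeries.mk fun k => (1 - w ^ k) • coeff k Φ with hΨ
    have hΨk : ∀ k, coeff k Ψ = (1 - w ^ k) • coeff k Φ := fun k => by simp [Ψ]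
    have hΨs : ∀ ρ : ℝ, 0 < ρ → ρ < 1 → Summable fun n => ‖coeff n Ψ‖ * ρ ^ n := by
      intro ρ h0 h1
      refine ((hΦs ρ h0 h1).mul_left 2).of_nonneg_of_le (fun _ => by positivity) fun k => ?_
      rw [hΨk, norm_smul, ← mul_assoc]
      gcongr
      refine (norm_sub_le _ _).trans ?_
      rw [norm_pow, hw1, one_pow, norm_one]; norm_num
    have hbound : ∀ ρ : ℝ, 0 < ρ → ρ < 1 → ‖coeff n Ψ‖ * ρ ^ n ≤ L₀ * (Real.pi / n) ^ s := by
      intro ρ h0 h1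
      refine norm_coeff_mul_pow_le hΨs h0 h1 (fun z hz => ?_) n
      have s1 := (summable_norm_pow_smul (hΦs ρ h0 h1) hz.le).of_norm
      have s2 := (summable_norm_pow_smul (hΦs ρ h0 h1) (z := w * z)
        (by rw [norm_mul, hw1, one_mul, hz])).of_norm
      have : evalAt Ψ z = evalAt Φ z - evalAt Φ (w * z) := by
        unfold evalAt
        rw [← Summable.tsum_sub s1 s2]
        refine tsum_congr fun k => ?_
        rw [hΨk, mul_pow, ← sub_smul, smul_smul]
        congr 1; ring
      rw [this]
      refine (hdiff z w (hz ▸ h0) (hz ▸ h1) hw1).trans ?_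
      gcongr
    -- The bound does not depend on the radius, so the radius can tend to `1`.
    have hlim : Tendsto (fun ρ : ℝ => ‖coeff n Ψ‖ * ρ ^ n) (𝓝[<] 1) (𝓝 (‖coeff n Ψ‖ * 1 ^ n)) :=
      ((continuous_const.mul (continuous_pow n)).tendsto 1).mono_left nhdsWithin_le_nhds
    have := le_of_tendsto hlim (by
      filter_upwards [Ioo_mem_nhdsLT (zero_lt_one (α := ℝ))] with ρ hρ using hbound ρ hρ.1 hρ.2)
    rw [hΨk, hwn, norm_smul] at this
    norm_num at this
    exact this
  have hE := eulerOp_inverse hHG hGH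
  refine Majorizes.of_eulerOp (C := L₀ * Real.pi ^ s * 2 ^ s) (s := s + 1) fun n => ?_
  rw [add_sub_cancel_right, coeff_smul, smul_eq_mul, coeff_polyWeight]
  rcases Nat.eq_zero_or_pos n with rfl | hn
  · simp only [coeff_eulerOp, Nat.cast_zero, zero_smul, norm_zero]; positivity
  have hn1 : (1 : ℝ) ≤ n := by exact_mod_cast hn
  rw [hE, map_neg, norm_neg]
  have h1 := hcoeff n hn
  calc ‖coeff n Φ‖ ≤ L₀ * (Real.pi / n) ^ s := by linarith [norm_nonneg (coeff n Φ)]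
    _ ≤ L₀ * (Real.pi * 2 / (n + 1)) ^ s := by
        gcongr L₀ * ?_ ^ s
        rw [div_le_div_iff₀ (by positivity) (by positivity)]
        nlinarith [Real.pi_pos]
    _ = _ := by
        rw [Real.div_rpow (by positivity) (by positivity), Real.mul_rpow (by positivity)
          (by positivity)]
        ring

/-- **Wiener's lemma** for the algebra of power series with coefficients `O(n ^ (-β))`, `β > 2`,
in a Banach algebra. -/
theorem exists_majorizes_inverse [CompleteSpace A] {G H : A⟦X⟧} {C β : ℝ} (hβ : 2 < β)
    (hG : Majorizes G (C • polyWeight β)) (hinv : ∀ z : ℂ, ‖z‖ ≤ 1 → IsUnit (evalAt G z))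
    (hHG : H * G = 1) (hGH : G * H = 1) :
    ∃ C' : ℝ, Majorizes H (C' • polyWeight β) := by
  -- Halving `β - 2` keeps the inequality `2 + s < β` strict.
  set s : ℝ := min 1 ((β - 2) / 2) with hs
  have hs0 : 0 < s := lt_min one_pos (by linarith)
  have hs1 : s ≤ 1 := min_le_left _ _
  have hs2 : 2 + s < β := by linarith [min_le_right 1 ((β - 2) / 2)]
  -- Bootstrap: if `H` decays at rate `σ > 1`, then `H (z G') H` decays at rate `min σ (β - 1)`, and
  -- `H` gains one more power, up to the ceiling `β`.
  have key : ∀ j : ℕ, ∃ C' : ℝ, Majorizes H (C' • polyWeight (min (s + 1 + j) β)) := by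
    intro j
    induction j with
    | zero =>
      obtain ⟨C', h⟩ := exists_majorizes_inverse_of_holder hs0 hs1 hs2 hG hinv hHG hGH
      refine ⟨C', ?_⟩
      rw [min_eq_left (by push_cast; linarith)]
      simpa using h
    | succ j ih =>
      obtain ⟨C₁, h⟩ := ih
      set σ := min (s + 1 + j) β
      have hσ1 : 1 < σ := lt_min (by linarith [j.cast_nonneg (α := ℝ)]) (by linarith)
      set τ := min σ (β - 1)
      have hτ1 : 1 < τ := lt_min hσ1 (by linarith)
      have hC₁ := h.const_nonneg
      have hC := hG.const_nonneg
      have h1 : Majorizes H (C₁ • polyWeight τ) :=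
        h.trans ((polyWeight_anti (min_le_left _ _)).smul hC₁)
      have h2 : Majorizes (eulerOp G) (C • polyWeight τ) :=
        hG.eulerOp.trans ((polyWeight_anti (min_le_right _ _)).smul hC)
      obtain ⟨K, hK0, hK⟩ := polyWeight_mul_self_le hτ1
      have h3 : Majorizes (eulerOp H) ((C₁ * C * C₁ * K * K) • polyWeight τ) := by
        rw [eulerOp_inverse hHG hGH]
        refine ((h1.mul h2).mul h1).neg.trans ?_
        have e : C₁ • polyWeight τ * C • polyWeight τ * C₁ • polyWeight τ =
            (C₁ * C * C₁) • (polyWeight τ * polyWeight τ * polyWeight τ) := by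
          simp only [smul_mul_smul_comm]
        have n0 := polyWeight_nonneg τ
        have e2 : CoeffLE (polyWeight τ * polyWeight τ * polyWeight τ)
            ((K * K) • polyWeight τ) := by
          refine (hK.mul (CoeffLE.refl _) (n0.mul_nonneg n0) n0).trans ?_
          rw [smul_mul_assoc, mul_smul]
          exact hK.smul hK0.le
        have e3 := e2.smul (r := C₁ * C * C₁) (by positivity)
        rw [smul_smul] at e3
        rwa [e, mul_assoc (C₁ * C * C₁) K K]
      have h4 : min (s + 1 + (j + 1 : ℕ)) β ≤ τ + 1 := by
        push_cast
        simp only [τ, σ]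
        rcases le_total (s + 1 + j) β with h | h
        · rw [min_eq_left h]
          rcases le_total (s + 1 + j) (β - 1) with h' | h'
          · rw [min_eq_left h']; exact (min_le_left _ _).trans (by linarith)
          · rw [min_eq_right h']; exact (min_le_right _ _).trans (by linarith)
        · rw [min_eq_right h, min_eq_right (by linarith : β - 1 ≤ β)]
          exact (min_le_right _ _).trans (by linarith)
      obtain ⟨C₂, h5⟩ := Majorizes.of_eulerOp (F := H) (s := τ + 1)
        (C := C₁ * C * C₁ * K * K) (by rwa [add_sub_cancel_right])
      exact ⟨C₂, h5.trans ((polyWeight_anti h4).smul (h5.const_nonneg))⟩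
  obtain ⟨j, hj⟩ := exists_nat_gt β
  obtain ⟨C', h⟩ := key j
  refine ⟨C', ?_⟩
  rwa [min_eq_right (by linarith)] at h

end InverseClosed

/-! ### Consequences of the Riesz projection having rank one. -/

section SpectralProjection

lemma circleIntegral_clm_comp {V W : Type*} [NormedAddCommGroup V] [NormedSpace ℂ V]
    [CompleteSpace V] [NormedAddCommGroup W] [NormedSpace ℂ W] [CompleteSpace W]
    (L : V →L[ℂ] W) {f : ℂ → V} {a : ℂ} {r : ℝ} (hf : CircleIntegrable f a r) :
    (∮ z in C(a, r), L (f z)) = L (∮ z in C(a, r), f z) := by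
  simp only [circleIntegral]
  rw [← L.intervalIntegral_comp_comm hf.out]
  simp

variable {E : Type*} [NormedAddCommGroup E] [NormedSpace ℂ E]

/-- The properties of a simple isolated eigenvalue `1` of `K` with spectral projection `P`
that are used below. -/
structure SimpleEigenvalueData (K P : E →L[ℂ] E) : Prop where
  idem : P * P = P
  mul_proj : K * P = P
  proj_mul : P * K = P
  isUnit : IsUnit (1 - K + P)
  ne_zero : P ≠ 0
  rank_one : ∀ x, P x ≠ 0 → ∀ y, ∃ a : ℂ, P y = a • P x

lemma SimpleEigenvalueData.exists_smul {K P : E →L[ℂ] E} (h : SimpleEigenvalueData K P)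
    (B : E →L[ℂ] E) : ∃ s : ℂ, P * B * P = s • P := by
  obtain ⟨x, hx⟩ : ∃ x, P x ≠ 0 := by
    by_contra! hc
    exact h.ne_zero (ContinuousLinearMap.ext hc)
  obtain ⟨s, hs⟩ := h.rank_one x hx (B (P x))
  refine ⟨s, ContinuousLinearMap.ext fun y => ?_⟩
  obtain ⟨a, ha⟩ := h.rank_one x hx y
  simp only [mul_apply_eq_comp, smul_apply, ha, map_smul, hs]
  exact smul_comm _ _ _

/-- An eigenvector `v` satisfies `(ζ - K)⁻¹ v = (ζ - 1)⁻¹ v`, so the contour integral gives `P v =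
v`. Since `P` has rank one, its range is spanned by `v`, whence `P * P = P` and `K * P = P`.
Invertibility of `1 - K + P` comes from the reduced resolvent `J`, the contour integral of `(ζ -
1)⁻¹ (ζ - K)⁻¹`, which inverts `1 - K` modulo `P`. -/
theorem IsSimpleIsolatedEigenvalue.data [CompleteSpace E] {K P : E →L[ℂ] E}
    (h : IsSimpleIsolatedEigenvalue K 1 P) : SimpleEigenvalueData K P := by
  obtain ⟨heig, ⟨r, hr, hspec, hPdef⟩, hrank⟩ := h
  set κ : ℂ := (2 * (Real.pi : ℂ) * Complex.I)⁻¹ with hκ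
  have hκ1 : κ * (2 * (Real.pi : ℂ) * Complex.I) = 1 :=
    inv_mul_cancel₀ (by simp [Real.pi_ne_zero])
  have hunit : ∀ ζ ∈ Metric.sphere (1 : ℂ) r, IsUnit (algebraMap ℂ (E →L[ℂ] E) ζ - K) := by
    intro ζ hζ
    by_contra hc
    have : ζ ∈ spectrum ℂ K ∩ Metric.closedBall 1 r :=
      ⟨hc, Metric.sphere_subset_closedBall hζ⟩
    rw [hspec, Set.mem_singleton_iff] at this
    rw [this, Metric.mem_sphere, dist_self] at hζ
    exact hr.ne hζ
  have hne : ∀ ζ ∈ Metric.sphere (1 : ℂ) r, ζ - 1 ≠ 0 := by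
    intro ζ hζ hc
    rw [sub_eq_zero.1 hc, Metric.mem_sphere, dist_self] at hζ
    exact hr.ne hζ
  have hl : ∀ ζ ∈ Metric.sphere (1 : ℂ) r,
      resolvent K ζ * (algebraMap ℂ (E →L[ℂ] E) ζ - K) = 1 :=
    fun ζ hζ => Ring.inverse_mul_cancel _ (hunit ζ hζ)
  have hr' : ∀ ζ ∈ Metric.sphere (1 : ℂ) r,
      (algebraMap ℂ (E →L[ℂ] E) ζ - K) * resolvent K ζ = 1 :=
    fun ζ hζ => Ring.mul_inverse_cancel _ (hunit ζ hζ)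
  have hcont : ContinuousOn (resolvent K) (Metric.sphere (1 : ℂ) r) := by
    intro ζ hζ
    obtain ⟨u, hu⟩ := hunit ζ hζ
    have h1 : ContinuousAt Ring.inverse (algebraMap ℂ (E →L[ℂ] E) ζ - K) := by
      rw [← hu]; exact NormedRing.inverse_continuousAt u
    have h2 : ContinuousAt (fun ζ : ℂ => algebraMap ℂ (E →L[ℂ] E) ζ - K) ζ :=
      ((continuous_algebraMap ℂ (E →L[ℂ] E)).sub continuous_const).continuousAt
    exact (ContinuousAt.comp (f := fun ζ : ℂ => algebraMap ℂ (E →L[ℂ] E) ζ - K)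
      h1 h2).continuousWithinAt
  have hint := hcont.circleIntegrable hr.le
  have hinvc : ContinuousOn (fun ζ : ℂ => (ζ - 1)⁻¹) (Metric.sphere (1 : ℂ) r) :=
    ContinuousOn.inv₀ (by fun_prop) hne
  have hintJ : CircleIntegrable (fun ζ => (ζ - 1)⁻¹ • resolvent K ζ) 1 r :=
    (hinvc.smul hcont).circleIntegrable hr.le
  -- the eigenvector is fixed by the projection
  obtain ⟨v, hv⟩ := heig.exists_hasEigenvector
  have hKv : K v = v := by simpa using hv.apply_eq_smul
  have hPv : P v = v := by
    have e := circleIntegral_clm_comp (ContinuousLinearMap.apply ℂ E v) hint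
    have e2 : (∮ ζ in C(1, r), ContinuousLinearMap.apply ℂ E v (resolvent K ζ)) =
        ∮ ζ in C(1, r), (ζ - 1)⁻¹ • v := by
      refine circleIntegral.integral_congr hr.le fun ζ hζ => ?_
      have h1 := congrArg (fun T : E →L[ℂ] E => T v) (hl ζ hζ)
      have h2 : (algebraMap ℂ (E →L[ℂ] E) ζ - K) v = (ζ - 1) • v := by
        simp [Algebra.algebraMap_eq_smul_one, hKv, sub_smul]
      simp only [mul_apply_eq_comp, h2, map_smul,
        one_apply_eq_self] at h1
      simp only [ContinuousLinearMap.apply_apply]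
      conv_rhs => rw [← h1]
      rw [smul_smul, inv_mul_cancel₀ (hne ζ hζ), one_smul]
    rw [e2, circleIntegral.integral_smul_const, circleIntegral.integral_sub_center_inv _ hr.ne']
      at e
    have : P v = κ • ((2 * (Real.pi : ℂ) * Complex.I) • v) := by
      rw [e, hPdef]; simp
    rw [this, smul_smul, hκ1, one_smul]
  have hv0 : v ≠ 0 := hv.2
  have hone : ∀ x, P x ≠ 0 → ∀ y, ∃ a : ℂ, P y = a • P x := by
    intro x hx y
    have h := (finrank_eq_one_iff_of_nonzero'
      (⟨P x, ⟨x, rfl⟩⟩ : LinearMap.range (P : E →ₗ[ℂ] E))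
      (fun hc => hx (congrArg Subtype.val hc))).1 hrank ⟨P y, ⟨y, rfl⟩⟩
    obtain ⟨a, ha⟩ := h
    exact ⟨a, (congrArg Subtype.val ha).symm⟩
  have hPvne : P v ≠ 0 := by rwa [hPv]
  have hidem : P * P = P := by
    ext y
    obtain ⟨a, ha⟩ := hone v hPvne y
    simp [ha, hPv]
  have hKP : K * P = P := by
    ext y
    obtain ⟨a, ha⟩ := hone v hPvne y
    simp [ha, hPv, hKv]
  have hcomm : P * K = K * P := by
    have e1 := circleIntegral_clm_comp (ContinuousLinearMap.mul ℂ (E →L[ℂ] E) K) hint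
    have e2 := circleIntegral_clm_comp ((ContinuousLinearMap.mul ℂ (E →L[ℂ] E)).flip K) hint
    have e3 : (∮ ζ in C(1, r), ContinuousLinearMap.mul ℂ (E →L[ℂ] E) K (resolvent K ζ)) =
        ∮ ζ in C(1, r), (ContinuousLinearMap.mul ℂ (E →L[ℂ] E)).flip K (resolvent K ζ) := by
      refine circleIntegral.integral_congr hr.le fun ζ hζ => ?_
      have h1 := hl ζ hζ
      have h2 := hr' ζ hζ
      have h3 := Algebra.commutes ζ (resolvent K ζ)
      simp only [ContinuousLinearMap.mul_apply', ContinuousLinearMap.flip_apply]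
      rw [mul_sub] at h1
      rw [sub_mul] at h2
      rw [← h1, h3] at h2
      exact sub_right_injective h2
    rw [e1, e2] at e3
    simp only [ContinuousLinearMap.mul_apply', ContinuousLinearMap.flip_apply] at e3
    rw [hPdef, smul_mul_assoc, mul_smul_comm, e3]
  have hPK : P * K = P := hcomm.trans hKP
  -- the reduced resolvent
  set J : E →L[ℂ] E := κ • ∮ ζ in C(1, r), (ζ - 1)⁻¹ • resolvent K ζ with hJ
  have hconst : (∮ ζ in C((1 : ℂ), r), (ζ - 1)⁻¹ • (1 : E →L[ℂ] E)) =
      (2 * (Real.pi : ℂ) * Complex.I) • (1 : E →L[ℂ] E) := by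
    rw [circleIntegral.integral_smul_const, circleIntegral.integral_sub_center_inv _ hr.ne']
  have hintc : CircleIntegrable (fun ζ => (ζ - 1)⁻¹ • (1 : E →L[ℂ] E)) 1 r :=
    (hinvc.smul continuousOn_const).circleIntegrable hr.le
  have hPeq : κ • (∮ ζ in C((1 : ℂ), r), ((ζ - 1)⁻¹ • (1 : E →L[ℂ] E) - resolvent K ζ)) =
      1 - P := by
    rw [circleIntegral.integral_sub hintc hint, hconst, smul_sub, smul_smul, hκ1, one_smul,
      ← hPdef]
  have hJl : (1 - K) * J = 1 - P := by
    have e1 := circleIntegral_clm_comp (ContinuousLinearMap.mul ℂ (E →L[ℂ] E) (1 - K)) hintJ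
    simp only [ContinuousLinearMap.mul_apply'] at e1
    rw [hJ, mul_smul_comm, ← e1, ← hPeq]
    congr 1
    refine circleIntegral.integral_congr hr.le fun ζ hζ => ?_
    have h2 := hr' ζ hζ
    -- With this splitting the integrand of `(1 - K) * J` becomes `(ζ - 1)⁻¹` minus the resolvent,
    -- which integrates to `1 - P`.
    have e : (1 - K) = (algebraMap ℂ (E →L[ℂ] E) ζ - K) - (ζ - 1) • (1 : E →L[ℂ] E) := by
      rw [Algebra.algebraMap_eq_smul_one, sub_smul, one_smul]; abel
    rw [mul_smul_comm, e, sub_mul, h2, smul_sub, smul_mul_assoc, one_mul, smul_smul,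
      inv_mul_cancel₀ (hne ζ hζ), one_smul]
  have hJr : J * (1 - K) = 1 - P := by
    have e1 := circleIntegral_clm_comp
      ((ContinuousLinearMap.mul ℂ (E →L[ℂ] E)).flip (1 - K)) hintJ
    simp only [ContinuousLinearMap.mul_apply', ContinuousLinearMap.flip_apply] at e1
    rw [hJ, smul_mul_assoc, ← e1, ← hPeq]
    congr 1
    refine circleIntegral.integral_congr hr.le fun ζ hζ => ?_
    have h2 := hl ζ hζ
    have e : (1 - K) = (algebraMap ℂ (E →L[ℂ] E) ζ - K) - (ζ - 1) • (1 : E →L[ℂ] E) := by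
      rw [Algebra.algebraMap_eq_smul_one, sub_smul, one_smul]; abel
    rw [smul_mul_assoc, e, mul_sub, h2, smul_sub, mul_smul_comm, mul_one, smul_smul,
      inv_mul_cancel₀ (hne ζ hζ), one_smul]
  have hQ : (1 - P) * (1 - P) = 1 - P := by
    simp [mul_sub, sub_mul, hidem]
  have hKQ : (1 - K) * (1 - P) = 1 - K := by
    rw [mul_sub, sub_mul 1 K P, hKP]; simp
  have hQK : (1 - P) * (1 - K) = 1 - K := by
    rw [mul_sub, sub_mul 1 P K, hPK]; simp
  have hQP : (1 - P) * P = 0 := by rw [sub_mul, hidem]; simp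
  have hPQ : P * (1 - P) = 0 := by rw [mul_sub, hidem]; simp
  have hKP0 : (1 - K) * P = 0 := by rw [sub_mul, hKP]; simp
  have hPK0 : P * (1 - K) = 0 := by rw [mul_sub, hPK]; simp
  refine ⟨hidem, hKP, hPK, ?_, ?_, hone⟩
  · refine ⟨⟨1 - K + P, (1 - P) * J * (1 - P) + P, ?_, ?_⟩, rfl⟩
    · have a1 : (1 - K) * ((1 - P) * J * (1 - P)) = 1 - P := by
        rw [← mul_assoc, ← mul_assoc, hKQ, hJl, hQ]
      have a2 : P * ((1 - P) * J * (1 - P)) = 0 := by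
        rw [← mul_assoc, ← mul_assoc, hPQ]; simp
      rw [add_mul, mul_add, mul_add, a1, a2, hKP0, hidem]; abel
    · have a1 : ((1 - P) * J * (1 - P)) * (1 - K) = 1 - P := by
        rw [mul_assoc, hQK, mul_assoc, hJr, hQ]
      have a2 : ((1 - P) * J * (1 - P)) * P = 0 := by
        rw [mul_assoc, hQP]; simp
      rw [add_mul, mul_add, mul_add, a1, a2, hPK0, hidem]; abel
  · rintro rfl
    exact hPvne rfl

end SpectralProjection

/-! ### Perturbation of the eigenprojection. -/

section PerturbedProjection

variable {E : Type*} [NormedAddCommGroup E] [NormedSpace ℂ E] [CompleteSpace E]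

/-- A small perturbation `K'` of `K` with an eigenvalue `1 - m` close to `1` has a projection `P'`
onto the corresponding eigenvector, close to `P` and with the same kernel. -/
theorem SimpleEigenvalueData.exists_perturbed_projection {K P : E →L[ℂ] E}
    (h : SimpleEigenvalueData K P) :
    ∃ C δ : ℝ, 0 ≤ C ∧ 0 < δ ∧ ∀ (K' : E →L[ℂ] E) (m : ℂ),
      Module.End.HasEigenvalue (K' : Module.End ℂ E) (1 - m) → ‖m‖ + ‖K' - K‖ ≤ δ →
      ∃ P' : E →L[ℂ] E, P' * P' = P' ∧ P * P' = P ∧ P' * P = P' ∧ K' * P' = (1 - m) • P' ∧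
        ‖P' - P‖ ≤ C * (‖m‖ + ‖K' - K‖) := by
  obtain ⟨u, hu⟩ := h.isUnit
  set b : E →L[ℂ] E := ↑u⁻¹ with hb
  have hbl : b * (1 - K + P) = 1 := by rw [← hu, hb, Units.inv_mul]
  have hone : ‖(1 : E →L[ℂ] E)‖ ≤ 1 := ContinuousLinearMap.norm_id_le
  have hbP : b * P = P := by
    have : (1 - K + P) * P = P := by rw [add_mul, sub_mul, h.mul_proj, h.idem]; simp
    calc b * P = b * ((1 - K + P) * P) := by rw [this]
      _ = P := by rw [← mul_assoc, hbl, one_mul]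
  refine ⟨2 * ‖b‖ * ‖P‖, 1 / (2 * (‖b‖ + 1)), by positivity, by positivity,
    fun K' m heig hsmall => ?_⟩
  set ε := ‖m‖ + ‖K' - K‖ with hε
  have hε0 : 0 ≤ ε := by positivity
  -- The eigenvalue equation for `x` reads `(1 - K + P) x = (m + K' - K) x + P x`. Applying `b`, the
  -- inverse of `1 - K + P`, gives `(1 - V) x = P x`, so `x = W (P x)` with `W` the inverse of `1 -
  -- V`; the projection sought is `W * P`.
  set V : E →L[ℂ] E := b * (m • 1 + (K' - K)) with hV
  have hVn : ‖V‖ ≤ ‖b‖ * ε := by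
    refine (norm_mul_le _ _).trans (mul_le_mul_of_nonneg_left ?_ (norm_nonneg _))
    refine (norm_add_le _ _).trans (add_le_add_left ?_ _)
    rw [norm_smul]
    exact mul_le_of_le_one_right (norm_nonneg _) hone
  have hV2 : ‖V‖ ≤ 1 / 2 := by
    refine hVn.trans ?_
    rw [le_div_iff₀ (by positivity)] at hsmall
    nlinarith [norm_nonneg b]
  obtain ⟨w, hw⟩ : IsUnit (1 - V) := isUnit_one_sub_of_norm_lt_one (hV2.trans_lt (by norm_num))
  set W : E →L[ℂ] E := ↑w⁻¹ with hWdef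
  have hW : W * (1 - V) = 1 := by rw [← hw, hWdef, Units.inv_mul]
  have hW1 : W - 1 = W * V := by rw [mul_sub, mul_one] at hW; rw [← hW]; abel
  have hWn : ‖W‖ ≤ 2 := by
    have : ‖W‖ ≤ ‖W‖ * ‖V‖ + 1 := by
      calc ‖W‖ = ‖W * V + 1‖ := by rw [← hW1, sub_add_cancel]
        _ ≤ _ := (norm_add_le _ _).trans (add_le_add (norm_mul_le _ _) hone)
    nlinarith [norm_nonneg W]
  obtain ⟨x, hx⟩ := heig.exists_hasEigenvector
  have hKx : K' x = (1 - m) • x := hx.apply_eq_smul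
  have hxW : W (P x) = x := by
    have e1 : (1 - V) x = P x := by
      have e2 : (1 - K + P) x = (m • (1 : E →L[ℂ] E) + (K' - K)) x + P x := by
        simp only [add_apply, sub_apply, smul_apply, one_apply_eq_self, hKx, sub_smul, one_smul]
        abel
      have e3 := congrArg b e2
      rw [map_add, ← mul_apply_eq_comp, hbl, ← mul_apply_eq_comp, ← mul_apply_eq_comp, hbP] at e3
      rw [sub_apply, e3]
      simp [V]
    rw [← e1, ← mul_apply_eq_comp, hW, one_apply_eq_self]
  have hPx : P x ≠ 0 := fun hc => hx.2 (by rw [← hxW, hc, map_zero])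
  -- By rank one, `P * W * P` is a multiple of `P`; evaluating at `x` shows that the factor is `1`.
  have hPWP : P * W * P = P := by
    obtain ⟨s, hs⟩ := h.exists_smul W
    have := congrArg (fun T : E →L[ℂ] E => T x) hs
    simp only [mul_apply_eq_comp, hxW, smul_apply] at this
    have hs1 : s = 1 := by
      have h0 : (1 - s) • P x = 0 := by rw [sub_smul, one_smul, ← this, sub_self]
      rcases smul_eq_zero.1 h0 with h1 | h1
      · exact (sub_eq_zero.1 h1).symm
      · exact absurd h1 hPx
    rw [hs, hs1, one_smul]
  refine ⟨W * P, ?_, ?_, ?_, ?_, ?_⟩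
  · rw [mul_assoc, ← mul_assoc P, hPWP]
  · rw [← mul_assoc, hPWP]
  · rw [mul_assoc, h.idem]
  · ext y
    obtain ⟨a, ha⟩ := h.rank_one x hPx y
    simp only [mul_apply_eq_comp, smul_apply, ha, map_smul, hxW, hKx]
    exact smul_comm _ _ _
  · have : W * P - P = W * V * P := by rw [← hW1, sub_mul, one_mul]
    rw [this]
    calc ‖W * V * P‖ ≤ ‖W‖ * ‖V‖ * ‖P‖ := norm_mul₃_le
      _ ≤ 2 * (‖b‖ * ε) * ‖P‖ := by gcongr
      _ = _ := by ring

end PerturbedProjection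

/-! ### Majorants uniform in the parameter. -/

section UniformBounds

open PowerSeries

variable {ι : Type*} {l : Filter ι} {A : Type*} [NormedRing A]

/-- Eventually along `l`, the series `F t` is majorized by a fixed multiple of `a t`. -/
def UnifBound (l : Filter ι) (F : ι → A⟦X⟧) (a : ι → ℝ⟦X⟧) : Prop :=
  ∃ C : ℝ, 0 ≤ C ∧ ∀ᶠ t in l, Majorizes (F t) (C • a t)

variable {F G : ι → A⟦X⟧} {a b c : ι → ℝ⟦X⟧} {σ : ι → ℝ}

lemma UnifBound.congr (h : UnifBound l F a) (e : ∀ᶠ t in l, F t = G t) : UnifBound l G a := by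
  obtain ⟨C, hC, h⟩ := h
  refine ⟨C, hC, ?_⟩
  filter_upwards [h, e] with t ht et
  rwa [← et]

lemma UnifBound.congr_weight (h : UnifBound l F a) (e : ∀ t, a t = b t) : UnifBound l F b := by
  rwa [← funext e]

lemma UnifBound.neg (h : UnifBound l F a) : UnifBound l (fun t => -F t) a := by
  obtain ⟨C, hC, h⟩ := h
  exact ⟨C, hC, h.mono fun t ht => ht.neg⟩

lemma UnifBound.add (h : UnifBound l F a) (h' : UnifBound l G a) :
    UnifBound l (fun t => F t + G t) a := by
  obtain ⟨C, hC, h⟩ := h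
  obtain ⟨C', hC', h'⟩ := h'
  refine ⟨C + C', by positivity, ?_⟩
  filter_upwards [h, h'] with t ht ht'
  rw [add_smul]
  exact ht.add ht'

lemma UnifBound.sub (h : UnifBound l F a) (h' : UnifBound l G a) :
    UnifBound l (fun t => F t - G t) a := by
  simpa only [sub_eq_add_neg] using h.add h'.neg

lemma UnifBound.mul (h : UnifBound l F a) (h' : UnifBound l G b) :
    UnifBound l (fun t => F t * G t) (fun t => a t * b t) := by
  obtain ⟨C, hC, h⟩ := h
  obtain ⟨C', hC', h'⟩ := h'
  refine ⟨C * C', by positivity, ?_⟩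
  filter_upwards [h, h'] with t ht ht'
  rw [← smul_mul_smul_comm]
  exact ht.mul ht'

/-- Weights are themselves real series, so the comparison of two weights is again a `UnifBound` and
obeys the same calculus. -/
lemma UnifBound.trans (h : UnifBound l F a) (h' : UnifBound l a b) : UnifBound l F b := by
  obtain ⟨C, hC, h⟩ := h
  obtain ⟨C', hC', h'⟩ := h'
  refine ⟨C * C', by positivity, ?_⟩
  filter_upwards [h, h'] with t ht ht'
  refine ht.trans ?_
  rw [mul_smul]
  exact CoeffLE.smul hC fun n => (le_abs_self _).trans (ht' n)

lemma UnifBound.smul_real {F : ι → ℝ⟦X⟧} (h : UnifBound l F a) (hσ : ∀ t, 0 ≤ σ t) :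
    UnifBound l (fun t => σ t • F t) (fun t => σ t • a t) := by
  obtain ⟨C, hC, h⟩ := h
  refine ⟨C, hC, h.mono fun t ht n => ?_⟩
  have := ht n
  simp only [coeff_smul, smul_eq_mul, norm_mul, Real.norm_of_nonneg (hσ t)] at this ⊢
  calc _ ≤ σ t * (C * coeff n (a t)) := mul_le_mul_of_nonneg_left this (hσ t)
    _ = _ := by ring

lemma UnifBound.smul [NormedAlgebra ℂ A] {m : ι → ℂ} {K : ℝ} (h : UnifBound l F a) (hK : 0 ≤ K)
    (hm : ∀ᶠ t in l, ‖m t‖ ≤ K * σ t) :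
    UnifBound l (fun t => m t • F t) (fun t => σ t • a t) := by
  obtain ⟨C, hC, h⟩ := h
  refine ⟨K * C, by positivity, ?_⟩
  filter_upwards [h, hm] with t ht hmt n
  have := ht n
  simp only [coeff_smul, smul_eq_mul, norm_smul] at this ⊢
  calc _ ≤ (K * σ t) * (C * coeff n (a t)) :=
        mul_le_mul hmt this (norm_nonneg _) ((norm_nonneg _).trans hmt)
    _ = _ := by ring

lemma UnifBound.C_mul {B : ι → A} {K : ℝ} (h : UnifBound l F a) (hK : 0 ≤ K)
    (hB : ∀ᶠ t in l, ‖B t‖ ≤ K) : UnifBound l (fun t => C (B t) * F t) a := by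
  obtain ⟨C', hC, h⟩ := h
  refine ⟨K * C', by positivity, ?_⟩
  filter_upwards [h, hB] with t ht hBt
  rw [mul_smul]
  exact ht.C_mul hBt

lemma UnifBound.mul_C {B : ι → A} {K : ℝ} (h : UnifBound l F a) (hK : 0 ≤ K)
    (hB : ∀ᶠ t in l, ‖B t‖ ≤ K) : UnifBound l (fun t => F t * C (B t)) a := by
  obtain ⟨C', hC, h⟩ := h
  refine ⟨K * C', by positivity, ?_⟩
  filter_upwards [h, hB] with t ht hBt
  rw [mul_smul]
  exact ht.mul_C hBt

lemma UnifBound.C_mul_of_le {B : ι → A} {K : ℝ} (h : UnifBound l F a) (hK : 0 ≤ K)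
    (hB : ∀ᶠ t in l, ‖B t‖ ≤ K * σ t) :
    UnifBound l (fun t => C (B t) * F t) (fun t => σ t • a t) := by
  obtain ⟨C', hC, h⟩ := h
  refine ⟨K * C', by positivity, ?_⟩
  filter_upwards [h, hB] with t ht hBt
  have := ht.C_mul hBt
  rwa [smul_smul, show K * σ t * C' = K * C' * σ t by ring, ← smul_smul] at this

lemma UnifBound.mul_C_of_le {B : ι → A} {K : ℝ} (h : UnifBound l F a) (hK : 0 ≤ K)
    (hB : ∀ᶠ t in l, ‖B t‖ ≤ K * σ t) :
    UnifBound l (fun t => F t * C (B t)) (fun t => σ t • a t) := by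
  obtain ⟨C', hC, h⟩ := h
  refine ⟨K * C', by positivity, ?_⟩
  filter_upwards [h, hB] with t ht hBt
  have := ht.mul_C hBt
  rwa [smul_smul, show K * σ t * C' = K * C' * σ t by ring, ← smul_smul] at this

lemma Majorizes.unifBound {F : A⟦X⟧} {a : ℝ⟦X⟧} {K : ℝ} (hK : 0 ≤ K)
    (h : Majorizes F (K • a)) : UnifBound l (fun _ => F) (fun _ => a) :=
  ⟨K, hK, Eventually.of_forall fun _ => h⟩

lemma UnifBound.of_coeffLE {K : ℝ} (hK : 0 ≤ K)
    (h : ∀ᶠ t in l, CoeffLE 0 (a t) ∧ CoeffLE (a t) (K • b t)) : UnifBound l a b := by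
  refine ⟨K, hK, h.mono fun t ht n => ?_⟩
  rw [Real.norm_of_nonneg (by simpa using ht.1 n)]
  exact ht.2 n

/-- Solving `Y = Z + F Y` with a small `F`, uniformly. -/
lemma UnifBound.of_eq_add_mul {Y Z : ι → A⟦X⟧} {φ v : ι → ℝ⟦X⟧} (hσ : Tendsto σ l (𝓝 0))
    (hσ0 : ∀ t, 0 ≤ σ t)
    (hY : ∀ᶠ t in l, Y t = Z t + F t * Y t) (hF : UnifBound l F fun t => σ t • φ t)
    (hφ : UnifBound l (fun t => φ t * v t) v) (hZ : UnifBound l Z fun t => σ t • v t)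
    (hv : ∀ᶠ t in l, ∀ n, 0 < coeff n (v t)) : UnifBound l Y fun t => σ t • v t := by
  obtain ⟨C₁, hC₁, hF⟩ := hF
  obtain ⟨C₂, hC₂, hφ⟩ := hφ
  obtain ⟨C₃, hC₃, hZ⟩ := hZ
  have hsmall : ∀ᶠ t in l, C₁ * C₂ * σ t < 1 / 2 := by
    have : Tendsto (fun t => C₁ * C₂ * σ t) l (𝓝 (C₁ * C₂ * 0)) := hσ.const_mul _
    rw [mul_zero] at this
    exact this.eventually_lt_const (by norm_num)
  refine ⟨2 * C₃, by positivity, ?_⟩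
  filter_upwards [hY, hF, hφ, hZ, hv, hsmall] with t hY hF hφ hZ hv hs
  have := majorizes_of_eq_add_mul (mul_nonneg hC₃ (hσ0 t)) hY hF (by rwa [mul_smul]) ?_ hv
  · rwa [← mul_assoc, mul_smul] at this
  · intro n
    have h1 := (le_abs_self _).trans (hφ n)
    rw [smul_mul_assoc, smul_mul_assoc]
    simp only [coeff_smul, smul_eq_mul] at h1 ⊢
    have h2 := mul_le_mul_of_nonneg_left h1 (mul_nonneg hC₁ (hσ0 t))
    nlinarith [mul_le_mul_of_nonneg_right hs.le (hv n).le]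

end UniformBounds

/-! ### Geometric weights of ratio `1 - d t²`. -/

section GeometricWeights

open PowerSeries

/-- The left side is `y ^ (n + 1) - x ^ (n + 1)`. -/
lemma sum_geom_mul_geom_le {x y : ℝ} (hx : 0 ≤ x) (hxy : x ≤ y) (hy : y ≤ 1) (n : ℕ) :
    (y - x) * coeff n (geomWeight x * geomWeight y) ≤ y ^ n := by
  have h := (Commute.all y x).geom_sum₂_mul (n + 1)
  have e : coeff n (geomWeight x * geomWeight y) =
      ∑ i ∈ Finset.range (n + 1), y ^ i * x ^ (n + 1 - 1 - i) := by
    rw [mul_comm, coeff_mul, Finset.Nat.sum_antidiagonal_eq_sum_range_succ_mk]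
    simp [coeff_geomWeight]
  rw [e, mul_comm, h]
  have h1 : y ^ (n + 1) ≤ y ^ n := pow_le_pow_of_le_one (hx.trans hxy) hy n.le_succ
  have h2 : 0 ≤ x ^ (n + 1) := by positivity
  linarith

variable {d : ℝ}

lemma eventually_mul_sq_lt (d : ℝ) : ∀ᶠ t : ℝ in 𝓝 0, d * t ^ 2 < 1 / 4 := by
  have : Tendsto (fun t : ℝ => d * t ^ 2) (𝓝 0) (𝓝 (d * 0 ^ 2)) :=
    (Continuous.tendsto (by fun_prop) 0)
  exact this.eventually_lt_const (by norm_num)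

/-- The weight `(1 - d t²) ^ n`. -/
noncomputable def geomSq (d : ℝ) (t : ℝ) : ℝ⟦X⟧ := geomWeight (1 - d * t ^ 2)

lemma geomSq_nonneg (d : ℝ) : ∀ᶠ t : ℝ in 𝓝 0, CoeffLE 0 (geomSq d t) := by
  filter_upwards [eventually_mul_sq_lt d] with t ht
  exact geomWeight_nonneg (by linarith)

lemma unifBound_geomSq_two (hd : 0 < d) : UnifBound (𝓝 0) (geomSq (2 * d)) (geomSq d) := by
  refine UnifBound.of_coeffLE zero_le_one ?_
  filter_upwards [geomSq_nonneg (2 * d), eventually_mul_sq_lt (2 * d)] with t h0 ht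
  refine ⟨h0, fun n => ?_⟩
  rw [one_smul, geomSq, geomSq, coeff_geomWeight, coeff_geomWeight]
  exact pow_le_pow_left₀ (by linarith) (by nlinarith [sq_nonneg t]) n

/-- The two ratios differ by exactly `d t²`, whence the constant `1 / d`. This is why the rates `2
d` and `d` are kept apart: with equal rates the convolution would carry a factor `n + 1`. -/
lemma unifBound_sq_smul_geomSq_mul (hd : 0 < d) :
    UnifBound (𝓝 0) (fun t : ℝ => t ^ 2 • (geomSq (2 * d) t * geomSq d t)) (geomSq d) := by
  refine UnifBound.of_coeffLE (K := 1 / d) (by positivity) ?_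
  filter_upwards [geomSq_nonneg (2 * d), geomSq_nonneg d, eventually_mul_sq_lt (2 * d)]
    with t h0 h1 ht
  constructor
  · have := (h0.mul_nonneg h1).smul (sq_nonneg t)
    rwa [smul_zero] at this
  · intro n
    have := sum_geom_mul_geom_le (x := 1 - 2 * d * t ^ 2) (y := 1 - d * t ^ 2) (by linarith)
      (by nlinarith [sq_nonneg t]) (by nlinarith [sq_nonneg t]) n
    simp only [coeff_smul, smul_eq_mul, geomSq] at this ⊢
    rw [coeff_geomWeight, one_div_mul_eq_div, le_div_iff₀ hd]
    linarith

lemma unifBound_mk_pow {A : Type*} [NormedRing A] {q : ℝ → A}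
    (hq : ∀ᶠ t in 𝓝 0, ‖q t‖ ≤ 1 - 2 * d * t ^ 2) [NormOneClass A] :
    UnifBound (𝓝 0) (fun t => PowerSeries.mk fun n => q t ^ n) (geomSq (2 * d)) := by
  refine ⟨1, zero_le_one, ?_⟩
  filter_upwards [hq] with t ht n
  rw [one_smul, geomSq, coeff_geomWeight, coeff_mk]
  exact (norm_pow_le _ _).trans (pow_le_pow_left₀ (norm_nonneg _) ht n)

/-- A shift divides by the ratio, which exceeds `1/2` for small `t`. -/
lemma unifBound_X_mul_geomSq :
    UnifBound (𝓝 0) (fun t => X * geomSq (2 * d) t) (geomSq (2 * d)) := by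
  refine UnifBound.of_coeffLE (K := 2) (by norm_num) ?_
  filter_upwards [geomSq_nonneg (2 * d), eventually_mul_sq_lt (2 * d)] with t h0 ht
  constructor
  · intro n
    cases n with
    | zero => simp
    | succ n => rw [coeff_succ_X_mul]; simpa using h0 n
  · intro n
    cases n with
    | zero => simp [geomSq, coeff_geomWeight]
    | succ n =>
      rw [coeff_succ_X_mul, coeff_smul, geomSq, coeff_geomWeight, coeff_geomWeight,
        pow_succ (1 - 2 * d * t ^ 2),
        smul_eq_mul]
      have : 0 ≤ (1 - 2 * d * t ^ 2) ^ n := pow_nonneg (by linarith) n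
      nlinarith

end GeometricWeights

/-! ### Tail series and division by `1 - z`. -/

section TailSeries

open PowerSeries

/-- The series `∑ zⁿ ∑_{k > n} F_k`. -/
noncomputable def tailSeries {A : Type*} [NormedRing A] (F : A⟦X⟧) : A⟦X⟧ :=
  PowerSeries.mk fun n => ∑' k, coeff (n + 1 + k) F

variable {A : Type*} [NormedRing A]

lemma coeff_tailSeries (F : A⟦X⟧) (n : ℕ) :
    coeff n (tailSeries F) = ∑' k, coeff (n + 1 + k) F := by
  simp [tailSeries]

lemma summable_coeff_add {F : A⟦X⟧} (hF : Summable fun n => ‖coeff n F‖) (n : ℕ) :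
    Summable fun k => ‖coeff (n + k) F‖ := by
  simpa only [add_comm] using (summable_nat_add_iff n).2 hF

lemma Majorizes.tailSeries [CompleteSpace A] {F : A⟦X⟧} {K s : ℝ} (hs : 1 ≤ s)
    (hF : Majorizes F (K • polyWeight (s + 1))) :
    Majorizes (tailSeries F) (K • polyWeight s) := fun n => by
  have hsum := summable_coeff_add (hF.summable (by linarith)) (n + 1)
  rw [coeff_tailSeries]
  exact (norm_tsum_le_tsum_norm hsum).trans
    (tsum_norm_tail_le hs (a := fun n => coeff n F) (fun n => by simpa using hF n) n)

variable [NormedAlgebra ℂ A]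

/-- `F(z) = F(1) - (1 - z) S(z)`, where `S` is the series of the tails of `F`. -/
lemma eq_C_sub_tailSeries [CompleteSpace A] {F : A⟦X⟧} (hF : Summable fun n => ‖coeff n F‖) :
    F = C (evalAt F 1) - (1 - X) * tailSeries F := by
  have h0 : ∀ n, coeff n F + ∑' k, coeff (n + 1 + k) F = ∑' k, coeff (n + k) F := fun n => by
    rw [(summable_coeff_add hF n).of_norm.tsum_eq_zero_add]
    simp only [add_zero]
    congr 1
    exact tsum_congr fun k => by rw [add_right_comm, add_assoc]
  ext n
  rw [map_sub, sub_mul, one_mul, map_sub]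
  cases n with
  | zero =>
    have := h0 0
    simp only [zero_add] at this
    simp only [coeff_tailSeries, coeff_zero_X_mul, evalAt, one_pow, one_smul, coeff_zero_C,
      zero_add, ← this]
    abel
  | succ n =>
    rw [coeff_succ_X_mul, coeff_C, if_neg n.succ_ne_zero, coeff_tailSeries, coeff_tailSeries,
      ← h0 (n + 1)]
    abel

end TailSeries

/-! ### Regularization of `1 - R` and block inversion. -/

section Factorization

open PowerSeries

variable {A : Type*} [NormedRing A]

lemma C_complement_mul {P : A} (hP : P * P = P) : (C (1 - P) : A⟦X⟧) * C P = 0 := by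
  rw [← map_mul, sub_mul, hP, one_mul, sub_self, map_zero]

lemma C_mul_complement {P : A} (hP : P * P = P) : (C P : A⟦X⟧) * C (1 - P) = 0 := by
  rw [← map_mul, mul_sub, hP, mul_one, sub_self, map_zero]

lemma C_complement_mul_self {P : A} (hP : P * P = P) :
    (C (1 - P) : A⟦X⟧) * C (1 - P) = C (1 - P) := by
  rw [← map_mul, mul_sub, sub_mul 1 P P, hP, one_mul, sub_self, mul_one, sub_zero]

/-- The regularized series `(1 - R) (1 - P) + S P`, where `S` is the series of the tails of `R`. -/
noncomputable def regularized (R : A⟦X⟧) (P : A) : A⟦X⟧ :=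
  (1 - R) * C (1 - P) + tailSeries R * C P

variable [NormedAlgebra ℂ A]

lemma C_smul_eq (m : ℂ) (a : A) : (C (m • a) : A⟦X⟧) = m • C a := by
  ext n
  rw [coeff_smul, coeff_C, coeff_C]
  split_ifs <;> simp

lemma map_algebraMap_commute (F : A⟦X⟧) (y : ℂ⟦X⟧) :
    F * PowerSeries.map (algebraMap ℂ A) y = PowerSeries.map (algebraMap ℂ A) y * F := by
  ext n
  rw [coeff_mul, coeff_mul, ← Finset.Nat.sum_antidiagonal_swap]
  refine Finset.sum_congr rfl fun p _ => ?_
  simp only [coeff_map, Prod.fst_swap, Prod.snd_swap]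
  exact (Algebra.commutes _ _).symm

lemma one_sub_mul_C_eq [CompleteSpace A] {R : A⟦X⟧} {P : A} {m : ℂ}
    (hR : Summable fun n => ‖coeff n R‖) (hRP : evalAt R 1 * P = (1 - m) • P) :
    (1 - R) * C P = m • C P + (1 - X) * tailSeries R * C P := by
  have e := eq_C_sub_tailSeries hR
  conv_lhs => rw [e]
  rw [sub_mul, sub_mul (C _), ← map_mul C, hRP, C_smul_eq, sub_smul, one_smul, one_mul]
  abel

/-- The relation between `1 - R` and its regularization, when `1 - m` is an eigenvalue of `R(1)`
with projection `P`. -/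
lemma one_sub_eq_regularized_mul [CompleteSpace A] {R : A⟦X⟧} {P : A} {m : ℂ}
    (hR : Summable fun n => ‖coeff n R‖) (hP : P * P = P) (hRP : evalAt R 1 * P = (1 - m) • P) :
    1 - R = regularized R P * (C (1 - P) + (1 - X) * C P) + m • C P := by
  have h1 := one_sub_mul_C_eq hR hRP
  have hx : ∀ F : A⟦X⟧, F * (1 - X) = (1 - X) * F := fun F => by
    rw [mul_sub, sub_mul, mul_one, one_mul, (commute_X F).eq]
  have hPP : (C P : A⟦X⟧) * C P = C P := by rw [← map_mul, hP]
  have hsum : (C (1 - P) : A⟦X⟧) + C P = 1 := by rw [← map_add, sub_add_cancel, map_one]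
  unfold regularized
  set S := tailSeries R
  set x : A⟦X⟧ := 1 - X
  have e1 : (1 - R) * C (1 - P) * C (1 - P) = (1 - R) * C (1 - P) := by
    rw [mul_assoc, C_complement_mul_self hP]
  have e2 : (1 - R) * C (1 - P) * (x * C P) = 0 := by
    rw [← hx, mul_assoc, ← mul_assoc (C (1 - P)), C_complement_mul hP, zero_mul, mul_zero]
  have e3 : S * C P * C (1 - P) = 0 := by rw [mul_assoc, C_mul_complement hP, mul_zero]
  have e4 : S * C P * (x * C P) = x * S * C P := by
    rw [← mul_assoc, hx, mul_assoc, mul_assoc S, hPP, mul_assoc]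
  rw [add_mul, mul_add, mul_add, e1, e2, e3, e4, add_zero, zero_add, add_assoc, add_comm _ (m • _),
    ← h1, ← mul_add, hsum, mul_one]

/-- Inversion of `1 - R` by means of the inverse `H` of its regularization and of the scalar
series `1 - X + m h`, where `h` represents the compression of `H` to the range of `P`. -/
lemma one_sub_mul_inverse_eq_one [CompleteSpace A] {R H : A⟦X⟧} {P : A} {m : ℂ} {h y : ℂ⟦X⟧}
    (hR : Summable fun n => ‖coeff n R‖) (hP : P * P = P) (hRP : evalAt R 1 * P = (1 - m) • P)
    (hGH : regularized R P * H = 1)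
    (hh : C P * H * C P = PowerSeries.map (algebraMap ℂ A) h * C P)
    (hy : (1 - X + m • h) * y = 1) :
    (1 - R) * (C (1 - P) * H + (C P - m • (C (1 - P) * H * C P)) *
      PowerSeries.map (algebraMap ℂ A) y * H) = 1 := by
  have hA := one_sub_eq_regularized_mul hR hP hRP
  set ι := PowerSeries.map (algebraMap ℂ A)
  set G := regularized R P
  have hx : ∀ F : A⟦X⟧, F * (1 - X) = (1 - X) * F := fun F => by
    rw [mul_sub, sub_mul, mul_one, one_mul, (commute_X F).eq]
  have hPP : (C P : A⟦X⟧) * C P = C P := by rw [← map_mul, hP]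
  have hsum : (C (1 - P) : A⟦X⟧) + C P = 1 := by rw [← map_add, sub_add_cancel, map_one]
  have hQQ := C_complement_mul_self hP
  have hPQ := C_mul_complement hP
  have hQP := C_complement_mul hP
  have hmι : ι (m • h) = m • ι h := by
    ext n
    rw [coeff_map, coeff_smul, smul_eq_mul, map_mul, coeff_smul, coeff_map, Algebra.smul_def]
  have hXι : ι X = X := by simp [ι]
  have hιy : ((1 - X) + m • ι h) * ι y = 1 := by
    have := congrArg ι hy
    rwa [map_mul, map_add, hmι, map_sub, map_one, hXι] at this
  have hcomm : ∀ F : A⟦X⟧, F * ι y = ι y * F := fun F => map_algebraMap_commute F y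
  set x : A⟦X⟧ := 1 - X
  set Q : A⟦X⟧ := C (1 - P)
  set p : A⟦X⟧ := C P
  set N : A⟦X⟧ := Q + x * p + m • (H * p) with hN
  have hGN : 1 - R = G * N := by
    rw [hA, hN, mul_add _ _ (m • _), mul_smul_comm, ← mul_assoc G H, hGH, one_mul]
  have hNQ : N * Q = Q := by
    rw [hN, add_mul, add_mul, hQQ, mul_assoc x, hPQ, mul_zero, smul_mul_assoc, mul_assoc H, hPQ,
      mul_zero, smul_zero, add_zero, add_zero]
  have hNp : N * p = x * p + m • (H * p) := by
    rw [hN, add_mul, add_mul, hQP, mul_assoc x, hPP, smul_mul_assoc, mul_assoc H, hPP, zero_add]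
  have hNN : N * (Q + (p - m • (Q * H * p)) * ι y) = 1 := by
    -- The correction `m Q H p` removes the off-diagonal entry: what is left of `H p` is `p H p`, a
    -- scalar multiple of `p`.
    have e1 : N * (p - m • (Q * H * p)) = (x + m • ι h) * p := by
      rw [mul_sub, hNp, mul_smul_comm, ← mul_assoc, ← mul_assoc, hNQ, add_sub_assoc, ← smul_sub,
        mul_assoc Q, ← one_sub_mul, show 1 - Q = p from sub_eq_of_eq_add' hsum.symm,
        ← mul_assoc, hh, add_mul, smul_mul_assoc]
    rw [mul_add, hNQ, ← mul_assoc, e1, mul_assoc, hcomm, ← mul_assoc, hιy, one_mul, hsum]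
  have e : Q * H + (p - m • (Q * H * p)) * ι y * H =
      (Q + (p - m • (Q * H * p)) * ι y) * H := by rw [add_mul]
  rw [e, hGN, mul_assoc, ← mul_assoc N, hNN, one_mul, hGH]

end Factorization

/-! ### Evaluation of elementary series. -/

section Evaluation

open PowerSeries

variable {A : Type*} [NormedRing A]

lemma majorizes_C {B : A} {K s : ℝ} (hB : ‖B‖ ≤ K) : Majorizes (C B) (K • polyWeight s) := by
  intro n
  have hK := (norm_nonneg _).trans hB
  rw [coeff_C, coeff_smul, smul_eq_mul]
  split_ifs with h
  · rw [h, coeff_polyWeight]; simpa using hB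
  · rw [norm_zero]; exact mul_nonneg hK (coeff_polyWeight_pos s n).le

variable [NormedAlgebra ℂ A]

lemma evalAt_X (z : ℂ) : evalAt (X : A⟦X⟧) z = z • 1 := by
  unfold evalAt
  rw [tsum_eq_single 1 fun n hn => by simp [coeff_X, hn]]
  simp

lemma evalAt_C (B : A) (z : ℂ) : evalAt (C B : A⟦X⟧) z = B := by
  unfold evalAt
  rw [tsum_eq_single 0 fun n hn => by simp [coeff_C, hn]]
  simp

variable [CompleteSpace A]

lemma evalAt_C_mul {F : A⟦X⟧} (hF : Summable fun n => ‖coeff n F‖) (B : A) {z : ℂ}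
    (hz : ‖z‖ ≤ 1) : evalAt (C B * F) z = B * evalAt F z := by
  unfold evalAt
  rw [← (summable_pow_smul_of_summable hF hz).of_norm.tsum_mul_left]
  exact tsum_congr fun n => by rw [coeff_C_mul, mul_smul_comm]

lemma evalAt_mul_C {F : A⟦X⟧} (hF : Summable fun n => ‖coeff n F‖) (B : A) {z : ℂ}
    (hz : ‖z‖ ≤ 1) : evalAt (F * C B) z = evalAt F z * B := by
  unfold evalAt
  rw [← (summable_pow_smul_of_summable hF hz).of_norm.tsum_mul_right]
  exact tsum_congr fun n => by rw [coeff_mul_C, smul_mul_assoc]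

lemma evalAt_add {F G : A⟦X⟧} (hF : Summable fun n => ‖coeff n F‖)
    (hG : Summable fun n => ‖coeff n G‖) {z : ℂ} (hz : ‖z‖ ≤ 1) :
    evalAt (F + G) z = evalAt F z + evalAt G z := by
  unfold evalAt
  rw [← (summable_pow_smul_of_summable hF hz).of_norm.tsum_add
    (summable_pow_smul_of_summable hG hz).of_norm]
  exact tsum_congr fun n => by rw [map_add, smul_add]

end Evaluation

/-! ### Inverse of the regularized unperturbed series. -/

section Unperturbed

open PowerSeries

variable {A : Type*} [NormedRing A]

lemma regularized_eq (R : A⟦X⟧) (P : A) :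
    regularized R P = C (1 - P) + R * C (-(1 - P)) + tailSeries R * C P := by
  rw [regularized, sub_mul, one_mul, map_neg, mul_neg, sub_eq_add_neg]

lemma majorizes_regularized {R : A⟦X⟧} {P : A} {K s : ℝ} (hR : Majorizes R (K • polyWeight s))
    (hS : Majorizes (tailSeries R) (K • polyWeight s)) :
    Majorizes (regularized R P)
      ((‖1 - P‖ + ‖1 - P‖ * K + ‖P‖ * K) • polyWeight s) := by
  rw [regularized_eq, add_smul, add_smul, mul_smul, mul_smul]
  exact ((majorizes_C le_rfl).add (hR.mul_C (by rw [norm_neg]))).add (hS.mul_C le_rfl)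

variable [NormedAlgebra ℂ A]

/-- A triangular operator with diagonal entries `1` and `μ`; the off-diagonal part satisfies `N * N
= 0`, so the inverse is explicit. -/
lemma isUnit_block {P N : A} {μ : ℂ} (hμ : μ ≠ 0) (hP : P * P = P) (hPN : P * N = 0)
    (hNP : N * P = N) : IsUnit (1 - P + μ • P + N) := by
  have hNN : N * N = 0 := by
    nth_rewrite 1 [← hNP]; rw [mul_assoc, hPN, mul_zero]
  refine ⟨⟨_, 1 - P + μ⁻¹ • P - μ⁻¹ • N, ?_, ?_⟩, rfl⟩ <;>
  · simp only [mul_add, mul_sub, add_mul, sub_mul, one_mul, mul_one, smul_mul_assoc,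
      mul_smul_comm, hP, hPN, hNP, hNN, smul_smul, mul_inv_cancel₀ hμ, inv_mul_cancel₀ hμ,
      one_smul, smul_zero, smul_sub, smul_add]
    abel

variable [CompleteSpace A]

lemma evalAt_eq_sub_tailSeries {F : A⟦X⟧} (hF : Summable fun n => ‖coeff n F‖)
    (hS : Summable fun n => ‖coeff n (tailSeries F)‖) {z : ℂ} (hz : ‖z‖ ≤ 1) :
    evalAt F z = evalAt F 1 - (1 - z) • evalAt (tailSeries F) z := by
  have e := eq_C_sub_tailSeries hF
  set S := tailSeries F
  have hXS : evalAt (X * S) z = z • evalAt S z := by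
    have h1 : Summable fun n => ‖z ^ n • coeff n (X : A⟦X⟧)‖ :=
      summable_of_ne_finset_zero (s := {1}) fun n hn => by
        rw [coeff_X, if_neg (by simpa using hn)]; simp
    rw [evalAt_mul h1 (summable_pow_smul_of_summable hS hz), evalAt_X, smul_one_mul]
  have hXSs : Summable fun n => ‖coeff n (X * S)‖ := by
    rw [← summable_nat_add_iff 1]
    simpa only [coeff_succ_X_mul] using hS
  have hC : Summable fun n => ‖coeff n (C (evalAt F 1) : A⟦X⟧)‖ :=
    summable_of_ne_finset_zero (s := {0}) fun n hn => by
      rw [coeff_C, if_neg (by simpa using hn)]; simp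
  have e2 : F + S = C (evalAt F 1) + X * S := by
    conv_lhs => rw [e]
    rw [sub_mul, one_mul]; abel
  have e3 := congrArg (evalAt · z) e2
  simp only [evalAt_add hF hS hz, evalAt_add hC hXSs hz, evalAt_C, hXS] at e3
  rw [eq_sub_of_add_eq e3, sub_smul, one_smul]
  abel

lemma evalAt_regularized {R : A⟦X⟧} (P : A) (hR : Summable fun n => ‖coeff n R‖)
    (hS : Summable fun n => ‖coeff n (tailSeries R)‖) {z : ℂ} (hz : ‖z‖ ≤ 1) :
    evalAt (regularized R P) z = (1 - evalAt R z) * (1 - P) + evalAt (tailSeries R) z * P := by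
  have s1 : Summable fun n => ‖coeff n (C (1 - P) : A⟦X⟧)‖ :=
    summable_of_ne_finset_zero (s := {0}) fun n hn => by
      rw [coeff_C, if_neg (by simpa using hn)]; simp
  have hmul : ∀ {F : A⟦X⟧} (B : A), (Summable fun n => ‖coeff n F‖) →
      Summable fun n => ‖coeff n (F * C B)‖ := by
    intro F B hF
    refine (hF.mul_right ‖B‖).of_nonneg_of_le (fun _ => norm_nonneg _) fun n => ?_
    rw [coeff_mul_C]; exact norm_mul_le _ _
  have s2 := hmul (-(1 - P)) hR
  have s3 := hmul P hS
  have s12 : Summable fun n => ‖coeff n (C (1 - P) + R * C (-(1 - P)))‖ :=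
    (s1.add s2).of_nonneg_of_le (fun _ => norm_nonneg _) fun n => by
      rw [map_add]; exact norm_add_le _ _
  rw [regularized_eq, evalAt_add s12 s3 hz, evalAt_add s1 s2 hz, evalAt_C, evalAt_mul_C hR _ hz,
    evalAt_mul_C hS _ hz]
  noncomm_ring

/-- The regularization of `1 - R` has an inverse whose coefficients decay like those of `R`. -/
theorem exists_inverse_regularized {R : A⟦X⟧} {P : A} {K β : ℝ} {μ : ℂ} (hβ : 2 < β)
    (hR : Majorizes R (K • polyWeight β)) (hS : Majorizes (tailSeries R) (K • polyWeight β))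
    (hR0 : coeff 0 R = 0) (hP : P * P = P) (hRP : evalAt R 1 * P = P) (hPR : P * evalAt R 1 = P)
    (hunit : IsUnit (1 - evalAt R 1 + P))
    (hinv : ∀ z : ℂ, ‖z‖ ≤ 1 → z ≠ 1 → IsUnit (1 - evalAt R z)) (hμ : μ ≠ 0)
    (hPS : P * evalAt (tailSeries R) 1 * P = μ • P) :
    ∃ H : A⟦X⟧, regularized R P * H = 1 ∧ H * regularized R P = 1 ∧
      (∃ K' : ℝ, Majorizes H (K' • polyWeight β)) ∧ P * evalAt H 1 = μ⁻¹ • P := by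
  have hRs : Summable fun n => ‖coeff n R‖ := hR.summable (by linarith)
  have hSs : Summable fun n => ‖coeff n (tailSeries R)‖ := hS.summable (by linarith)
  have hG := majorizes_regularized (P := P) hR hS
  have hGs : Summable fun n => ‖coeff n (regularized R P)‖ := hG.summable (by linarith)
  have hev : ∀ z : ℂ, ‖z‖ ≤ 1 → evalAt (regularized R P) z =
      (1 - evalAt R z) * (1 - P) + evalAt (tailSeries R) z * P :=
    fun z hz => evalAt_regularized P hRs hSs hz
  have hQP : (1 - P) * P = 0 := by rw [sub_mul, hP, one_mul, sub_self]
  have hPQ : P * (1 - P) = 0 := by rw [mul_sub, hP, mul_one, sub_self]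
  have hQQ : (1 - P) * (1 - P) = 1 - P := by
    conv_lhs => rw [mul_sub, mul_one]
    rw [hQP, sub_zero]
  have hKQ : (1 - evalAt R 1) * (1 - P) = 1 - evalAt R 1 := by
    rw [mul_sub, sub_mul _ _ P, hRP]; simp
  have h1 : (‖(1 : ℂ)‖ : ℝ) ≤ 1 := by simp
  -- invertibility on the closed disk
  have hGinv : ∀ z : ℂ, ‖z‖ ≤ 1 → IsUnit (evalAt (regularized R P) z) := by
    intro z hz
    rw [hev z hz]
    rcases eq_or_ne z 1 with rfl | hz1
    · obtain ⟨u, hu⟩ := hunit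
      set b : A := ↑u⁻¹ with hb
      have hub : (1 - evalAt R 1 + P) * b = 1 := by rw [← hu, hb, Units.mul_inv]
      set S := evalAt (tailSeries R) 1
      -- At `z = 1` the regularization factors as `1 - R(1) + P` times a triangular operator; its
      -- diagonal entry on `P` is `μ`, from `P S(1) P = μ P`.
      set N : A := b * (1 - P) * S * P with hN
      have hPb : P * b = P := by
        have : P * (1 - evalAt R 1 + P) = P := by rw [mul_add, mul_sub, hPR, hP]; simp
        calc P * b = P * (1 - evalAt R 1 + P) * b := by rw [this]
          _ = P := by rw [mul_assoc, hub, mul_one]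
      have hPN : P * N = 0 := by
        rw [hN, ← mul_assoc, ← mul_assoc, ← mul_assoc, hPb, hPQ, zero_mul, zero_mul]
      have hNP : N * P = N := by rw [hN, mul_assoc, hP]
      have hBN : (1 - evalAt R 1 + P) * N = (1 - P) * S * P := by
        rw [hN, ← mul_assoc, ← mul_assoc, ← mul_assoc, hub, one_mul]
      have e : (1 - evalAt R 1) * (1 - P) + S * P =
          (1 - evalAt R 1 + P) * ((1 - P) + μ • P + N) := by
        rw [mul_add, mul_add, hBN, mul_smul_comm, add_mul _ _ P, hP, sub_mul _ _ P, hRP, one_mul,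
          sub_self, zero_add, add_mul _ _ (1 - P), hPQ, ← hPS, sub_mul 1 P S, sub_mul _ _ P]
        simp only [one_mul]; abel
      rw [e]
      exact IsUnit.mul ⟨u, hu⟩ (isUnit_block hμ hP hPN hNP)
    · have hz' : 1 - z ≠ 0 := sub_ne_zero.2 hz1.symm
      have hAP : (1 - evalAt R z) * P = (1 - z) • (evalAt (tailSeries R) z * P) := by
        rw [evalAt_eq_sub_tailSeries hRs hSs hz, sub_mul, sub_mul, hRP, smul_mul_assoc, one_mul]
        abel
      -- Away from `1` the regularization is `1 - R(z)` with the range of `P` rescaled by `(1 -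
      -- z)⁻¹`.
      have e : (1 - evalAt R z) * (1 - P) + evalAt (tailSeries R) z * P =
          (1 - evalAt R z) * (1 - P + (1 - z)⁻¹ • P + 0) := by
        rw [add_zero, mul_add, mul_smul_comm, hAP, smul_smul, inv_mul_cancel₀ hz', one_smul]
      rw [e]
      exact (hinv z hz hz1).mul (isUnit_block (inv_ne_zero hz') hP (mul_zero _) (zero_mul _))
  -- Since `R` has no constant term, the constant term of its tail series is `R(1)`, and `R(1) P =
  -- P`; so the regularization starts with `(1 - P) + P = 1`.
  have hc : constantCoeff (regularized R P) = ((1 : Aˣ) : A) := by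
    have h0 : coeff 0 (tailSeries R) = evalAt R 1 := by
      have := congrArg (coeff 0) (eq_C_sub_tailSeries hRs)
      rw [sub_mul, one_mul, map_sub, map_sub, coeff_zero_X_mul, hR0, coeff_zero_C, sub_zero,
        eq_comm, sub_eq_zero] at this
      exact this.symm
    rw [← coeff_zero_eq_constantCoeff_apply, regularized, map_add, coeff_mul_C, coeff_mul_C,
      map_sub, hR0, h0, hRP, coeff_zero_one]
    simp
  have hGH := mul_invOfUnit _ _ hc
  have hHG := invOfUnit_mul _ _ hc
  set H := invOfUnit (regularized R P) 1
  obtain ⟨K', hK'⟩ := exists_majorizes_inverse hβ hG hGinv hHG hGH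
  refine ⟨H, hGH, hHG, ⟨K', hK'⟩, ?_⟩
  have hHs : Summable fun n => ‖coeff n H‖ := hK'.summable (by linarith)
  have e1 : evalAt (regularized R P) 1 * evalAt H 1 = 1 := by
    rw [← evalAt_mul (summable_pow_smul_of_summable hGs h1)
      (summable_pow_smul_of_summable hHs h1), hGH, evalAt_one]
  -- Left multiplication by `P` kills `1 - R(1)`, leaving `P S(1) P`.
  have e2 : P * evalAt (regularized R P) 1 = μ • P := by
    rw [hev 1 h1, mul_add, ← mul_assoc, ← mul_assoc, hPS, mul_sub P, hPR, mul_one, sub_self,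
      zero_mul, zero_add]
  have e3 : P = μ • (P * evalAt H 1) := by
    rw [← smul_mul_assoc, ← e2, mul_assoc, e1, mul_one]
  conv_rhs => rw [e3]
  rw [smul_smul, inv_mul_cancel₀ hμ, one_smul]

end Unperturbed

/-! ### Perturbation of inverses, operator-valued and scalar. -/

section PerturbedSeries

open PowerSeries

lemma UnifBound.refl {ι : Type*} {l : Filter ι} {a : ι → ℝ⟦X⟧} (h : ∀ᶠ t in l, CoeffLE 0 (a t)) :
    UnifBound l a a :=
  UnifBound.of_coeffLE zero_le_one (h.mono fun t ht => ⟨ht, by rw [one_smul]; exact .refl _⟩)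

lemma UnifBound.add_left {ι : Type*} {l : Filter ι} {A : Type*} [NormedRing A] {F : ι → A⟦X⟧}
    {a b : ι → ℝ⟦X⟧} (h : UnifBound l F a) (hb : ∀ᶠ t in l, CoeffLE 0 (b t)) :
    UnifBound l F (fun t => a t + b t) := by
  obtain ⟨C, hC, h⟩ := h
  refine ⟨C, hC, ?_⟩
  filter_upwards [h, hb] with t ht hbt n
  have h1 := ht n
  have h2 := mul_nonneg hC (show 0 ≤ coeff n (b t) by simpa using hbt n)
  simp only [coeff_smul, smul_eq_mul, map_add] at h1 ⊢
  linarith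

lemma UnifBound.add_right {ι : Type*} {l : Filter ι} {A : Type*} [NormedRing A] {F : ι → A⟦X⟧}
    {a b : ι → ℝ⟦X⟧} (h : UnifBound l F b) (ha : ∀ᶠ t in l, CoeffLE 0 (a t)) :
    UnifBound l F (fun t => a t + b t) :=
  (h.add_left ha).congr_weight fun _ => add_comm _ _

lemma unifBound_polyWeight_mul {γ : ℝ} (hγ : 1 < γ) (l : Filter ℝ) :
    UnifBound l (fun _ => polyWeight γ * polyWeight γ) fun _ => polyWeight γ := by
  obtain ⟨K, hK, h⟩ := polyWeight_mul_self_le hγ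
  exact UnifBound.of_coeffLE hK.le (Eventually.of_forall fun _ =>
    ⟨(polyWeight_nonneg γ).mul_nonneg (polyWeight_nonneg γ), h⟩)

lemma unifBound_polyWeight (γ : ℝ) (l : Filter ℝ) :
    UnifBound l (fun _ => polyWeight γ) fun _ => polyWeight γ :=
  .refl (Eventually.of_forall fun _ => polyWeight_nonneg γ)

lemma tendsto_abs_zero : Tendsto (fun t : ℝ => |t|) (𝓝 0) (𝓝 0) := by
  have := continuous_abs.tendsto (0 : ℝ)
  rwa [abs_zero] at this

/-- Stability of inversion in the algebra of series with coefficients `O(n ^ (-γ))`. -/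
lemma unifBound_inverse_sub {A : Type*} [NormedRing A] {γ K : ℝ} (hγ : 1 < γ) {G H : A⟦X⟧}
    (hHG : H * G = 1) (hH : Majorizes H (K • polyWeight γ)) {G' H' : ℝ → A⟦X⟧}
    (hG' : UnifBound (𝓝 0) (fun t => G' t - G) fun t => |t| • polyWeight γ)
    (hGH' : ∀ᶠ t in 𝓝 0, G' t * H' t = 1) :
    UnifBound (𝓝 0) (fun t => H' t - H) fun t => |t| • polyWeight γ := by
  have hHb : UnifBound (𝓝 (0 : ℝ)) (fun _ => H) fun _ => polyWeight γ :=
    hH.unifBound hH.const_nonneg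
  have hww := unifBound_polyWeight_mul hγ (𝓝 0)
  have hF : UnifBound (𝓝 0) (fun t => -(H * (G' t - G))) fun t => |t| • polyWeight γ := by
    refine ((hHb.mul hG').neg.congr_weight fun t => mul_smul_comm _ _ _).trans ?_
    exact hww.smul_real fun t => abs_nonneg t
  -- With `F = -H (G' - G)`, the identities `H G = 1` and `G' H' = 1` give `H' - H = F H'`, that is,
  -- `Y = F H + F Y` for `Y = H' - H`.
  refine UnifBound.of_eq_add_mul (φ := fun _ => polyWeight γ) (v := fun _ => polyWeight γ)
    (F := fun t => -(H * (G' t - G))) (Z := fun t => -(H * (G' t - G)) * H)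
    tendsto_abs_zero (fun t => abs_nonneg t) ?_ hF hww ?_
    (Eventually.of_forall fun _ n => coeff_polyWeight_pos γ n)
  · filter_upwards [hGH'] with t ht
    rw [← mul_add, add_sub_cancel, mul_sub H, hHG, neg_mul, sub_mul, mul_assoc, ht]
    simp
  · refine ((hF.mul hHb).congr_weight fun t => smul_mul_assoc _ _ _).trans ?_
    exact hww.smul_real fun t => abs_nonneg t

/-- The factor `1 - X` removes the slowly decaying geometric series up to the factor `1 - q`, later
`μ⁻¹ m t = O(t²)`. -/
lemma one_sub_X_mul_mk_pow {R : Type*} [CommRing R] (q : R) :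
    (1 - X) * (PowerSeries.mk fun n => q ^ n) =
      1 - (1 - q) • (X * PowerSeries.mk fun n => q ^ n) := by
  ext n
  cases n with
  | zero => simp [sub_mul]
  | succ n =>
    rw [sub_mul, one_mul, map_sub, map_sub, coeff_smul, coeff_succ_X_mul, coeff_mk, coeff_mk,
      coeff_one, if_neg n.succ_ne_zero, smul_eq_mul]
    ring

lemma one_sub_smul_X_mul_mk_pow {R : Type*} [CommRing R] (q : R) :
    (1 - q • X) * (PowerSeries.mk fun n => q ^ n) = 1 := by
  ext n
  cases n with
  | zero => simp [sub_mul]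
  | succ n =>
    rw [sub_mul, one_mul, smul_mul_assoc, map_sub, coeff_smul, coeff_succ_X_mul, coeff_mk,
      coeff_mk, coeff_one, if_neg n.succ_ne_zero, smul_eq_mul]
    ring

section Weights

variable {γ d : ℝ}

/-- The convolution of `(n + 1) ^ (-γ)` and `(1 - d t²) ^ n`. -/
noncomputable def mixedWeight (γ d t : ℝ) : ℝ⟦X⟧ := polyWeight γ * geomSq d t

lemma mixedWeight_nonneg (γ d : ℝ) : ∀ᶠ t in 𝓝 0, CoeffLE 0 (mixedWeight γ d t) :=
  (geomSq_nonneg d).mono fun _ ht => (polyWeight_nonneg γ).mul_nonneg ht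

lemma mixedWeight_pos (γ d : ℝ) : ∀ᶠ t in 𝓝 0, ∀ n, 0 < coeff n (mixedWeight γ d t) := by
  filter_upwards [eventually_mul_sq_lt d] with t ht n
  rw [mixedWeight, coeff_mul]
  refine Finset.sum_pos (fun p _ => mul_pos (coeff_polyWeight_pos _ _) ?_)
    ⟨(0, n), by simp⟩
  rw [geomSq, coeff_geomWeight]
  exact pow_pos (by linarith) _

lemma unifBound_polyWeight_mul_mixedWeight (hγ : 1 < γ) :
    UnifBound (𝓝 0) (fun t => polyWeight γ * mixedWeight γ d t) (mixedWeight γ d) :=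
  ((unifBound_polyWeight_mul hγ (𝓝 0)).mul (UnifBound.refl (geomSq_nonneg d))).congr
    (Eventually.of_forall fun _ => mul_assoc _ _ _)

lemma unifBound_polyWeight_mul_geomSq_two (hd : 0 < d) :
    UnifBound (𝓝 0) (fun t => polyWeight γ * geomSq (2 * d) t) (mixedWeight γ d) :=
  (unifBound_polyWeight γ (𝓝 0)).mul (unifBound_geomSq_two hd)

/-- The factor `t ^ 2` pays for the convolution of the two geometric weights, so the mixed weight
reproduces itself. -/
lemma unifBound_sq_smul_mul_mixedWeight (hγ : 1 < γ) (hd : 0 < d) :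
    UnifBound (𝓝 0) (fun t => t ^ 2 • (polyWeight γ * geomSq (2 * d) t) * mixedWeight γ d t)
      (mixedWeight γ d) :=
  ((unifBound_polyWeight_mul hγ (𝓝 0)).mul (unifBound_sq_smul_geomSq_mul hd)).congr
    (Eventually.of_forall fun t => by
      rw [mixedWeight, mul_smul_comm, smul_mul_assoc]; congr 1; ring)

lemma unifBound_sq_smul_mul_geomSq_two (hd : 0 < d) :
    UnifBound (𝓝 0) (fun t => t ^ 2 • (polyWeight γ * geomSq (2 * d) t) * geomSq (2 * d) t)
      (mixedWeight γ d) := by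
  have h1 : UnifBound (𝓝 0) (fun t : ℝ => t ^ 2 • (geomSq (2 * d) t * geomSq (2 * d) t))
      (geomSq d) :=
    (((UnifBound.refl (geomSq_nonneg (2 * d))).mul (unifBound_geomSq_two hd)).smul_real
      fun t => sq_nonneg t).trans (unifBound_sq_smul_geomSq_mul hd)
  exact ((unifBound_polyWeight γ (𝓝 0)).mul h1).congr (Eventually.of_forall fun t => by
      rw [mul_smul_comm, smul_mul_assoc]; congr 1; ring)

end Weights

variable {γ d : ℝ} {μ : ℂ} {m : ℝ → ℂ}

/-- The inverse of the scalar series `1 - X + m h` is close to the geometric series of ratio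
`1 - m / μ`, when `h(1)` is close to `1 / μ`. -/
lemma unifBound_scalar_inverse_sub {Km Ku : ℝ} (hγ : 1 < γ) (hd : 0 < d) (hKm : 0 ≤ Km)
    (hm : ∀ᶠ t in 𝓝 0, ‖m t‖ ≤ Km * t ^ 2)
    (hq : ∀ᶠ t in 𝓝 0, ‖1 - μ⁻¹ * m t‖ ≤ 1 - 2 * d * t ^ 2)
    {h₀ u : ℂ⟦X⟧} (hh₀ : h₀ = C μ⁻¹ - (1 - X) * u) (hu : Majorizes u (Ku • polyWeight γ))
    {h y : ℝ → ℂ⟦X⟧} (hh : UnifBound (𝓝 0) (fun t => h t - h₀) fun t => |t| • polyWeight γ)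
    (hy : ∀ᶠ t in 𝓝 0, (1 - X + m t • h t) * y t = 1) :
    UnifBound (𝓝 0) (fun t => y t - PowerSeries.mk fun n => (1 - μ⁻¹ * m t) ^ n)
      fun t => |t| • mixedWeight γ d t := by
  set geo : ℝ → ℂ⟦X⟧ := fun t => PowerSeries.mk fun n => (1 - μ⁻¹ * m t) ^ n with hgeo
  have hgeob : UnifBound (𝓝 0) geo (geomSq (2 * d)) := unifBound_mk_pow hq
  have hXgeo : UnifBound (𝓝 0) (fun t => X * geo t) (geomSq (2 * d)) := by
    refine UnifBound.trans ?_ unifBound_X_mul_geomSq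
    obtain ⟨K, hK, h⟩ := hgeob
    refine ⟨K, hK, h.mono fun t ht n => ?_⟩
    cases n with
    | zero => simp
    | succ n =>
      have := ht n
      rw [coeff_smul] at this ⊢
      rwa [coeff_succ_X_mul, coeff_succ_X_mul]
  have habs : ∀ t : ℝ, 0 ≤ |t| := fun t => abs_nonneg t
  have hle1 : ∀ᶠ t : ℝ in 𝓝 0, |t| ≤ 1 := tendsto_abs_zero.eventually_le_const one_pos
  -- Chosen so that `h₀ = μ⁻¹ X + (1 - X) c`: the first term turns `1 - X` into `1 - (1 - μ⁻¹ m) X`,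
  -- and the second carries the factor `1 - X`.
  set c : ℂ⟦X⟧ := C μ⁻¹ - u with hc
  have hcb : UnifBound (𝓝 (0 : ℝ)) (fun _ => c) fun _ => polyWeight γ :=
    ((majorizes_C le_rfl).unifBound (norm_nonneg _)).sub (hu.unifBound hu.const_nonneg)
  have hφ0 : ∀ᶠ t : ℝ in 𝓝 0, CoeffLE 0 (t ^ 2 • (polyWeight γ * geomSq (2 * d) t)) := by
    filter_upwards [geomSq_nonneg (2 * d)] with t ht
    have := ((polyWeight_nonneg γ).mul_nonneg ht).smul (sq_nonneg t)
    rwa [smul_zero] at this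
  set φ : ℝ → ℝ⟦X⟧ := fun t => polyWeight γ + t ^ 2 • (polyWeight γ * geomSq (2 * d) t)
  have hφ1 : UnifBound (𝓝 0) (fun _ => polyWeight γ) φ := (unifBound_polyWeight γ _).add_left hφ0
  have hφ2 : UnifBound (𝓝 0) (fun t => t ^ 2 • (polyWeight γ * geomSq (2 * d) t)) φ :=
    (UnifBound.refl hφ0).add_right (Eventually.of_forall fun _ => polyWeight_nonneg γ)
  -- the error term
  set F : ℝ → ℂ⟦X⟧ := fun t => -(m t • ((1 - X) * c + (h t - h₀)) * geo t) with hFdef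
  -- Expanding `(1 - X) geo`, the error splits into `m c`, `μ⁻¹ m² c X geo` and `m (h - h₀) geo`, of
  -- respective sizes `t²`, `t⁴` and `|t|³`; the last two contain a geometric weight and use the
  -- second term of `φ`.
  have hF : UnifBound (𝓝 0) F fun t => |t| • φ t := by
    have t1 : UnifBound (𝓝 0) (fun t => m t • c) fun t => |t| • φ t := by
      refine (hcb.smul (σ := fun t => |t|) hKm ?_).trans (hφ1.smul_real habs)
      filter_upwards [hm, hle1] with t ht h1
      refine ht.trans (mul_le_mul_of_nonneg_left ?_ hKm)
      rw [← sq_abs]; nlinarith [abs_nonneg t]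
    have t2 : UnifBound (𝓝 0) (fun t => (m t * (μ⁻¹ * m t)) • (c * (X * geo t)))
        fun t => |t| • φ t := by
      refine ((hcb.mul hXgeo).smul (σ := fun t => |t| * t ^ 2) (K := Km * ‖μ⁻¹‖ * Km)
        (by positivity) ?_).trans ((hφ2.smul_real habs).congr
          (Eventually.of_forall fun t => by rw [smul_smul]))
      filter_upwards [hm, hle1] with t ht h1
      rw [norm_mul, norm_mul]
      have h2 : t ^ 2 ≤ |t| := by rw [← sq_abs]; nlinarith [abs_nonneg t]
      calc ‖m t‖ * (‖μ⁻¹‖ * ‖m t‖) ≤ (Km * |t|) * (‖μ⁻¹‖ * (Km * t ^ 2)) := by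
            gcongr; exact ht.trans (by gcongr)
        _ = _ := by ring
    have t3 : UnifBound (𝓝 0) (fun t => m t • ((h t - h₀) * geo t)) fun t => |t| • φ t := by
      refine ((hh.mul hgeob).smul (σ := fun t => t ^ 2) hKm hm).trans
        ((hφ2.smul_real habs).congr (Eventually.of_forall fun t => by
          rw [smul_mul_assoc, smul_comm]))
    refine ((t1.sub t2).add t3).neg.congr (Eventually.of_forall fun t => ?_)
    have e := one_sub_X_mul_mk_pow (1 - μ⁻¹ * m t)
    rw [sub_sub_cancel] at e
    change (1 - X) * geo t = 1 - (μ⁻¹ * m t) • (X * geo t) at e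
    simp only [hFdef]
    congr 1
    rw [mul_smul, ← smul_sub, ← smul_add, smul_mul_assoc, add_mul, mul_comm (1 - X) c, mul_assoc c,
      e, mul_sub, mul_one, mul_smul_comm]
  have hφv : UnifBound (𝓝 0) (fun t => φ t * mixedWeight γ d t) (mixedWeight γ d) :=
    ((unifBound_polyWeight_mul_mixedWeight hγ).add
      (unifBound_sq_smul_mul_mixedWeight hγ hd)).congr
      (Eventually.of_forall fun t => (add_mul _ _ _).symm)
  have hφg : UnifBound (𝓝 0) (fun t => φ t * geomSq (2 * d) t) (mixedWeight γ d) :=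
    ((unifBound_polyWeight_mul_geomSq_two hd).add
      (unifBound_sq_smul_mul_geomSq_two hd)).congr
      (Eventually.of_forall fun t => (add_mul _ _ _).symm)
  -- Multiplying the equation for `y` by `geo` gives `y = geo + F y`, hence `Y = F geo + F Y` for `Y
  -- = y - geo`.
  refine UnifBound.of_eq_add_mul (F := F) (Z := fun t => F t * geo t) (φ := φ)
    tendsto_abs_zero habs ?_ hF hφv ?_ (mixedWeight_pos γ d)
  · filter_upwards [hy] with t ht
    have e := one_sub_smul_X_mul_mk_pow (1 - μ⁻¹ * m t)
    change (1 - (1 - μ⁻¹ * m t) • X) * geo t = 1 at e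
    have e2 : (1 - X + m t • h t) = (1 - (1 - μ⁻¹ * m t) • X) +
        m t • ((1 - X) * c + (h t - h₀)) := by
      rw [hh₀, hc]
      simp only [smul_eq_C_mul, map_sub, map_one, map_mul]
      ring
    rw [← mul_add, add_sub_cancel, hFdef]
    dsimp only
    rw [e2] at ht
    linear_combination geo t * ht - y t * e
  · refine ((hF.mul hgeob).congr_weight fun t => smul_mul_assoc _ _ _).trans ?_
    exact hφg.smul_real habs

end PerturbedSeries

/-! ### Asymptotics of the full inverse. -/

section InverseAsymptotics

open PowerSeries

lemma UnifBound.map_algebraMap {ι : Type*} {l : Filter ι} {A : Type*} [NormedRing A]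
    [NormedAlgebra ℂ A] [NormOneClass A] {F : ι → ℂ⟦X⟧} {a : ι → ℝ⟦X⟧} (h : UnifBound l F a) :
    UnifBound l (fun t => PowerSeries.map (algebraMap ℂ A) (F t)) a := by
  obtain ⟨C, hC, h⟩ := h
  refine ⟨C, hC, h.mono fun t ht n => ?_⟩
  rw [coeff_map, norm_algebraMap']
  exact ht n

variable {A : Type*} [NormedRing A] [NormedAlgebra ℂ A]

variable [CompleteSpace A] [NormOneClass A] {γ d : ℝ} {μ : ℂ} {m : ℝ → ℂ}

/-- Asymptotics of the inverse of `1 - R`, as given by `one_sub_mul_inverse_eq_one`. -/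
theorem unifBound_inverse_sub_geometric {Km KH Kp : ℝ} (hγ : 1 < γ) (hd : 0 < d) (hKm : 0 ≤ Km)
    (hm : ∀ᶠ t in 𝓝 0, ‖m t‖ ≤ Km * t ^ 2)
    (hq : ∀ᶠ t in 𝓝 0, ‖1 - μ⁻¹ * m t‖ ≤ 1 - 2 * d * t ^ 2)
    {P : A} {H₀ : A⟦X⟧} (hH₀ : Majorizes H₀ (KH • polyWeight (γ + 1)))
    (hPH : P * evalAt H₀ 1 = μ⁻¹ • P)
    {P' : ℝ → A} {H' : ℝ → A⟦X⟧} {y : ℝ → ℂ⟦X⟧} (hKp : 0 ≤ Kp)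
    (hP' : ∀ᶠ t in 𝓝 0, ‖P' t - P‖ ≤ Kp * |t|)
    (hH' : UnifBound (𝓝 0) (fun t => H' t - H₀) fun t => |t| • polyWeight γ)
    (hy : UnifBound (𝓝 0) (fun t => y t - PowerSeries.mk fun n => (1 - μ⁻¹ * m t) ^ n)
      fun t => |t| • mixedWeight γ d t) :
    UnifBound (𝓝 0) (fun t =>
      (C (1 - P' t) * H' t + (C (P' t) - m t • (C (1 - P' t) * H' t * C (P' t))) *
        PowerSeries.map (algebraMap ℂ A) (y t) * H' t) -
      PowerSeries.map (algebraMap ℂ A) (μ⁻¹ • PowerSeries.mk fun n => (1 - μ⁻¹ * m t) ^ n) * C P)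
      fun t => polyWeight γ + |t| • mixedWeight γ d t := by
  set geo : ℝ → ℂ⟦X⟧ := fun t => PowerSeries.mk fun n => (1 - μ⁻¹ * m t) ^ n with hgeo
  set ι : ℂ⟦X⟧ →+* A⟦X⟧ := PowerSeries.map (algebraMap ℂ A) with hι
  have habs : ∀ t : ℝ, 0 ≤ |t| := fun t => abs_nonneg t
  have hle1 : ∀ᶠ t : ℝ in 𝓝 0, |t| ≤ 1 := tendsto_abs_zero.eventually_le_const one_pos
  have hsq : ∀ᶠ t : ℝ in 𝓝 0, t ^ 2 ≤ |t| := by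
    filter_upwards [hle1] with t h1
    rw [← sq_abs]; nlinarith [abs_nonneg t]
  have hm1 : ∀ᶠ t in 𝓝 0, ‖m t‖ ≤ Km * |t| := by
    filter_upwards [hm, hsq] with t ht h2
    exact ht.trans (mul_le_mul_of_nonneg_left h2 hKm)
  have hW0 : ∀ᶠ t : ℝ in 𝓝 0, CoeffLE 0 (polyWeight γ) :=
    Eventually.of_forall fun _ => polyWeight_nonneg γ
  have hV0 : ∀ᶠ t : ℝ in 𝓝 0, CoeffLE 0 (|t| • mixedWeight γ d t) := by
    filter_upwards [mixedWeight_nonneg γ d] with t ht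
    have := ht.smul (habs t)
    rwa [smul_zero] at this
  -- bounds of the ingredients
  have hP'n : ∀ᶠ t in 𝓝 0, ‖P' t‖ ≤ Kp + ‖P‖ := by
    filter_upwards [hP', hle1] with t ht h1
    calc ‖P' t‖ = ‖(P' t - P) + P‖ := by rw [sub_add_cancel]
      _ ≤ Kp * |t| + ‖P‖ := (norm_add_le _ _).trans (by gcongr)
      _ ≤ _ := by gcongr; exact mul_le_of_le_one_right hKp h1
  have hQ'n : ∀ᶠ t in 𝓝 0, ‖1 - P' t‖ ≤ 1 + (Kp + ‖P‖) := by
    filter_upwards [hP'n] with t ht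
    refine (norm_sub_le _ _).trans ?_
    rw [norm_one]; gcongr
  have hH₀b : UnifBound (𝓝 (0 : ℝ)) (fun _ => H₀) fun _ => polyWeight γ :=
    (hH₀.trans ((polyWeight_anti (by linarith)).smul hH₀.const_nonneg)).unifBound
      hH₀.const_nonneg
  have hH'b : UnifBound (𝓝 0) H' fun _ => polyWeight γ := by
    have : UnifBound (𝓝 (0 : ℝ)) (fun t => |t| • polyWeight γ) fun _ => polyWeight γ := by
      refine UnifBound.of_coeffLE zero_le_one ?_
      filter_upwards [hle1] with t h1
      constructor
      · have := (polyWeight_nonneg γ).smul (habs t)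
        rwa [smul_zero] at this
      · exact CoeffLE.smul_right h1 (polyWeight_nonneg γ)
    exact ((hH'.trans this).add hH₀b).congr (Eventually.of_forall fun t => sub_add_cancel _ _)
  have hgeob : UnifBound (𝓝 0) geo (geomSq (2 * d)) := unifBound_mk_pow hq
  have hXgeo : UnifBound (𝓝 0) (fun t => X * geo t) (geomSq (2 * d)) := by
    refine UnifBound.trans ?_ unifBound_X_mul_geomSq
    obtain ⟨K, hK, h⟩ := hgeob
    refine ⟨K, hK, h.mono fun t ht n => ?_⟩
    cases n with
    | zero => simp
    | succ n =>
      have := ht n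
      rw [coeff_smul] at this ⊢
      rwa [coeff_succ_X_mul, coeff_succ_X_mul]
  have hwv := unifBound_polyWeight_mul_mixedWeight (d := d) hγ
  have hwg := unifBound_polyWeight_mul_geomSq_two (γ := γ) hd
  have hww := unifBound_polyWeight_mul hγ (𝓝 0)
  have habsv : UnifBound (𝓝 0) (fun t => |t| • mixedWeight γ d t) (mixedWeight γ d) := by
    refine UnifBound.of_coeffLE zero_le_one ?_
    filter_upwards [hle1, hV0, mixedWeight_nonneg γ d] with t h1 h2 h3
    exact ⟨h2, CoeffLE.smul_right h1 h3⟩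
  -- multiplication by `y` turns the polynomial weight into the mixed one
  have hmuly : ∀ F : ℝ → A⟦X⟧, UnifBound (𝓝 0) F (fun _ => polyWeight γ) →
      UnifBound (𝓝 0) (fun t => F t * ι (y t)) (mixedWeight γ d) := by
    intro F hF
    have h1 := (hF.mul (hgeob.map_algebraMap (A := A))).trans hwg
    have h2 := ((hF.mul (hy.map_algebraMap (A := A))).congr_weight
      fun t => mul_smul_comm _ _ _).trans ((hwv.smul_real habs).trans habsv)
    refine (h1.add h2).congr (Eventually.of_forall fun t => ?_)
    rw [← mul_add, ← map_add, add_sub_cancel]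
  have hmuly' : ∀ F : ℝ → A⟦X⟧, UnifBound (𝓝 0) F (fun t => |t| • polyWeight γ) →
      UnifBound (𝓝 0) (fun t => F t * ι (y t)) (fun t => |t| • mixedWeight γ d t) := by
    intro F hF
    have h1 := ((hF.mul (hgeob.map_algebraMap (A := A))).congr_weight
      fun t => smul_mul_assoc _ _ _).trans (hwg.smul_real habs)
    have h2 := ((hF.mul (hy.map_algebraMap (A := A))).congr_weight
      fun t => (smul_mul_assoc _ _ _).trans (congrArg _ (mul_smul_comm _ _ _))).trans
      (((hwv.smul_real habs).trans habsv).smul_real habs)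
    refine (h1.add h2).congr (Eventually.of_forall fun t => ?_)
    rw [← mul_add, ← map_add, add_sub_cancel]
  -- The difference is `t1 + t2 + t3 - t4 - t5`: replace `P' H'` by `P H₀` in `P' H' y` (`t2`), then
  -- `y` by `geo` (`t3`), then `P H₀` by its value `μ⁻¹ P` at `1` (`t4`). The terms `t1` and `t5`
  -- are those beginning with `1 - P'`.
  have t1 : UnifBound (𝓝 0) (fun t => C (1 - P' t) * H' t)
      fun t => polyWeight γ + |t| • mixedWeight γ d t :=
    (hH'b.C_mul (by positivity) hQ'n).add_left hV0
  have t2 : UnifBound (𝓝 0) (fun t => (C (P' t) * H' t - C P * H₀) * ι (y t))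
      fun t => polyWeight γ + |t| • mixedWeight γ d t := by
    refine (hmuly' _ ?_).add_right hW0
    have a1 := hH'.C_mul (by positivity) hP'n
    have a2 := hH₀b.C_mul_of_le hKp hP'
    refine (a1.add a2).congr (Eventually.of_forall fun t => ?_)
    rw [map_sub, mul_sub, sub_mul]; abel
  have t3 : UnifBound (𝓝 0) (fun t => C P * H₀ * ι (y t - geo t))
      fun t => polyWeight γ + |t| • mixedWeight γ d t := by
    refine UnifBound.add_right ?_ hW0
    have a1 := hH₀b.C_mul (B := fun _ => P) (norm_nonneg P) (Eventually.of_forall fun _ => le_rfl)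
    exact ((a1.mul (hy.map_algebraMap (A := A))).congr_weight
      fun t => mul_smul_comm _ _ _).trans (hwv.smul_real habs)
  -- `P H₀ = μ⁻¹ P - (1 - X) U`. Taking tails costs one power, which is why `H₀` is required to
  -- decay at rate `γ + 1`.
  set U : A⟦X⟧ := tailSeries (C P * H₀) with hU
  have hCPH : Majorizes (C P * H₀) ((‖P‖ * KH) • polyWeight (γ + 1)) := by
    rw [mul_smul]; exact hH₀.C_mul le_rfl
  have hUb : UnifBound (𝓝 (0 : ℝ)) (fun _ => U) fun _ => polyWeight γ :=
    (hCPH.tailSeries hγ.le).unifBound hCPH.const_nonneg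
  have t4 : UnifBound (𝓝 0) (fun t => U - (μ⁻¹ * m t) • (U * ι (X * geo t)))
      fun t => polyWeight γ + |t| • mixedWeight γ d t := by
    refine (hUb.add_left hV0).sub (UnifBound.add_right ?_ hW0)
    refine ((hUb.mul (hXgeo.map_algebraMap (A := A))).smul (σ := fun t => |t|)
      (K := ‖μ⁻¹‖ * Km) (by positivity) ?_).trans (hwg.smul_real habs)
    filter_upwards [hm1] with t ht
    rw [norm_mul, mul_assoc]; gcongr
  have t5 : UnifBound (𝓝 0)
      (fun t => m t • (C (1 - P' t) * H' t * C (P' t) * H' t * ι (y t)))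
      fun t => polyWeight γ + |t| • mixedWeight γ d t := by
    refine UnifBound.add_right ?_ hW0
    refine UnifBound.smul (hmuly _ ?_) hKm hm1
    exact (((hH'b.C_mul (by positivity) hQ'n).mul_C (by positivity) hP'n).mul hH'b).trans hww
  refine ((((t1.add t2).add t3).sub t4).sub t5).congr (Eventually.of_forall fun t => ?_)
  have hcomm : ι (y t) * H' t = H' t * ι (y t) := (map_algebraMap_commute _ _).symm
  have hCPHs : Summable fun n => ‖coeff n H₀‖ := hH₀.summable (by linarith)
  have e1 : C P * H₀ = μ⁻¹ • C P - (1 - X) * U := by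
    have := eq_C_sub_tailSeries (hCPH.summable (by linarith))
    rwa [evalAt_C_mul hCPHs P (by simp), hPH, C_smul_eq] at this
  have e2 : (1 - X) * ι (geo t) = 1 - (μ⁻¹ * m t) • ι (X * geo t) := by
    have := congrArg ι (one_sub_X_mul_mk_pow (1 - μ⁻¹ * m t))
    rw [sub_sub_cancel, map_mul, map_sub, map_sub, map_one] at this
    have hX : ι X = X := by rw [hι, map_X]
    rw [hX] at this
    rw [this]
    congr 1
    ext n
    rw [coeff_map, coeff_smul, coeff_smul, coeff_map, smul_eq_mul, map_mul, Algebra.smul_def]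
  have e3 : C P * H₀ * ι (geo t) = μ⁻¹ • (C P * ι (geo t)) -
      (U - (μ⁻¹ * m t) • (U * ι (X * geo t))) := by
    have hx : (1 - X) * U = U * (1 - X) := by
      rw [mul_sub, sub_mul, mul_one, one_mul, (commute_X U).eq]
    rw [e1, sub_mul, smul_mul_assoc, hx, mul_assoc, e2, mul_sub, mul_one, mul_smul_comm]
  have e4 : ι (μ⁻¹ • geo t) * C P = μ⁻¹ • (C P * ι (geo t)) := by
    have : ι (μ⁻¹ • geo t) = μ⁻¹ • ι (geo t) := by
      ext n
      rw [coeff_map, coeff_smul, coeff_smul, coeff_map, smul_eq_mul, map_mul, Algebra.smul_def]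
    rw [this, smul_mul_assoc, map_algebraMap_commute]
  change _ = _ - ι (μ⁻¹ • geo t) * C P
  simp only [e4, sub_mul, map_sub ι, mul_sub, e3]
  simp only [smul_mul_assoc, mul_assoc, hcomm]
  abel

end InverseAsymptotics

/-! ### From sequences of operators to formal series. -/

section OperatorSeries

open PowerSeries

variable {E : Type*} [NormedAddCommGroup E] [NormedSpace ℂ E]

/-- The formal power series `∑_{n ≥ 1} Rₙ Xⁿ`. -/
noncomputable def seriesOf (R : ℕ → E →L[ℂ] E) : (E →L[ℂ] E)⟦X⟧ :=
  PowerSeries.mk fun n => if n = 0 then 0 else R n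

lemma coeff_zero_seriesOf (R : ℕ → E →L[ℂ] E) : coeff 0 (seriesOf R) = 0 := by
  rw [seriesOf, coeff_mk, if_pos rfl]

lemma coeff_succ_seriesOf (R : ℕ → E →L[ℂ] E) (n : ℕ) :
    coeff (n + 1) (seriesOf R) = R (n + 1) := by
  rw [seriesOf, coeff_mk, if_neg n.succ_ne_zero]

lemma seriesOf_sub (R R' : ℕ → E →L[ℂ] E) :
    seriesOf (fun k => R k - R' k) = seriesOf R - seriesOf R' := by
  ext1 n
  rw [map_sub]
  cases n with
  | zero => simp only [coeff_zero_seriesOf, sub_zero]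
  | succ n => simp only [coeff_succ_seriesOf]

lemma evalAt_seriesOf (R : ℕ → E →L[ℂ] E) (z : ℂ) : evalAt (seriesOf R) z = opSeries R z := by
  unfold evalAt opSeries
  rw [← Nat.succ_injective.tsum_eq (f := fun n => z ^ n • coeff n (seriesOf R))]
  · exact tsum_congr fun n => by rw [Nat.succ_eq_add_one, coeff_succ_seriesOf]
  · intro n hn
    cases n with
    | zero => simp [coeff_zero_seriesOf] at hn
    | succ n => exact ⟨n, rfl⟩

lemma summable_seriesOf {R : ℕ → E →L[ℂ] E} (h : Summable fun k => ‖R (k + 1)‖) :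
    Summable fun n => ‖coeff n (seriesOf R)‖ := by
  rw [← summable_nat_add_iff 1]
  simpa only [coeff_succ_seriesOf] using h

lemma normTail_eq (R : ℕ → E →L[ℂ] E) (n : ℕ) :
    normTail R n = ∑' k, ‖coeff (n + 1 + k) (seriesOf R)‖ := by
  refine tsum_congr fun k => ?_
  rw [add_right_comm, coeff_succ_seriesOf]

lemma norm_coeff_tailSeries_seriesOf_le {R : ℕ → E →L[ℂ] E}
    (h : Summable fun k => ‖R (k + 1)‖) (n : ℕ) :
    ‖coeff n (tailSeries (seriesOf R))‖ ≤ normTail R n := by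
  rw [normTail_eq, coeff_tailSeries]
  exact norm_tsum_le_tsum_norm (summable_coeff_add (summable_seriesOf h) (n + 1))

lemma norm_opSeries_one_le {R : ℕ → E →L[ℂ] E} (h : Summable fun k => ‖R (k + 1)‖) :
    ‖opSeries R 1‖ ≤ normTail R 0 := by
  unfold opSeries normTail
  simp only [one_pow, one_smul, zero_add, add_comm 1]
  exact norm_tsum_le_tsum_norm h

lemma majorizes_tailSeries_seriesOf {R : ℕ → E →L[ℂ] E} {K s : ℝ}
    (h : Summable fun k => ‖R (k + 1)‖) (hK : ∀ n, normTail R n ≤ K * coeff n (polyWeight s)) :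
    Majorizes (tailSeries (seriesOf R)) (K • polyWeight s) := fun n => by
  simpa using (norm_coeff_tailSeries_seriesOf_le h n).trans (hK n)

/-- A coefficient is bounded by the tail that starts at it; the shift of index by one costs `2 ^ s`.
-/
lemma majorizes_seriesOf {R : ℕ → E →L[ℂ] E} {K s : ℝ} (hs : 0 ≤ s) (hK0 : 0 ≤ K)
    (h : Summable fun k => ‖R (k + 1)‖) (hK : ∀ n, normTail R n ≤ K * coeff n (polyWeight s)) :
    Majorizes (seriesOf R) ((2 ^ s * K) • polyWeight s) := fun n => by
  rw [coeff_smul, smul_eq_mul]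
  cases n with
  | zero =>
    rw [coeff_zero_seriesOf, norm_zero]
    exact mul_nonneg (by positivity) (coeff_polyWeight_pos s 0).le
  | succ n =>
    rw [coeff_succ_seriesOf]
    have h1 : ‖R (n + 1)‖ ≤ normTail R n := by
      have hs := summable_coeff_add (summable_seriesOf h) (n + 1)
      have := hs.le_tsum 0 fun _ _ => norm_nonneg _
      rwa [← normTail_eq, add_zero, coeff_succ_seriesOf] at this
    refine (h1.trans (hK n)).trans ?_
    have h2 : coeff n (polyWeight s) ≤ 2 ^ s * coeff (n + 1) (polyWeight s) := by
      rw [coeff_polyWeight, coeff_polyWeight, mul_one_div, div_le_div_iff₀ (by positivity)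
        (by positivity), one_mul, ← Real.mul_rpow (by norm_num) (by positivity)]
      push_cast
      exact Real.rpow_le_rpow (by positivity) (by linarith [n.cast_nonneg (α := ℝ)]) hs
    calc K * coeff n (polyWeight s) ≤ K * (2 ^ s * coeff (n + 1) (polyWeight s)) :=
          mul_le_mul_of_nonneg_left h2 hK0
      _ = _ := by ring

lemma exists_normTail_le {R : ℕ → E →L[ℂ] E} {β : ℝ} (hβ : 0 ≤ β)
    (h : normTail R =O[atTop] fun n : ℕ => 1 / (n : ℝ) ^ β) :
    ∃ K : ℝ, 0 ≤ K ∧ ∀ n, normTail R n ≤ K * coeff n (polyWeight β) := by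
  have h1 : (fun n : ℕ => 1 / (n : ℝ) ^ β) =O[atTop] fun n => coeff n (polyWeight β) := by
    refine IsBigO.of_bound (2 ^ β) ?_
    filter_upwards [eventually_ge_atTop 1] with n hn
    have hn1 : (1 : ℝ) ≤ n := by exact_mod_cast hn
    rw [Real.norm_of_nonneg (by positivity), Real.norm_of_nonneg (coeff_polyWeight_pos _ _).le,
      coeff_polyWeight, mul_one_div, div_le_div_iff₀ (by positivity) (by positivity), one_mul,
      ← Real.mul_rpow (by norm_num) (by positivity)]
    exact Real.rpow_le_rpow (by positivity) (by linarith) hβ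
  have h2 := (isBigO_nat_atTop_iff
    fun n hn => absurd hn (coeff_polyWeight_pos β n).ne').1 (h.trans h1)
  obtain ⟨K, hK⟩ := h2
  have hK0 : 0 ≤ K := by
    have := (norm_nonneg _).trans (hK 0)
    rw [Real.norm_of_nonneg (coeff_polyWeight_pos _ _).le] at this
    exact nonneg_of_mul_nonneg_left this (coeff_polyWeight_pos β 0)
  refine ⟨K, hK0, fun n => ?_⟩
  have := hK n
  rw [Real.norm_of_nonneg (coeff_polyWeight_pos _ _).le] at this
  exact (le_abs_self _).trans this

variable [CompleteSpace E]

lemma tailSeries_sub {A : Type*} [NormedRing A] [CompleteSpace A] {F G : A⟦X⟧}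
    (hF : Summable fun n => ‖coeff n F‖) (hG : Summable fun n => ‖coeff n G‖) :
    tailSeries (F - G) = tailSeries F - tailSeries G := by
  ext n
  rw [map_sub, coeff_tailSeries, coeff_tailSeries, coeff_tailSeries,
    ← (summable_coeff_add hF (n + 1)).of_norm.tsum_sub (summable_coeff_add hG (n + 1)).of_norm]
  simp only [map_sub]

/-- The difference quotient at `1` is exactly the tail series evaluated at `z`, which is continuous
on the closed disk. -/
lemma opSeriesDerivOne_eq {R : ℕ → E →L[ℂ] E} (h : Summable fun k => ‖R (k + 1)‖)
    (hS : Summable fun n => ‖coeff n (tailSeries (seriesOf R))‖) :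
    opSeriesDerivOne R = evalAt (tailSeries (seriesOf R)) 1 := by
  have hd : HasDerivWithinAt (opSeries R) (evalAt (tailSeries (seriesOf R)) 1)
      (Metric.closedBall 0 1) 1 := by
    rw [hasDerivWithinAt_iff_tendsto_slope]
    have hc := (continuousOn_evalAt hS 1 (by simp)).mono_left
      (nhdsWithin_mono 1 (Set.sdiff_subset (s := Metric.closedBall (0 : ℂ) 1) (t := {1})))
    refine hc.congr' ?_
    filter_upwards [self_mem_nhdsWithin] with z hz
    have hz1 : z - 1 ≠ 0 := sub_ne_zero.2 hz.2
    have hzb : ‖z‖ ≤ 1 := by simpa using hz.1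
    have e := evalAt_eq_sub_tailSeries (summable_seriesOf h) hS hzb
    rw [evalAt_seriesOf, evalAt_seriesOf] at e
    rw [slope_def_module, e, sub_sub_cancel_left, ← neg_smul, neg_sub, smul_smul,
      inv_mul_cancel₀ hz1, one_smul]
  refine hd.derivWithin ?_
  exact ((uniqueDiffOn_convex (convex_closedBall (0 : ℂ) 1)
    (by rw [interior_closedBall _ one_ne_zero]; exact ⟨0, by simp⟩)) 1 (by simp)).mono_field

end OperatorSeries

/-! ### The perturbed eigenvalue. -/

section Eigenvalue

/-- For small `t`, `|1 - c t²/μ|` is at most `1 - Re c t²/(2μ)`; replacing `c t²` by `M` costs at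
most half of this gain. The remaining `Re c/(4μ)` is written as `2 d`, to match the two geometric
rates. -/
lemma eventually_norm_one_sub_le {μ : ℝ} (hμ : 0 < μ) {M : ℝ → ℂ} {c : ℂ} (hc : 0 < c.re)
    (hM : M ~[𝓝 (0 : ℝ)] fun t : ℝ => c * (t : ℂ) ^ 2) :
    ∀ᶠ t in 𝓝 (0 : ℝ), ‖1 - (μ : ℂ)⁻¹ * M t‖ ≤ 1 - 2 * (c.re / (8 * μ)) * t ^ 2 := by
  have hc0 : 0 < ‖c‖ := norm_pos_iff.2 fun h => by simp [h] at hc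
  have h1 := hM.isLittleO.bound (c := c.re / (4 * ‖c‖)) (by positivity)
  have ht : ∀ a b : ℝ, 0 < b → ∀ᶠ t : ℝ in 𝓝 0, a * t ^ 2 < b := fun a b hb => by
    have : Tendsto (fun t : ℝ => a * t ^ 2) (𝓝 0) (𝓝 (a * 0 ^ 2)) :=
      Continuous.tendsto (by fun_prop) 0
    exact this.eventually_lt_const (by simpa using hb)
  filter_upwards [h1, ht (μ⁻¹ * ‖c‖ ^ 2) c.re hc, ht (μ⁻¹ * c.re) 1 one_pos] with t h1 h2 h3
  set κ : ℝ := μ⁻¹ with hκ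
  have hκ0 : 0 < κ := by positivity
  have e0 : ((μ : ℂ)⁻¹) = (κ : ℂ) := by rw [hκ]; push_cast; rfl
  have h1' : ‖M t - c * (t : ℂ) ^ 2‖ ≤ c.re / 4 * t ^ 2 := by
    refine h1.trans (le_of_eq ?_)
    rw [norm_mul, norm_pow, Complex.norm_real, Real.norm_eq_abs, sq_abs]
    field_simp
  have h4 : ‖1 - (κ : ℂ) * (c * (t : ℂ) ^ 2)‖ ≤ 1 - κ * c.re * t ^ 2 / 2 := by
    refine abs_le_of_sq_le_sq' ?_ (by nlinarith) |>.2
    rw [← Complex.normSq_eq_norm_sq, Complex.normSq_apply]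
    have er : ∀ x : ℝ, (1 - (κ : ℂ) * (c * (x : ℂ))).re = 1 - κ * c.re * x := fun x => by
      simp [mul_assoc]
    have ei : ∀ x : ℝ, (1 - (κ : ℂ) * (c * (x : ℂ))).im = -(κ * c.im * x) := fun x => by
      simp [mul_assoc]
    rw [← Complex.ofReal_pow, er, ei]
    have hn : ‖c‖ ^ 2 = c.re * c.re + c.im * c.im := by
      rw [← Complex.normSq_eq_norm_sq, Complex.normSq_apply]
    have h5 := mul_le_mul_of_nonneg_left h2.le (by positivity : 0 ≤ κ * t ^ 2)
    rw [hn] at h5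
    nlinarith [sq_nonneg (κ * c.re * t ^ 2)]
  have e : 1 - (μ : ℂ)⁻¹ * M t =
      (1 - (κ : ℂ) * (c * (t : ℂ) ^ 2)) - (κ : ℂ) * (M t - c * (t : ℂ) ^ 2) := by
    rw [e0]; ring
  rw [e]
  refine (norm_sub_le _ _).trans ?_
  rw [norm_mul, Complex.norm_real, Real.norm_of_nonneg hκ0.le]
  have h6 := mul_le_mul_of_nonneg_left h1' hκ0.le
  have e8 : c.re / (8 * μ) = κ * c.re / 8 := by rw [hκ]; field_simp
  rw [e8]
  linarith

lemma exists_norm_le_sq {M : ℝ → ℂ} {c : ℂ}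
    (hM : M ~[𝓝 (0 : ℝ)] fun t : ℝ => c * (t : ℂ) ^ 2) :
    ∃ K : ℝ, 0 ≤ K ∧ ∀ᶠ t in 𝓝 (0 : ℝ), ‖M t‖ ≤ K * t ^ 2 := by
  obtain ⟨K, hK, h⟩ := hM.isBigO.exists_nonneg
  refine ⟨K * ‖c‖, by positivity, h.bound.mono fun t ht => ht.trans (le_of_eq ?_)⟩
  rw [norm_mul, norm_pow, Complex.norm_real, Real.norm_eq_abs, sq_abs, mul_assoc]

end Eigenvalue

/-! ### Convergence of the formal inverse; dependence of the regularization on `t`. -/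

section Assembly

open PowerSeries

/-- The sum of the coefficients of a mixed weight is bounded by a constant. -/
lemma exists_coeff_mixedWeight_le {γ : ℝ} (hγ : 1 < γ) {d : ℝ} (hd : 0 < d) :
    ∃ W : ℝ, 0 ≤ W ∧ ∀ᶠ t in 𝓝 (0 : ℝ), ∀ n, coeff n (mixedWeight γ d t) ≤ W := by
  have hsum := summable_polyWeight hγ
  refine ⟨∑' n, coeff n (polyWeight γ), tsum_nonneg fun n => (coeff_polyWeight_pos γ n).le, ?_⟩
  filter_upwards [eventually_mul_sq_lt d] with t ht n
  rw [mixedWeight, coeff_mul, Finset.Nat.sum_antidiagonal_eq_sum_range_succ_mk]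
  refine le_trans (Finset.sum_le_sum fun k _ => ?_)
    (hsum.sum_le_tsum (Finset.range n.succ) fun k _ => (coeff_polyWeight_pos γ k).le)
  dsimp only
  rw [geomSq, coeff_geomWeight]
  exact mul_le_of_le_one_right (coeff_polyWeight_pos γ k).le
    (pow_le_one₀ (by linarith) (by nlinarith [sq_nonneg t]))

lemma evalAt_one_sub {A : Type*} [NormedRing A] [NormedAlgebra ℂ A] [CompleteSpace A] {F : A⟦X⟧}
    (hF : Summable fun n => ‖coeff n F‖) {z : ℂ} (hz : ‖z‖ ≤ 1) :
    evalAt (1 - F) z = 1 - evalAt F z := by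
  have h1 : Summable fun n => ‖coeff n (1 : A⟦X⟧)‖ :=
    summable_of_ne_finset_zero (s := {0}) fun n hn => by
      rw [coeff_one, if_neg (by simpa using hn)]; simp
  have h2 : Summable fun n => ‖coeff n (1 - F)‖ :=
    (h1.add hF).of_nonneg_of_le (fun _ => norm_nonneg _) fun n => by
      rw [map_sub]; exact norm_sub_le _ _
  have := evalAt_add h2 hF hz
  rw [sub_add_cancel, evalAt_one] at this
  rw [this, add_sub_cancel_right]

/-- A formal inverse of `1 - F` with bounded coefficients is an inverse in the open unit disk. -/
lemma isUnit_and_hasSum_inverse {A : Type*} [NormedRing A] [NormedAlgebra ℂ A] [CompleteSpace A]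
    {F T : A⟦X⟧} (hF : Summable fun n => ‖coeff n F‖) (hF0 : coeff 0 F = 0)
    (hT : (1 - F) * T = 1) {K : ℝ} (hTK : ∀ n, ‖coeff n T‖ ≤ K) {z : ℂ} (hz : ‖z‖ < 1) :
    IsUnit (1 - evalAt F z) ∧
      HasSum (fun n => z ^ n • coeff n T) (Ring.inverse (1 - evalAt F z)) := by
  have hc : constantCoeff (1 - F) = ((1 : Aˣ) : A) := by
    rw [← coeff_zero_eq_constantCoeff_apply, map_sub, hF0, coeff_zero_one]; simp
  have hT' : T * (1 - F) = 1 := by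
    have e := left_inv_eq_right_inv (invOfUnit_mul _ _ hc) hT
    rw [← e]; exact invOfUnit_mul _ _ hc
  have hs : Summable fun n => ‖z ^ n • coeff n T‖ := by
    refine ((summable_geometric_of_lt_one (norm_nonneg z) hz).mul_right K).of_nonneg_of_le
      (fun _ => norm_nonneg _) fun n => ?_
    rw [norm_smul, norm_pow]
    exact mul_le_mul_of_nonneg_left (hTK n) (by positivity)
  have hs1 : Summable fun n => ‖coeff n (1 - F)‖ := by
    have h1 : Summable fun n => ‖coeff n (1 : A⟦X⟧)‖ :=
      summable_of_ne_finset_zero (s := {0}) fun n hn => by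
        rw [coeff_one, if_neg (by simpa using hn)]; simp
    exact (h1.add hF).of_nonneg_of_le (fun _ => norm_nonneg _) fun n => by
      rw [map_sub]; exact norm_sub_le _ _
  have hs2 := summable_pow_smul_of_summable hs1 hz.le
  have e1 : (1 - evalAt F z) * evalAt T z = 1 := by
    rw [← evalAt_one_sub hF hz.le, ← evalAt_mul hs2 hs, hT, evalAt_one]
  have e2 : evalAt T z * (1 - evalAt F z) = 1 := by
    rw [← evalAt_one_sub hF hz.le, ← evalAt_mul hs hs2, hT', evalAt_one]
  set U : Aˣ := ⟨1 - evalAt F z, evalAt T z, e1, e2⟩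
  refine ⟨⟨U, rfl⟩, ?_⟩
  have : Ring.inverse (1 - evalAt F z) = evalAt T z := Ring.inverse_unit U
  rw [this]
  exact hs.of_norm.hasSum


/-- The regularized series depends in a Lipschitz way on the perturbation. -/
lemma unifBound_regularized_sub {A : Type*} [NormedRing A] {γ K : ℝ} {R : A⟦X⟧} {P : A}
    {R' : ℝ → A⟦X⟧} {P' : ℝ → A} (hR : Majorizes R (K • polyWeight γ))
    (hS : Majorizes (tailSeries R) (K • polyWeight γ))
    (hR' : UnifBound (𝓝 0) (fun t => R' t - R) fun t => |t| • polyWeight γ)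
    (hS' : UnifBound (𝓝 0) (fun t => tailSeries (R' t) - tailSeries R)
      fun t => |t| • polyWeight γ) {Kp : ℝ} (hKp : 0 ≤ Kp)
    (hP' : ∀ᶠ t in 𝓝 0, ‖P' t - P‖ ≤ Kp * |t|) :
    UnifBound (𝓝 0) (fun t => regularized (R' t) (P' t) - regularized R P)
      fun t => |t| • polyWeight γ := by
  have hle1 : ∀ᶠ t : ℝ in 𝓝 0, |t| ≤ 1 := tendsto_abs_zero.eventually_le_const one_pos
  have hP'n : ∀ᶠ t in 𝓝 0, ‖P' t‖ ≤ Kp + ‖P‖ := by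
    filter_upwards [hP', hle1] with t ht h1
    calc ‖P' t‖ = ‖(P' t - P) + P‖ := by rw [sub_add_cancel]
      _ ≤ Kp * |t| + ‖P‖ := (norm_add_le _ _).trans (by gcongr)
      _ ≤ _ := by gcongr; exact mul_le_of_le_one_right hKp h1
  have hQ'n : ∀ᶠ t in 𝓝 0, ‖1 - P' t‖ ≤ ‖(1 : A)‖ + (Kp + ‖P‖) := by
    filter_upwards [hP'n] with t ht
    exact (norm_sub_le _ _).trans (by gcongr)
  have h1 : UnifBound (𝓝 (0 : ℝ)) (fun _ => (C (1 : A) : A⟦X⟧)) fun _ => polyWeight γ :=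
    (majorizes_C le_rfl).unifBound (norm_nonneg _)
  have hRb : UnifBound (𝓝 (0 : ℝ)) (fun _ => R) fun _ => polyWeight γ :=
    hR.unifBound hR.const_nonneg
  have hSb : UnifBound (𝓝 (0 : ℝ)) (fun _ => tailSeries R) fun _ => polyWeight γ :=
    hS.unifBound hS.const_nonneg
  have b1 := h1.mul_C_of_le hKp hP'
  have b2 := hR'.mul_C (by positivity) hQ'n
  have b3 := hRb.mul_C_of_le hKp hP'
  have b4 := hS'.mul_C (by positivity) hP'n
  have b5 := hSb.mul_C_of_le hKp hP'
  refine ((((b3.sub b1).sub b2).add b4).add b5).congr (Eventually.of_forall fun t => ?_)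
  simp only [regularized_eq, map_sub, map_neg, map_one]
  noncomm_ring

end Assembly

/-! ### Compression to the rank-one range of `P`. -/

section Compression

open PowerSeries

/-- For a rank-one projection `P`, the compressions `P B P` are multiples of `P`. -/
lemma exists_compression {A : Type*} [NormedRing A] [NormedAlgebra ℂ A] {P : A}
    (hP0 : P ≠ 0) (hrank : ∀ B : A, ∃ s : ℂ, P * B * P = s • P) :
    ∃ φ : A → ℂ, (∀ B, P * B * P = φ B • P) ∧ ∀ B B', ‖φ B - φ B'‖ ≤ ‖P‖ * ‖B - B'‖ := by
  choose φ hφ using hrank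
  refine ⟨φ, hφ, fun B B' => ?_⟩
  have hn : 0 < ‖P‖ := norm_pos_iff.2 hP0
  refine le_of_mul_le_mul_right ?_ hn
  rw [← norm_smul, sub_smul, ← hφ, ← hφ, ← sub_mul, ← mul_sub]
  exact norm_mul₃_le

variable {A : Type*} [NormedRing A]

/-- The coefficientwise image of a power series. -/
noncomputable def compress (φ : A → ℂ) (F : A⟦X⟧) : ℂ⟦X⟧ :=
  PowerSeries.mk fun n => φ (coeff n F)

lemma coeff_compress (φ : A → ℂ) (F : A⟦X⟧) (n : ℕ) :
    coeff n (compress φ F) = φ (coeff n F) := by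
  simp [compress]

variable {P : A} {φ : A → ℂ}

lemma unifBound_compress_sub {ι : Type*} {l : Filter ι} {F G : ι → A⟦X⟧} {a : ι → ℝ⟦X⟧}
    (hφ : ∀ B B', ‖φ B - φ B'‖ ≤ ‖P‖ * ‖B - B'‖) (h : UnifBound l (fun t => F t - G t) a) :
    UnifBound l (fun t => compress φ (F t) - compress φ (G t)) a := by
  obtain ⟨K, hK, h⟩ := h
  refine ⟨‖P‖ * K, by positivity, h.mono fun t ht n => ?_⟩
  rw [map_sub, coeff_compress, coeff_compress, mul_smul]
  refine (hφ _ _).trans ?_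
  rw [coeff_smul, smul_eq_mul, ← map_sub]
  exact mul_le_mul_of_nonneg_left (ht n) (norm_nonneg _)

lemma majorizes_compress {F : A⟦X⟧} {a : ℝ⟦X⟧} (hφ : ∀ B B', ‖φ B - φ B'‖ ≤ ‖P‖ * ‖B - B'‖)
    (h0 : φ 0 = 0) (h : Majorizes F a) : Majorizes (compress φ F) (‖P‖ • a) := fun n => by
  have := hφ (coeff n F) 0
  rw [h0, sub_zero, sub_zero] at this
  rw [coeff_compress, coeff_smul, smul_eq_mul]
  exact this.trans (mul_le_mul_of_nonneg_left (h n) (norm_nonneg _))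

lemma evalAt_compress_one [NormedAlgebra ℂ A] [CompleteSpace A] {F : A⟦X⟧} {ν : ℂ} (hP0 : P ≠ 0) (hP : P * P = P)
    (hφ : ∀ B, P * B * P = φ B • P) (hF : Summable fun n => ‖coeff n F‖)
    (hc : Summable fun n => ‖coeff n (compress φ F)‖) (hν : P * evalAt F 1 = ν • P) :
    evalAt (compress φ F) 1 = ν := by
  have e : evalAt (compress φ F) 1 • P = ν • P := by
    have e1 : P * evalAt F 1 * P = ν • P := by rw [hν, smul_mul_assoc, hP]
    rw [← e1]
    unfold evalAt
    simp only [one_pow, one_smul]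
    rw [← hF.of_norm.tsum_mul_left, ← (hF.of_norm.mul_left P).tsum_mul_right,
      ← hc.of_norm.tsum_smul_const]
    exact tsum_congr fun n => by rw [coeff_compress, hφ]
  exact smul_left_injective ℂ hP0 e

end Compression

/-! ### The expansion for small `t`. -/

section Main

open PowerSeries

/-- The expansion of the inverse of `1 - R(z,t)` when the simple eigenvalue `1` of `R(1)` is
perturbed to `1 - M t`, with `M t` quadratic in `t`. -/
theorem exists_inverse_expansion_of_perturbation {E : Type*} [NormedAddCommGroup E] [NormedSpace ℂ E] [CompleteSpace E]
    {β : ℝ} (hβ : 2 < β) {R : ℕ → E →L[ℂ] E} (hRsum : Summable fun k : ℕ => ‖R (k + 1)‖)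
    (hRtail : normTail R =O[atTop] fun n : ℕ => 1 / (n : ℝ) ^ β)
    {P : E →L[ℂ] E} (hP : SimpleEigenvalueData (opSeries R 1) P)
    (hRinv : ∀ z : ℂ, ‖z‖ ≤ 1 → z ≠ 1 → IsUnit (1 - opSeries R z))
    {μ : ℝ} (hμ : 0 < μ) (hPR : P * opSeriesDerivOne R * P = (μ : ℂ) • P)
    {Rt : ℝ → ℕ → E →L[ℂ] E}
    (hRtsum : ∀ᶠ t in 𝓝 (0 : ℝ), Summable fun k : ℕ => ‖Rt t (k + 1) - R (k + 1)‖)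
    {C₀ : ℝ} (hC₀ : 0 ≤ C₀)
    (hRttail : ∀ᶠ t in 𝓝 (0 : ℝ), ∀ n : ℕ,
      normTail (fun k => Rt t k - R k) n ≤ C₀ * |t| * coeff n (polyWeight (β - 1)))
    {M : ℝ → ℂ}
    (hM : ∀ᶠ t in 𝓝 (0 : ℝ),
      Module.End.HasEigenvalue (opSeries (Rt t) 1 : Module.End ℂ E) (1 - M t))
    {c : ℂ} (hc : 0 < c.re) (hMc : M ~[𝓝 (0 : ℝ)] fun t : ℝ => c * (t : ℂ) ^ 2) :
    ∃ (d K : ℝ) (T : ℝ → (E →L[ℂ] E)⟦X⟧), 0 < d ∧ 0 ≤ K ∧ ∀ᶠ t in 𝓝 (0 : ℝ),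
      (∀ z : ℂ, ‖z‖ < 1 → IsUnit (1 - opSeries (Rt t) z) ∧
        HasSum (fun n : ℕ => z ^ n • coeff n (T t)) (Ring.inverse (1 - opSeries (Rt t) z))) ∧
      ∀ n, ‖coeff n (T t) - ((μ : ℂ)⁻¹ * (1 - (μ : ℂ)⁻¹ * M t) ^ n) • P‖ ≤
        K * (coeff n (polyWeight (β - 1)) + |t| * coeff n (mixedWeight (β - 1) d t)) := by
  have : Nontrivial E := by
    obtain ⟨x, hx⟩ : ∃ x, P x ≠ 0 := by
      by_contra! hn
      exact hP.ne_zero (ContinuousLinearMap.ext hn)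
    exact ⟨_, _, hx⟩
  set γ : ℝ := β - 1 with hγdef
  have hγ : 1 < γ := by linarith
  have hγβ : γ + 1 = β := by rw [hγdef]; ring
  have hμ' : (μ : ℂ) ≠ 0 := by exact_mod_cast hμ.ne'
  -- the unperturbed series
  set F := seriesOf R with hF
  have hFs := summable_seriesOf hRsum
  obtain ⟨K₀, hK₀, hK₀n⟩ := exists_normTail_le (by linarith) hRtail
  obtain ⟨K, hK, hFb, hSb⟩ : ∃ K : ℝ, 0 ≤ K ∧ Majorizes F (K • polyWeight β) ∧
      Majorizes (tailSeries F) (K • polyWeight β) := by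
    refine ⟨2 ^ β * K₀, by positivity, majorizes_seriesOf (by linarith) hK₀ hRsum hK₀n,
      (majorizes_tailSeries_seriesOf hRsum hK₀n).trans
        (CoeffLE.smul_right ?_ (polyWeight_nonneg β))⟩
    exact le_mul_of_one_le_left hK₀ (Real.one_le_rpow (by norm_num) (by linarith))
  have hFe : evalAt F 1 = opSeries R 1 := evalAt_seriesOf R 1
  have hSs : Summable fun n => ‖coeff n (tailSeries F)‖ := hSb.summable (by linarith)
  obtain ⟨H, hGH, hHG, ⟨KH, hHb⟩, hPH⟩ := exists_inverse_regularized (P := P) (μ := μ) hβ hFb hSb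
    (coeff_zero_seriesOf R) hP.idem (by rw [hFe, hP.mul_proj]) (by rw [hFe, hP.proj_mul])
    (by rw [hFe]; exact hP.isUnit) (fun z hz hz1 => by rw [evalAt_seriesOf]; exact hRinv z hz hz1)
    hμ' (by rw [← opSeriesDerivOne_eq hRsum hSs]; exact hPR)
  -- The perturbation is controlled only at rate `γ = β - 1`, so comparisons with it take place
  -- there.
  have hwβ : CoeffLE (polyWeight β) (polyWeight γ) := polyWeight_anti (by linarith)
  have hFγ := hFb.trans (hwβ.smul hK)
  have hSγ := hSb.trans (hwβ.smul hK)
  have hHγ := hHb.trans (hwβ.smul hHb.const_nonneg)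
  -- the perturbed series
  set F' : ℝ → (E →L[ℂ] E)⟦X⟧ := fun t => seriesOf (Rt t) with hF'
  have hF's : ∀ᶠ t in 𝓝 (0 : ℝ), Summable fun n => ‖coeff n (F' t)‖ := by
    filter_upwards [hRtsum] with t ht
    refine summable_seriesOf ((ht.add hRsum).of_nonneg_of_le (fun _ => norm_nonneg _) fun n => ?_)
    calc ‖Rt t (n + 1)‖ = ‖(Rt t (n + 1) - R (n + 1)) + R (n + 1)‖ := by rw [sub_add_cancel]
      _ ≤ _ := norm_add_le _ _
  have hF'b : UnifBound (𝓝 0) (fun t => F' t - F) fun t => |t| • polyWeight γ := by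
    refine ⟨2 ^ γ * C₀, by positivity, ?_⟩
    filter_upwards [hRtsum, hRttail] with t h1 h2
    rw [hF, hF', ← seriesOf_sub, smul_smul, mul_assoc]
    exact majorizes_seriesOf (by linarith) (by positivity) h1 h2
  have hS'b : UnifBound (𝓝 0) (fun t => tailSeries (F' t) - tailSeries F)
      fun t => |t| • polyWeight γ := by
    refine ⟨C₀, hC₀, ?_⟩
    filter_upwards [hRtsum, hRttail, hF's] with t h1 h2 h3
    change Majorizes (tailSeries (seriesOf (Rt t)) - tailSeries (seriesOf R)) _
    rw [← tailSeries_sub h3 hFs, ← seriesOf_sub, smul_smul]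
    exact majorizes_tailSeries_seriesOf h1 h2
  -- the perturbed projection
  obtain ⟨KM, hKM, hMb⟩ := exists_norm_le_sq hMc
  have hle1 : ∀ᶠ t : ℝ in 𝓝 0, |t| ≤ 1 := tendsto_abs_zero.eventually_le_const one_pos
  have hsmall : ∀ᶠ t in 𝓝 (0 : ℝ),
      ‖M t‖ + ‖opSeries (Rt t) 1 - opSeries R 1‖ ≤ (KM + C₀) * |t| := by
    filter_upwards [hRtsum, hRttail, hMb, hle1, hF's] with t h1 h2 h3 h4 h5
    have e : opSeries (Rt t) 1 - opSeries R 1 = opSeries (fun k => Rt t k - R k) 1 := by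
      rw [← evalAt_seriesOf, ← evalAt_seriesOf, ← evalAt_seriesOf, seriesOf_sub]
      unfold evalAt
      rw [← (summable_pow_smul_of_summable h5 (by simp)).of_norm.tsum_sub
        (summable_pow_smul_of_summable hFs (by simp)).of_norm]
      simp only [map_sub, smul_sub, F']
    have h6 := (norm_opSeries_one_le (R := fun k => Rt t k - R k) h1).trans (h2 0)
    rw [coeff_polyWeight] at h6
    rw [e, add_mul]
    refine add_le_add (h3.trans (mul_le_mul_of_nonneg_left ?_ hKM)) (by simpa using h6)
    rw [← sq_abs]; nlinarith [abs_nonneg t]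
  obtain ⟨Kp, δ, hKp, hδ, hpert⟩ := hP.exists_perturbed_projection
  have hP'ex : ∀ᶠ t in 𝓝 (0 : ℝ), ∃ P' : E →L[ℂ] E, P' * P' = P' ∧ P * P' = P ∧ P' * P = P' ∧
      opSeries (Rt t) 1 * P' = (1 - M t) • P' ∧ ‖P' - P‖ ≤ Kp * (KM + C₀) * |t| := by
    have hlim : ∀ᶠ t : ℝ in 𝓝 0, (KM + C₀) * |t| < δ := by
      have : Tendsto (fun t : ℝ => (KM + C₀) * |t|) (𝓝 0) (𝓝 ((KM + C₀) * 0)) :=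
        tendsto_abs_zero.const_mul _
      exact this.eventually_lt_const (by simpa using hδ)
    filter_upwards [hM, hsmall, hlim] with t h1 h2 h3
    obtain ⟨P', p1, p2, p3, p4, p5⟩ := hpert _ _ h1 (h2.trans h3.le)
    refine ⟨P', p1, p2, p3, p4, p5.trans ?_⟩
    rw [mul_assoc]
    exact mul_le_mul_of_nonneg_left h2 hKp
  obtain ⟨P', hP'⟩ := hP'ex.choice
  have hP'b : ∀ᶠ t in 𝓝 0, ‖P' t - P‖ ≤ Kp * (KM + C₀) * |t| := hP'.mono fun t h => h.2.2.2.2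
  have hKp' : 0 ≤ Kp * (KM + C₀) := by positivity
  -- the inverse of the perturbed regularization
  have hGb := unifBound_regularized_sub hFγ hSγ hF'b hS'b hKp' hP'b
  -- A formal inverse needs only an invertible constant term, and units form an open set.
  have hH'ex : ∀ᶠ t in 𝓝 (0 : ℝ), ∃ H' : (E →L[ℂ] E)⟦X⟧, regularized (F' t) (P' t) * H' = 1 := by
    have hu : IsUnit (constantCoeff (regularized F P)) :=
      ⟨⟨_, constantCoeff H, by rw [← map_mul, hGH, map_one], by rw [← map_mul, hHG, map_one]⟩,
        rfl⟩
    have hlim : Tendsto (fun t => constantCoeff (regularized (F' t) (P' t))) (𝓝 0)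
        (𝓝 (constantCoeff (regularized F P))) := by
      obtain ⟨CG, -, hG⟩ := hGb
      rw [tendsto_iff_norm_sub_tendsto_zero]
      have hz : Tendsto (fun t : ℝ => CG * |t|) (𝓝 0) (𝓝 0) := by
        simpa using tendsto_abs_zero.const_mul CG
      refine squeeze_zero' (Eventually.of_forall fun _ => norm_nonneg _) ?_ hz
      filter_upwards [hG] with t ht
      have := ht 0
      simpa [coeff_polyWeight] using this
    filter_upwards [hlim (Units.isOpen.mem_nhds hu)] with t ht
    obtain ⟨u, hu⟩ := ht
    exact ⟨_, mul_invOfUnit _ u hu.symm⟩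
  obtain ⟨H', hH'⟩ := hH'ex.choice
  have hH'b := unifBound_inverse_sub hγ hHG hHγ hGb hH'
  -- the compressed scalar series and its inverse
  obtain ⟨φ, hφ, hφL⟩ := exists_compression hP.ne_zero hP.exists_smul
  have hφ0 : φ 0 = 0 := by
    have h1 := hφ 0
    rw [mul_zero, zero_mul, eq_comm, smul_eq_zero] at h1
    exact h1.resolve_right hP.ne_zero
  set h₀ : ℂ⟦X⟧ := compress φ H with hh₀
  set h : ℝ → ℂ⟦X⟧ := fun t => compress φ (H' t * C (P' t)) with hh
  have hh₀b : Majorizes h₀ ((‖P‖ * KH) • polyWeight (γ + 1)) := by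
    rw [mul_smul, hγβ]; exact majorizes_compress hφL hφ0 hHb
  have hh₀s : Summable fun n => ‖coeff n h₀‖ := hh₀b.summable (by linarith)
  have hHs : Summable fun n => ‖coeff n H‖ := hHb.summable (by linarith)
  have hh₀1 : evalAt h₀ 1 = (μ : ℂ)⁻¹ :=
    evalAt_compress_one hP.ne_zero hP.idem hφ hHs hh₀s hPH
  -- Inserting `P` makes `h - h₀` the compression of `H' P' - H P`, which is `O(|t|)`.
  have hh₀C : h₀ = compress φ (H * C P) := by
    ext n
    rw [coeff_compress, coeff_compress, coeff_mul_C]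
    refine smul_left_injective ℂ hP.ne_zero ?_
    dsimp only
    rw [← hφ, ← hφ, mul_assoc P, mul_assoc P, mul_assoc _ P P, hP.idem]
  have hhb : UnifBound (𝓝 0) (fun t => h t - h₀) fun t => |t| • polyWeight γ := by
    rw [hh₀C]
    refine unifBound_compress_sub hφL (F := fun t => H' t * C (P' t)) (G := fun _ => H * C P) ?_
    have hP'n : ∀ᶠ t in 𝓝 0, ‖P' t‖ ≤ Kp * (KM + C₀) + ‖P‖ := by
      filter_upwards [hP'b, hle1] with t ht h1
      calc ‖P' t‖ = ‖(P' t - P) + P‖ := by rw [sub_add_cancel]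
        _ ≤ Kp * (KM + C₀) * |t| + ‖P‖ := (norm_add_le _ _).trans (by gcongr)
        _ ≤ _ := add_le_add (mul_le_of_le_one_right hKp' h1) le_rfl
    have b1 := hH'b.mul_C (by positivity) hP'n
    have b2 := (hHγ.unifBound (l := 𝓝 (0 : ℝ)) hHγ.const_nonneg).mul_C_of_le hKp' hP'b
    refine (b1.add b2).congr (Eventually.of_forall fun t => ?_)
    rw [sub_mul, map_sub, mul_sub]; abel
  have hyex : ∀ᶠ t in 𝓝 (0 : ℝ), ∃ y : ℂ⟦X⟧, (1 - X + M t • h t) * y = 1 := by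
    obtain ⟨Ch, hCh, hhC⟩ := hhb
    have hlim : ∀ᶠ t : ℝ in 𝓝 0, KM * |t| * (Ch + ‖coeff 0 h₀‖) < 1 := by
      have : Tendsto (fun t : ℝ => KM * |t| * (Ch + ‖coeff 0 h₀‖)) (𝓝 0)
          (𝓝 (KM * 0 * (Ch + ‖coeff 0 h₀‖))) := (tendsto_abs_zero.const_mul _).mul_const _
      exact this.eventually_lt_const (by simp)
    filter_upwards [hhC, hMb, hle1, hlim] with t h1 h2 h3 h4
    have e0 : constantCoeff (1 - X + M t • h t) = 1 + M t * coeff 0 (h t) := by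
      rw [← coeff_zero_eq_constantCoeff_apply, map_add, map_sub, coeff_smul, coeff_zero_one,
        coeff_zero_X, smul_eq_mul, sub_zero]
    have hb : ‖coeff 0 (h t)‖ ≤ Ch + ‖coeff 0 h₀‖ := by
      have h5 := h1 0
      simp only [coeff_smul, smul_eq_mul, coeff_polyWeight, map_sub] at h5
      have h6 : ‖coeff 0 (h t) - coeff 0 h₀‖ ≤ Ch * |t| := by simpa using h5
      calc ‖coeff 0 (h t)‖ = ‖(coeff 0 (h t) - coeff 0 h₀) + coeff 0 h₀‖ := by rw [sub_add_cancel]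
        _ ≤ Ch * |t| + ‖coeff 0 h₀‖ := (norm_add_le _ _).trans (by gcongr)
        _ ≤ _ := by gcongr; exact mul_le_of_le_one_right hCh h3
    have hne : constantCoeff (1 - X + M t • h t) ≠ 0 := by
      rw [e0]
      intro h7
      have h8 : ‖M t * coeff 0 (h t)‖ = 1 := by
        rw [eq_neg_of_add_eq_zero_right h7, norm_neg, norm_one]
      have h9 : ‖M t‖ ≤ KM * |t| := h2.trans (by
        gcongr; rw [← sq_abs]; nlinarith [abs_nonneg t])
      rw [norm_mul] at h8
      have := mul_le_mul h9 hb (norm_nonneg _) (by positivity)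
      linarith
    exact ⟨_, PowerSeries.mul_inv_cancel _ hne⟩
  obtain ⟨y, hy⟩ := hyex.choice
  set d : ℝ := c.re / (8 * μ) with hd
  have hd0 : 0 < d := by positivity
  have hq := eventually_norm_one_sub_le hμ hc hMc
  have hu := hh₀b.tailSeries hγ.le
  have hyb := unifBound_scalar_inverse_sub hγ hd0 hKM hMb hq
    (by rw [← hh₀1]; exact eq_C_sub_tailSeries hh₀s) hu hhb hy
  have hTb := unifBound_inverse_sub_geometric hγ hd0 hKM hMb hq (P := P)
    (by rw [hγβ]; exact hHb) hPH hKp' hP'b hH'b hyb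
  set T : ℝ → (E →L[ℂ] E)⟦X⟧ := fun t =>
    C (1 - P' t) * H' t + (C (P' t) - M t • (C (1 - P' t) * H' t * C (P' t))) *
      PowerSeries.map (algebraMap ℂ (E →L[ℂ] E)) (y t) * H' t with hT
  have hT1 : ∀ᶠ t in 𝓝 (0 : ℝ), (1 - F' t) * T t = 1 := by
    filter_upwards [hF's, hP', hH', hy] with t h1 h2 h3 h4
    obtain ⟨p1, p2, p3, p4, -⟩ := h2
    refine one_sub_mul_inverse_eq_one h1 p1 (by rw [evalAt_seriesOf, p4]) h3 ?_ h4
    ext1 n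
    rw [coeff_mul_C, coeff_C_mul, coeff_mul_C, coeff_map, coeff_compress, coeff_mul_C,
      ← Algebra.smul_def]
    -- `φ` is defined through `P`; multiplying by `P'` on both sides and using `P' * P = P'`
    -- transfers the compression to the range of `P'`.
    have e := congrArg (fun B => P' t * B * P' t) (hφ (coeff n (H' t) * P' t))
    simp only [mul_smul_comm, smul_mul_assoc, p3, p1] at e
    rw [← e]
    calc P' t * coeff n (H' t) * P' t
        = (P' t * P) * coeff n (H' t) * (P' t * P) * P' t := by
          rw [p3, mul_assoc _ (P' t) (P' t), p1]
      _ = _ := by simp only [mul_assoc]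
  obtain ⟨KT, hKT, hTb⟩ := hTb
  obtain ⟨W, hW, hWb⟩ := exists_coeff_mixedWeight_le hγ hd0
  have hbound : ∀ᶠ t in 𝓝 (0 : ℝ), ∀ n,
      ‖coeff n (T t) - ((μ : ℂ)⁻¹ * (1 - (μ : ℂ)⁻¹ * M t) ^ n) • P‖ ≤
        KT * (coeff n (polyWeight γ) + |t| * coeff n (mixedWeight γ d t)) := by
    filter_upwards [hTb] with t ht n
    have := ht n
    rw [map_sub, coeff_mul_C, coeff_map, coeff_smul, coeff_mk, smul_eq_mul,
      ← Algebra.smul_def, coeff_smul, smul_eq_mul, map_add _ (polyWeight γ), coeff_smul,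
      smul_eq_mul] at this
    exact this
  refine ⟨d, KT, T, hd0, hKT, ?_⟩
  filter_upwards [hbound, hT1, hF's, hWb, hle1, hq, mixedWeight_nonneg γ d] with t h1 h2 h3 h4 h5 h6 h7
  refine ⟨fun z hz => ?_, h1⟩
  -- Bounded coefficients make the formal inverse converge, hence a true inverse, on the open disk.
  have hbd : ∀ n, ‖coeff n (T t)‖ ≤ KT * (1 + W) + ‖(μ : ℂ)⁻¹‖ * ‖P‖ := by
    intro n
    have hw : coeff n (polyWeight γ) ≤ 1 := by
      rw [coeff_polyWeight]
      refine div_le_one_of_le₀ (Real.one_le_rpow ?_ (by linarith)) (by positivity)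
      linarith [n.cast_nonneg (α := ℝ)]
    have hq1 : ‖(1 - (μ : ℂ)⁻¹ * M t) ^ n‖ ≤ 1 := by
      rw [norm_pow]
      refine pow_le_one₀ (norm_nonneg _) (h6.trans ?_)
      have : 0 ≤ 2 * (c.re / (8 * μ)) * t ^ 2 := by positivity
      linarith
    have hv : |t| * coeff n (mixedWeight γ d t) ≤ W :=
      (mul_le_mul h5 (h4 n) (by simpa using h7 n) zero_le_one).trans (one_mul W).le
    calc ‖coeff n (T t)‖ = ‖(coeff n (T t) - ((μ : ℂ)⁻¹ * (1 - (μ : ℂ)⁻¹ * M t) ^ n) • P) +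
          ((μ : ℂ)⁻¹ * (1 - (μ : ℂ)⁻¹ * M t) ^ n) • P‖ := by rw [sub_add_cancel]
      _ ≤ KT * (1 + W) + ‖(μ : ℂ)⁻¹‖ * 1 * ‖P‖ := by
          refine (norm_add_le _ _).trans (add_le_add ((h1 n).trans (by gcongr)) ?_)
          rw [norm_smul, norm_mul]
          gcongr
      _ = _ := by rw [mul_one]
  have := isUnit_and_hasSum_inverse h3 (coeff_zero_seriesOf _) h2 hbd hz
  rwa [evalAt_seriesOf] at this

end Main

/-! ### The final statement. -/

theorem theorem3p1 {E : Type*} [NormedAddCommGroup E] [NormedSpace ℂ E] [CompleteSpace E]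
    (β : ℝ) (hβ : 2 < β)
    (R : ℕ → E →L[ℂ] E)
    (hRsum : Summable fun k : ℕ => ‖R (k + 1)‖)
    (hRtail : normTail R =O[atTop] fun n : ℕ => 1 / (n : ℝ) ^ β)
    (P : E →L[ℂ] E) (hP : IsSimpleIsolatedEigenvalue (opSeries R 1) 1 P)
    (hRinv : ∀ z : ℂ, ‖z‖ ≤ 1 → z ≠ 1 → IsUnit (1 - opSeries R z))
    (μ : ℝ) (hμ : 0 < μ) (hPR : P * opSeriesDerivOne R * P = (μ : ℂ) • P)
    (α : ℝ) (hα : 0 < α)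
    (Rt : ℝ → ℕ → E →L[ℂ] E)
    (hRtsum : ∀ t ∈ Set.Icc (-α) α, Summable fun k : ℕ => ‖Rt t (k + 1) - R (k + 1)‖)
    (C₀ : ℝ)
    (hRttail : ∀ t ∈ Set.Icc (-α) α, ∀ n : ℕ,
      normTail (fun k => Rt t k - R k) n ≤ C₀ * |t| / ((n : ℝ) + 1) ^ (β - 1))
    (lam : ℂ → ℝ → ℂ) (hlam : IsEigenvalueCloseToOne Rt lam)
    (M : ℝ → ℂ) (hM : ∀ᶠ t in 𝓝 (0 : ℝ), lam 1 t = 1 - M t)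
    (c : ℂ) (hc : 0 < c.re)
    (hMc : M ~[𝓝 (0 : ℝ)] fun t : ℝ => c * (t : ℂ) ^ 2) :
    ∃ α' d C : ℝ, 0 < α' ∧ α' ≤ α ∧ 0 < d ∧ 0 < C ∧
      ∃ T : ℝ → ℕ → E →L[ℂ] E, ∀ t ∈ Set.Icc (-α') α',
        (∀ z : ℂ, ‖z‖ < 1 →
          IsUnit (1 - opSeries (Rt t) z) ∧
          HasSum (fun n : ℕ => z ^ n • T t n) (Ring.inverse (1 - opSeries (Rt t) z))) ∧
        ∀ n : ℕ, 1 ≤ n →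
          ‖T t n - ((μ : ℂ)⁻¹ * (1 - (μ : ℂ)⁻¹ * M t) ^ n) • P‖ ≤
            C / (n : ℝ) ^ (β - 1) +
              C * |t| * seqConv (fun k => 1 / ((k : ℝ) + 1) ^ (β - 1))
                (fun k => (1 - d * t ^ 2) ^ k) n := by
  have hIcc : ∀ᶠ t in 𝓝 (0 : ℝ), t ∈ Set.Icc (-α) α := Icc_mem_nhds (by linarith) hα
  have hlim : Tendsto (fun t : ℝ => ((1 : ℂ), t)) (𝓝 0)
      (𝓝[Metric.closedBall 0 1 ×ˢ Set.univ] (1, 0)) := by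
    refine tendsto_nhdsWithin_iff.2 ⟨Continuous.tendsto (by fun_prop) 0, ?_⟩
    exact Eventually.of_forall fun t => by simp
  have hMeig : ∀ᶠ t in 𝓝 (0 : ℝ),
      Module.End.HasEigenvalue (opSeries (Rt t) 1 : Module.End ℂ E) (1 - M t) := by
    filter_upwards [hlim.eventually hlam.1, hM] with t h1 h2
    rwa [← h2]
  obtain ⟨d, K, T, hd, hK, h⟩ := exists_inverse_expansion_of_perturbation hβ hRsum hRtail hP.data hRinv hμ hPR
    (hIcc.mono hRtsum) (abs_nonneg C₀) (by
      filter_upwards [hIcc] with t ht n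
      refine (hRttail t ht n).trans ?_
      rw [coeff_polyWeight, mul_one_div]
      gcongr
      exact le_abs_self _) hMeig hc hMc
  obtain ⟨ε, hε, hball⟩ := Metric.eventually_nhds_iff.1
    (h.and ((mixedWeight_nonneg (β - 1) d).and hIcc))
  -- `ε / 2` puts the closed interval inside the open ball of radius `ε`; `K + 1` makes the constant
  -- strictly positive.
  refine ⟨min α (ε / 2), d, K + 1, lt_min hα (by linarith), min_le_left _ _, hd, by linarith,
    fun t n => PowerSeries.coeff n (T t), fun t ht => ?_⟩
  obtain ⟨⟨h1, h2⟩, hnn, -⟩ := hball (y := t) (by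
    rw [Real.dist_eq, sub_zero]
    have := abs_le.2 ⟨ht.1, ht.2⟩
    linarith [min_le_right α (ε / 2)])
  refine ⟨h1, fun n hn => (h2 n).trans ?_⟩
  have hconv : seqConv (fun k => 1 / ((k : ℝ) + 1) ^ (β - 1)) (fun k => (1 - d * t ^ 2) ^ k) n =
      PowerSeries.coeff n (mixedWeight (β - 1) d t) := by
    rw [mixedWeight, PowerSeries.coeff_mul, Finset.Nat.sum_antidiagonal_eq_sum_range_succ_mk]
    simp only [coeff_polyWeight, geomSq, coeff_geomWeight, seqConv]
  have hn0 : (0 : ℝ) < n := by exact_mod_cast hn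
  have hv : 0 ≤ PowerSeries.coeff n (mixedWeight (β - 1) d t) := by simpa using hnn n
  have hw : PowerSeries.coeff n (polyWeight (β - 1)) ≤ 1 / (n : ℝ) ^ (β - 1) := by
    rw [coeff_polyWeight]
    exact one_div_le_one_div_of_le (by positivity)
      (Real.rpow_le_rpow hn0.le (by linarith) (by linarith))
  rw [hconv, mul_add, ← mul_assoc, ← mul_one_div (K + 1)]
  exact add_le_add (mul_le_mul (by linarith) hw (coeff_polyWeight_pos _ n).le (by linarith))
    (mul_le_mul_of_nonneg_right
      (mul_le_mul_of_nonneg_right (by linarith) (abs_nonneg t)) hv)
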